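/- Let $n\ge 1$ and let $V$ be an $(n+1)$-dimensional Euclidean space, with closed unit ball $\bar B^{n+1}$ and unit sphere $S^n$. Let $\mathcal C$ be the Clifford algebra of $V$ with $v^2=\|v\|^2$ for $v\in V$, with principal automorphism $\pi$ ($\pi(v)=-v$), principal anti-automorphism $\tau$, $a\mapsto a^\tau$ ($v^\tau=v$), $a^\nu=\pi(a)^\tau$, $\Delta(a)=a^\nu a$, and scalar part $\Phi:\mathcal C\to\mathbb R$. Let $V^1=\mathbb R\oplus V\subset\mathcal C$, with the quadratic form $Q^1(x^0+v)=(x^0)^2-\|v\|^2$ of signature $(1,n+1)$. Put $$\mathcal G=\{a\in\mathcal C:\ \Delta(a)=1,\ \text{and for every } w\in V^1 \text{ there is } w'\in V^1 \text{ with } aw=w'\pi(a)\}.$$ Let $\gamma$ be the algebra homomorphism from the Clifford algebra of $(V^1,Q^1)$ to the $2\times2$ matrices over $\mathcal C$ with $\gamma(x^0+v)=\begin{pmatrix}0&x^0+v\\x^0-v&0\end{pmatrix}$, and let $\psi^+$ be the upper left entry of $\gamma$, restricted to the even subalgebra. Then $\mathcal G=\psi^+(Spin^+(V^1,Q^1))$,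 where $Spin^+(V^1,Q^1)$ consists of the even elements $g$ with $g^\nu g=1$ and $gV^1g^{-1}=V^1$. Put $\sigma_g(w)=gwg^\tau$ and $P(x)=1+x$ for $x\in\bar B^{n+1}$. (i) For $g\in\mathcal G$ and $x\in\bar B^{n+1}$ one has $\Phi(\sigma_g(P(x)))>0$, and $$\varphi_g(x)=P^{-1}\left(\frac{\sigma_g(P(x))}{\Phi(\sigma_g(P(x)))}\right)$$ is a well-defined point of $\bar B^{n+1}$. The map $g\mapsto\varphi_g$ is a homomorphism from $\mathcal G$ to the group of bijections of $\bar B^{n+1}$. (ii) Let $u\in V$ with $\|u\|=1$ and $0\le\alpha<1$. Then $m=(1+\alpha u)/\sqrt{1-\alpha^2}$ is a spin-boost, that is, an element of $\mathcal G$ with $m=m^\tau$ and $\Phi(v^\tau m v)\ge0$ for all $v\in\mathcal C$, and for all $x\in\bar B^{n+1}$ $$\varphi_m(x)=\frac{(1-\alpha^2)x+2\alpha(1+\alpha\,u\cdot x)u}{1+\alpha^2+2\alpha\,u\cdot x}.$$ (iii) Restricted to $S^n$, $\varphi$ is a two-fold covering homomorphism from $\mathcal G$ (with its topology as a subset of $\mathcal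 C$) onto the group of orientation-preserving Möbius transformations of $S^n$ (with the topology of uniform convergence), that is, of the bijections of $S^n$ that preserve all cross-ratios $\frac{d(a,x)\,d(b,y)}{d(a,b)\,d(x,y)}$, $a\ne b$, $x\neq y$, where $d(x,y)=\|x-y\|$, and the orientation of $S^n$. (iv) With $m,\alpha,u$ as in (ii), put $\rho(x)=\dfrac{1-\alpha^2}{1+\alpha^2+2\alpha\,u\cdot x}$. Then $\varphi_m$ restricts to a smooth diffeomorphism of $S^n$ that is conformal with factor $\rho>0$: $\varphi_m^*G=\rho^2G$ for the natural Riemannian metric $G$ of $S^n$. For the volume form $dS$ of $S^n$ one has $\varphi_m^*(dS)=\rho^n\,dS$ on $S^n$, and for the Euclidean volume form $dV$ of $V$ one has $\varphi_m^*(dV)=\rho^{n+2}\,dV$ on the ball. -/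

import Mathlib

open Metric Set
open scoped Manifold ContDiff

noncomputable section

namespace SpinMobius

/-! ### The Clifford algebras `C = C(V, Q)` and `C¹ = C(V¹, Q¹)` -/

section Clifford

variable (V : Type*) [NormedAddCommGroup V] [InnerProductSpace ℝ V]

/-- The Euclidean quadratic form `Q v = ⟪v, v⟫` of `V`. -/
def quadForm : QuadraticForm ℝ V := LinearMap.BilinMap.toQuadraticMap (innerₗ V)

/-- The Clifford algebra `C = C(V, Q)`, in which `v * v = Q v`. -/
abbrev Cl : Type _ := CliffordAlgebra (quadForm V)

/-- The inclusion of `V` in `C`. -/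
abbrev vec : V →ₗ[ℝ] Cl V := CliffordAlgebra.ι (quadForm V)

variable {V}

/-- The principal automorphism, `v ↦ -v` on vectors. -/
abbrev prinAut (a : Cl V) : Cl V := CliffordAlgebra.involute a

/-- The principal anti-automorphism, `v ↦ v` on vectors. -/
abbrev tau (a : Cl V) : Cl V := CliffordAlgebra.reverse a

/-- The anti-automorphism `v ↦ -v` on vectors. -/
abbrev nu (a : Cl V) : Cl V := tau (prinAut a)

/-- The norm function `Δ(a) = a^ν a`. -/
def normFun (a : Cl V) : Cl V := nu a * a

/-- The scalar part of `a`: its degree zero component under the canonical linear isomorphism of the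
Clifford algebra with the exterior algebra. -/
def scalarPart (a : Cl V) : ℝ :=
  ExteriorAlgebra.algebraMapInv (CliffordAlgebra.equivExterior (quadForm V) a)

variable (V)

/-- The space `V¹ = ℝ ⊕ V ⊆ C` of paravectors. -/
def paravectors : Submodule ℝ (Cl V) :=
  LinearMap.range (Algebra.linearMap ℝ (Cl V)) ⊔ LinearMap.range (vec V)

/-- The quadratic form `Q¹ (x₀, v) = x₀² - Q v` on `ℝ × V`. -/
def quadForm1 : QuadraticForm ℝ (ℝ × V) :=
  (QuadraticMap.sq (R := ℝ)).prod (-(quadForm V))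

/-- The Clifford algebra `C¹ = C(V¹, Q¹)`. -/
abbrev Cl1 : Type _ := CliffordAlgebra (quadForm1 V)

/-- The group `Spin⁺(V¹, Q¹)`, as a subset of `C¹`: the invertible even elements `g` with
`g^ν g = 1` and `g V¹ g⁻¹ = V¹`. -/
def spinPlus : Set (Cl1 V) :=
  {g | g ∈ CliffordAlgebra.even (quadForm1 V) ∧
    CliffordAlgebra.reverse (CliffordAlgebra.involute g) * g = 1 ∧
    ∃ u : (Cl1 V)ˣ, (u : Cl1 V) = g ∧
      (fun x : Cl1 V => (u : Cl1 V) * x * ((u⁻¹ : (Cl1 V)ˣ) : Cl1 V)) ''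
        range (CliffordAlgebra.ι (quadForm1 V)) = range (CliffordAlgebra.ι (quadForm1 V))}

/-- The linear map `(x₀, v) ↦ !![0, x₀ + v; x₀ - v, 0]` from `V¹` to the matrices over `C`. -/
def gammaLin : (ℝ × V) →ₗ[ℝ] Matrix (Fin 2) (Fin 2) (Cl V) where
  toFun x := !![0, algebraMap ℝ (Cl V) x.1 + vec V x.2; algebraMap ℝ (Cl V) x.1 - vec V x.2, 0]
  map_add' x y := by
    ext i j
    fin_cases i <;> fin_cases j <;> simp <;> abel
  map_smul' r x := by
    ext i j
    fin_cases i <;> fin_cases j <;>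
      simp [smul_add, smul_sub, Algebra.algebraMap_eq_smul_one, mul_smul]

theorem gammaLin_sq (x : ℝ × V) :
    gammaLin V x * gammaLin V x
      = algebraMap ℝ (Matrix (Fin 2) (Fin 2) (Cl V)) (quadForm1 V x) := by
  have h : vec V x.2 * vec V x.2 = algebraMap ℝ (Cl V) (quadForm V x.2) :=
    CliffordAlgebra.ι_sq_scalar _ _
  have hc : algebraMap ℝ (Cl V) x.1 * vec V x.2 = vec V x.2 * algebraMap ℝ (Cl V) x.1 :=
    Algebra.commutes _ _
  have e1 : quadForm1 V x = x.1 * x.1 - quadForm V x.2 := by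
    simp [quadForm1, sub_eq_add_neg]
  rw [e1, map_sub, map_mul]
  ext i j
  fin_cases i <;> fin_cases j <;>
    simp [gammaLin, Matrix.mul_apply, Fin.sum_univ_two, Matrix.algebraMap_matrix_apply, mul_add,
      add_mul, mul_sub, sub_mul, h, hc]
  abel

/-- The algebra homomorphism `γ : C¹ → Mat(2, C)` extending `gammaLin`. -/
def gamma : Cl1 V →ₐ[ℝ] Matrix (Fin 2) (Fin 2) (Cl V) :=
  CliffordAlgebra.lift (quadForm1 V) ⟨gammaLin V, gammaLin_sq V⟩

variable {V}

/-- The map `ψ : C¹ → C`, the upper left entry of `γ`; its restriction to the even subalgebra is the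
isomorphism `ψ⁺` onto `C`. -/
def psi (g : Cl1 V) : Cl V := gamma V g 0 0

/-- A transformer: for each paravector `w` there is a paravector `w'` with `a w = w' π(a)`. -/
def IsTransformer (a : Cl V) : Prop :=
  ∀ w ∈ paravectors V, ∃ w' ∈ paravectors V, a * w = w' * prinAut a

/-- `σ_a (w) = a w a^τ`. -/
def sigma (a w : Cl V) : Cl V := a * w * tau a

/-- Positivity: `a = a^τ` and `(v, a v) = Φ(v^τ a v) ≥ 0` for all `v ∈ C`. -/
def IsPositive (a : Cl V) : Prop :=
  a = tau a ∧ ∀ v : Cl V, 0 ≤ scalarPart (tau v * (a * v))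

theorem normFun_one : normFun (1 : Cl V) = 1 := by simp [normFun, nu]

theorem normFun_mul {a b : Cl V} (ha : normFun a = 1) (hb : normFun b = 1) :
    normFun (a * b) = 1 := by
  unfold normFun at *
  have : nu (a * b) = nu b * nu a := by simp [nu]
  rw [this, mul_assoc, ← mul_assoc (nu a), ha, one_mul, hb]

theorem IsTransformer.inv [FiniteDimensional ℝ V] {u : (Cl V)ˣ} (hu : IsTransformer (u : Cl V)) :
    IsTransformer ((u⁻¹ : (Cl V)ˣ) : Cl V) := by
  have hfd : FiniteDimensional ℝ (paravectors V) := by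
    unfold paravectors; infer_instance
  let p : (Cl V)ˣ := Units.map (CliffordAlgebra.involute (Q := quadForm V) : Cl V →* Cl V) u
  have hp : ((p : (Cl V)ˣ) : Cl V) = prinAut (u : Cl V) := rfl
  have hp' : ((p⁻¹ : (Cl V)ˣ) : Cl V) = prinAut ((u⁻¹ : (Cl V)ˣ) : Cl V) := rfl
  have key : ∀ w ∈ paravectors V, (u : Cl V) * w * ((p⁻¹ : (Cl V)ˣ) : Cl V) ∈ paravectors V := by
    intro w hw
    obtain ⟨w', hw', e⟩ := hu w hw
    rw [e, ← hp, mul_assoc, Units.mul_inv, mul_one]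
    exact hw'
  let L : Cl V →ₗ[ℝ] Cl V :=
    (LinearMap.mulRight ℝ ((p⁻¹ : (Cl V)ˣ) : Cl V)) ∘ₗ (LinearMap.mulLeft ℝ (u : Cl V))
  let T : paravectors V →ₗ[ℝ] paravectors V := L.restrict key
  have hinj : Function.Injective T := by
    intro x y hxy
    have h1 : (u : Cl V) * (x : Cl V) * ((p⁻¹ : (Cl V)ˣ) : Cl V)
        = (u : Cl V) * (y : Cl V) * ((p⁻¹ : (Cl V)ˣ) : Cl V) := congrArg Subtype.val hxy
    exact Subtype.ext (by simpa using h1)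
  have hsurj : Function.Surjective T := LinearMap.injective_iff_surjective.mp hinj
  intro w hw
  obtain ⟨w', h⟩ := hsurj ⟨w, hw⟩
  have h1 : (u : Cl V) * (w' : Cl V) * ((p⁻¹ : (Cl V)ˣ) : Cl V) = w := congrArg Subtype.val h
  refine ⟨w', w'.2, ?_⟩
  rw [← h1, ← hp', mul_assoc (u : Cl V), Units.inv_mul_cancel_left]

variable (V) in
/-- The group `𝒢 = {a ∈ 𝒯 : Δ(a) = 1}` of transformers of norm one. (As `C` is finite-dimensional,
`Δ(a) = 1` makes `a` invertible.) -/
def spinG [FiniteDimensional ℝ V] : Subgroup (Cl V)ˣ where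
  carrier := {u | IsTransformer (u : Cl V) ∧ normFun (u : Cl V) = 1}
  mul_mem' := by
    rintro a b ⟨ha, ha'⟩ ⟨hb, hb'⟩
    refine ⟨fun w hw => ?_, by rw [Units.val_mul]; exact normFun_mul ha' hb'⟩
    obtain ⟨w', hw', e⟩ := hb w hw
    obtain ⟨w'', hw'', e'⟩ := ha w' hw'
    refine ⟨w'', hw'', ?_⟩
    rw [Units.val_mul, mul_assoc, e, ← mul_assoc, e', prinAut, prinAut, prinAut, map_mul, mul_assoc]
  one_mem' := ⟨fun w hw => ⟨w, hw, by simp [prinAut]⟩, by simpa using normFun_one⟩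
  inv_mem' := by
    rintro u ⟨hu, hu'⟩
    refine ⟨hu.inv, ?_⟩
    have h1 : nu (u : Cl V) = ((u⁻¹ : (Cl V)ˣ) : Cl V) := by
      have : nu (u : Cl V) * u = 1 := hu'
      exact Units.eq_inv_of_mul_eq_one_right this
    have h2 : nu (((u⁻¹ : (Cl V)ˣ)) : Cl V) = u := by
      rw [← h1]
      simp [nu, tau, prinAut, CliffordAlgebra.reverse_involute]
    change nu (((u⁻¹ : (Cl V)ˣ)) : Cl V) * ((u⁻¹ : (Cl V)ˣ) : Cl V) = 1
    rw [h2, Units.mul_inv]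

/-- The topology of `𝒢`, as a subset of the finite-dimensional real vector space `C`. -/
instance [FiniteDimensional ℝ V] : TopologicalSpace (spinG V) :=
  TopologicalSpace.induced (fun g : spinG V => ((g : (Cl V)ˣ) : Cl V)) (moduleTopology ℝ (Cl V))

variable (V) in
/-- The set `𝒢₊` of spin-boosts, the positive elements of `𝒢`. -/
def spinBoosts [FiniteDimensional ℝ V] : Set (spinG V) :=
  {m | IsPositive ((m : (Cl V)ˣ) : Cl V)}

/-! ### The action on the ball -/

/-- The closed unit ball `B̄ⁿ⁺¹` of `V`. -/
abbrev Ball (V : Type*) [NormedAddCommGroup V] : Type _ := closedBall (0 : V) 1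

/-- The unit sphere `Sⁿ` of `V`. -/
abbrev Sph (V : Type*) [NormedAddCommGroup V] : Type _ := sphere (0 : V) 1

instance (V : Type*) [NormedAddCommGroup V] : Nonempty (Ball V) :=
  ⟨⟨0, by simp⟩⟩

/-- The inclusion of the sphere in the closed ball. -/
def sphToBall (x : Sph V) : Ball V := ⟨x, sphere_subset_closedBall x.2⟩

/-- `P(x) = 1 + x`. -/
def P (x : Ball V) : Cl V := 1 + vec V (x : V)

/-- `σ_g(P(x)) / Φ(σ_g(P(x)))`. -/
def normalizedSigma [FiniteDimensional ℝ V] (g : spinG V) (x : Ball V) : Cl V :=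
  (scalarPart (sigma ((g : (Cl V)ˣ) : Cl V) (P x)))⁻¹ • sigma ((g : (Cl V)ˣ) : Cl V) (P x)

/-- `φ_g(x) = P⁻¹(σ_g(P(x)) / Φ(σ_g(P(x))))`. -/
def phi [FiniteDimensional ℝ V] (g : spinG V) (x : Ball V) : Ball V :=
  Function.invFun P (normalizedSigma g x)

/-- The map
`x ↦ ((1 - α²) x + 2 α (1 + α (u · x)) u) / (1 + α² + 2 α (u · x))`. -/
def boostMap (α : ℝ) (u x : V) : V :=
  (1 + α ^ 2 + 2 * α * inner ℝ u x)⁻¹ •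
    ((1 - α ^ 2) • x + (2 * α * (1 + α * inner ℝ u x)) • u)

/-- `ρ(x) = (1 - α²) / (1 + α² + 2 α (u · x))`. -/
def boostFactor (α : ℝ) (u x : V) : ℝ :=
  (1 - α ^ 2) / (1 + α ^ 2 + 2 * α * inner ℝ u x)

end Clifford

/-! ### The group of orientation-preserving Möbius transformations of the sphere -/

section Mobius

variable {V : Type*} [NormedAddCommGroup V]

/-- The cross-ratio `d(u,x) d(v,y) / (d(u,v) d(x,y))`, for the distance of `V`. -/
def crossRatio (u v x y : Sph V) : ℝ := dist u x * dist v y / (dist u v * dist x y)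

variable (V) in
/-- The Möbius transformations of the sphere: the bijections that preserve cross-ratios. -/
def mobiusGroup : Subgroup (Equiv.Perm (Sph V)) where
  carrier := {f | ∀ u v x y : Sph V, u ≠ v → x ≠ y →
    crossRatio (f u) (f v) (f x) (f y) = crossRatio u v x y}
  mul_mem' := by
    intro f g hf hg u v x y huv hxy
    rw [← hg u v x y huv hxy]
    exact hf _ _ _ _ (g.injective.ne huv) (g.injective.ne hxy)
  one_mem' := fun _ _ _ _ _ _ => rfl
  inv_mem' := by
    intro f hf u v x y huv hxy
    have := hf (f⁻¹ u) (f⁻¹ v) (f⁻¹ x) (f⁻¹ y) (f⁻¹.injective.ne huv) (f⁻¹.injective.ne hxy)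
    simpa using this.symm

variable [InnerProductSpace ℝ V]

open Classical in
/-- The radial extension `v ↦ ‖v‖ f(v / ‖v‖)` of a map of the sphere. -/
def coneExt (f : Sph V → Sph V) (v : V) : V :=
  if h : v = 0 then 0 else
    ‖v‖ • (f ⟨‖v‖⁻¹ • v, by simp [norm_smul, h]⟩ : V)

/-- A map of the sphere preserves the orientation: at each point `x` its radial extension is differentiable with positive determinant. As the derivative sends
the outer normal `x` to the outer normal `f x`, this says that `df_x : T_x S → T_{f x} S` preserves
the orientation of the sphere. (At a point of non-differentiability `fderiv` and its determinant
are zero.) -/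
def PreservesOrientation (f : Sph V → Sph V) : Prop :=
  ∀ x : Sph V, 0 < (fderiv ℝ (coneExt f) (x : V)).det

theorem coneExt_zero (f : Sph V → Sph V) : coneExt f 0 = 0 := by simp [coneExt]

theorem coneExt_of_ne (f : Sph V → Sph V) {v : V} (h : v ≠ 0) :
    coneExt f v = ‖v‖ • (f ⟨‖v‖⁻¹ • v, by simp [norm_smul, h]⟩ : V) := by simp [coneExt, h]

theorem norm_coneExt (f : Sph V → Sph V) (v : V) : ‖coneExt f v‖ = ‖v‖ := by
  by_cases h : v = 0
  · subst h; simp [coneExt]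
  · rw [coneExt_of_ne f h, norm_smul]; simp

theorem coneExt_coe (f : Sph V → Sph V) (x : Sph V) : coneExt f (x : V) = f x := by
  have hx : ‖(x : V)‖ = 1 := by simp
  have h0 : (x : V) ≠ 0 := by intro h; rw [h] at hx; simp at hx
  rw [coneExt_of_ne f h0]
  simp

theorem coneExt_comp (f g : Sph V → Sph V) (v : V) :
    coneExt (f ∘ g) v = coneExt f (coneExt g v) := by
  by_cases h : v = 0
  · subst h; simp [coneExt]
  · have hn : ‖v‖ ≠ 0 := norm_ne_zero_iff.mpr h
    have h' : coneExt g v ≠ 0 := by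
      rw [← norm_ne_zero_iff, norm_coneExt]; exact hn
    rw [coneExt_of_ne _ h', coneExt_of_ne _ h]
    have e : (⟨‖coneExt g v‖⁻¹ • coneExt g v, by simp [norm_smul, h']⟩ : Sph V)
        = g ⟨‖v‖⁻¹ • v, by simp [norm_smul, h]⟩ := by
      apply Subtype.ext
      simp only [norm_coneExt]
      rw [coneExt_of_ne g h, smul_smul]
      exact (congrArg (fun r : ℝ => r • _) (inv_mul_cancel₀ hn)).trans (one_smul ℝ _)
    rw [e, norm_coneExt]
    rfl

theorem coneExt_id (v : V) : coneExt (id : Sph V → Sph V) v = v := by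
  by_cases h : v = 0
  · subst h; simp [coneExt]
  · have hn : ‖v‖ ≠ 0 := norm_ne_zero_iff.mpr h
    rw [coneExt_of_ne _ h]
    simp [smul_smul, hn]

theorem PreservesOrientation.differentiableAt [FiniteDimensional ℝ V] {f : Sph V → Sph V}
    (hf : PreservesOrientation f) (x : Sph V) : DifferentiableAt ℝ (coneExt f) (x : V) := by
  by_contra h
  have h1 := hf x
  rw [fderiv_zero_of_not_differentiableAt h] at h1
  have hx : ‖(x : V)‖ = 1 := by simp
  have : Nontrivial V := ⟨(x : V), 0, by intro h; rw [h] at hx; simp at hx⟩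
  have h2 : (0 : V →L[ℝ] V).det = 0 := by
    change LinearMap.det (0 : V →ₗ[ℝ] V) = 0
    rw [LinearMap.det_zero, zero_pow Module.finrank_pos.ne']
  rw [h2] at h1
  exact lt_irrefl _ h1

theorem PreservesOrientation.continuous [FiniteDimensional ℝ V] {f : Sph V → Sph V}
    (hf : PreservesOrientation f) : Continuous f := by
  rw [continuous_induced_rng, continuous_iff_continuousAt]
  intro x
  have h := (hf.differentiableAt x).continuousAt.comp (continuous_subtype_val.continuousAt (x := x))
  refine h.congr (Filter.Eventually.of_forall fun y => ?_)
  simp [coneExt_coe]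

theorem preservesOrientation_id : PreservesOrientation (id : Sph V → Sph V) := by
  intro x
  have : coneExt (id : Sph V → Sph V) = id := funext coneExt_id
  rw [this, fderiv_id]
  simp [ContinuousLinearMap.det]

theorem PreservesOrientation.comp [FiniteDimensional ℝ V] {f g : Sph V → Sph V}
    (hf : PreservesOrientation f) (hg : PreservesOrientation g) : PreservesOrientation (f ∘ g) := by
  intro x
  have e : coneExt (f ∘ g) = coneExt f ∘ coneExt g := funext (coneExt_comp f g)
  have h1 : DifferentiableAt ℝ (coneExt f) (coneExt g x) := by
    rw [coneExt_coe]; exact hf.differentiableAt _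
  rw [e, fderiv_comp _ h1 (hg.differentiableAt x), coneExt_coe]
  change 0 < LinearMap.det (((fderiv ℝ (coneExt f) (g x : V)) : V →ₗ[ℝ] V)
    ∘ₗ ((fderiv ℝ (coneExt g) (x : V)) : V →ₗ[ℝ] V))
  rw [LinearMap.det_comp]
  exact mul_pos (hf (g x)) (hg x)

theorem continuousAt_coneExt {f : Sph V → Sph V} (hf : Continuous f) (x : Sph V) :
    ContinuousAt (coneExt f) (x : V) := by
  have hx : ‖(x : V)‖ = 1 := by simp
  have h0 : (x : V) ≠ 0 := by intro h; rw [h] at hx; simp at hx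
  have hon : ContinuousOn (coneExt f) {v : V | v ≠ 0} := by
    rw [continuousOn_iff_continuous_domRestrict]
    have e : ({v : V | v ≠ 0} : Set V).domRestrict (coneExt f) = fun v : {v : V | v ≠ 0} =>
        ‖(v : V)‖ • (f ⟨‖(v : V)‖⁻¹ • (v : V), by
          have : (v : V) ≠ 0 := v.2
          simp [norm_smul, this]⟩ : V) := by
      funext v
      exact coneExt_of_ne f v.2
    rw [e]
    refine Continuous.smul (by fun_prop) (continuous_subtype_val.comp (hf.comp ?_))
    refine Continuous.subtype_mk (Continuous.smul ?_ continuous_subtype_val) _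
    exact Continuous.inv₀ (by fun_prop) (fun v => norm_ne_zero_iff.mpr v.2)
  exact hon.continuousAt (isOpen_ne.mem_nhds h0)

theorem PreservesOrientation.inv [FiniteDimensional ℝ V] {f : Equiv.Perm (Sph V)}
    (hf : PreservesOrientation f) : PreservesOrientation (f⁻¹ : Equiv.Perm (Sph V)) := by
  have hc : Continuous (f⁻¹ : Equiv.Perm (Sph V)) :=
    (Continuous.homeoOfEquivCompactToT2 (f := f) hf.continuous).symm.continuous
  intro x
  set y : Sph V := (f⁻¹ : Equiv.Perm (Sph V)) x with hy
  have hdet := hf y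
  let L : V ≃L[ℝ] V := ContinuousLinearMap.toContinuousLinearEquivOfDetNeZero
    (fderiv ℝ (coneExt f) (y : V)) hdet.ne'
  have hL : (L : V →L[ℝ] V) = fderiv ℝ (coneExt f) (y : V) := by ext v; rfl
  have hd : HasFDerivAt (coneExt f) (L : V →L[ℝ] V)
      (coneExt (f⁻¹ : Equiv.Perm (Sph V)) (x : V)) := by
    rw [coneExt_coe, hL]
    exact (hf.differentiableAt y).hasFDerivAt
  have hloc : ∀ v : V, coneExt f (coneExt (f⁻¹ : Equiv.Perm (Sph V)) v) = v := by
    intro v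
    rw [← coneExt_comp]
    have : (f ∘ (f⁻¹ : Equiv.Perm (Sph V)) : Sph V → Sph V) = id := by
      funext z; simp
    rw [this, coneExt_id]
  have hinv := HasFDerivAt.of_local_left_inverse (continuousAt_coneExt hc x) hd
    (Filter.Eventually.of_forall hloc)
  rw [hinv.fderiv]
  have hprod : (L.symm : V →L[ℝ] V).det * (L : V →L[ℝ] V).det = 1 := by
    change LinearMap.det ((L.symm : V →L[ℝ] V) : V →ₗ[ℝ] V)
      * LinearMap.det ((L : V →L[ℝ] V) : V →ₗ[ℝ] V) = 1
    rw [← LinearMap.det_comp]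
    have : ((L.symm : V →L[ℝ] V) : V →ₗ[ℝ] V) ∘ₗ ((L : V →L[ℝ] V) : V →ₗ[ℝ] V)
        = LinearMap.id := by
      ext v; simp
    rw [this, LinearMap.det_id]
  rw [← hL] at hdet
  by_contra hneg
  have := mul_nonpos_of_nonpos_of_nonneg (not_lt.mp hneg) hdet.le
  linarith

variable (V) in
/-- The group of orientation-preserving Möbius transformations of the sphere. -/
def mobiusGroupPlus [FiniteDimensional ℝ V] : Subgroup (Equiv.Perm (Sph V)) where
  carrier := {f | f ∈ mobiusGroup V ∧ PreservesOrientation f}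
  mul_mem' := fun ha hb => ⟨mul_mem ha.1 hb.1, ha.2.comp hb.2⟩
  one_mem' := ⟨one_mem _, preservesOrientation_id⟩
  inv_mem' := fun ha => ⟨inv_mem ha.1, ha.2.inv⟩

/-- The topology of uniform convergence on the Möbius group. -/
instance [FiniteDimensional ℝ V] : TopologicalSpace (mobiusGroupPlus V) :=
  TopologicalSpace.induced
    (fun f : mobiusGroupPlus V => UniformFun.ofFun (f : Equiv.Perm (Sph V)))
    (inferInstance : TopologicalSpace (UniformFun (Sph V) (Sph V)))

end Mobius

/-! ### The geometry of the sphere -/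

section Sphere

variable {V : Type*} [NormedAddCommGroup V] [InnerProductSpace ℝ V] {n : ℕ}
  [Fact (Module.finrank ℝ V = n + 1)]

/-- A tangent vector of the sphere, as a vector of `V`: the derivative of the inclusion. -/
def tangentToAmbient (x : Sph V) : TangentSpace (𝓡 n) x →L[ℝ] V :=
  mfderiv (𝓡 n) 𝓘(ℝ, V) (Subtype.val : Sph V → V) x

/-- The natural Riemannian metric `G` of the sphere, induced from `V`. -/
def sphereMetric (x : Sph V) (v w : TangentSpace (𝓡 n) x) : ℝ :=
  inner ℝ (tangentToAmbient x v) (tangentToAmbient x w)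

/-- The volume form `dS` of the sphere for the boundary orientation that an orientation of `V`
induces: `dS_x (v₁, …, vₙ) = dV (x, v₁, …, vₙ)`. -/
def sphereVolumeForm (o : Orientation ℝ V (Fin (n + 1))) (x : Sph V)
    (v : Fin n → TangentSpace (𝓡 n) x) : ℝ :=
  o.volumeForm (Fin.cons (x : V) fun i => tangentToAmbient x (v i))

end Sphere

end SpinMobius

end

open SpinMobius

set_option linter.unusedSectionVars false

noncomputable section

namespace SpinMobius

/-! ### Contraction by a vector, and the scalar part as a trace -/

section CliffordBasics

variable {V : Type*} [NormedAddCommGroup V] [InnerProductSpace ℝ V]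

/-! The scalar part `Φ` is a trace on `C`, and `Φ(a^τ a)` is positive definite, since it is the sum
of the squares of the coefficients of `a` on the products of an orthonormal basis. An element `g` of
`𝒢` acts on `ℝ ⊕ V` by `w ↦ g w g^τ`. This action preserves `w π(w)`, so it is a Lorentz isometry,
and it sends `1` to a vector with time component `Φ(g g^τ) > 0`. It therefore preserves the closed
future cone (`fst_pos_of_isometry`). The ball is the set of rays of that cone, cut at time one, and
the sphere is the set of light rays; `φ_g` is the action on rays, which gives (i).

For light vectors the Lorentz product of `(1, x)` and `(1, y)` is `d(x, y)² / 2`. Hence `g` changes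
squared distances by a product of two point factors, and these cancel in a cross-ratio. Conversely,
a bijection that preserves cross-ratios scales distances by `μ(x) μ(y)` (`exists_conformal_factor`).
After rescaling, the light vectors of the image points have the same Gram matrix as the original
ones, so a Lorentz isometry carries one family to the other (`exists_lorentz_of_mobius`). A boost
brings this isometry back to one that fixes `(1, 0)`, which is an orthogonal map of `V`. Such a map
is a product of reflections, hence covered by a product of unit vectors whose parity is the
determinant (`exists_pin_lift`). Even products lie in `𝒢`, and elements of `𝒢` that fix `(1, 0)` are
even; this is how orientation enters on both sides.

The kernel is `{1, -1}`: three distinct points force all point factors to be `1`, and then `g` is a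
central scalar. The homomorphism is proper, because the point factors are recovered from distances
between image points (`denom_sq_eq`) and they bound `Φ(g^τ g)`. A proper surjection is a quotient
map, and a quotient homomorphism with finite kernel is a covering.

The boost formula is `p q p` for a unit paravector `p`. Its derivative is `ρ` times the identity
plus a rank one map, from which the metric and volume statements follow. Finally `v ↦ v e₀` extends
to a section of `ψ⁺` (`evenLift`), which identifies `𝒢` with the image of `Spin⁺`. -/

theorem quadForm_apply (v : V) : quadForm V v = inner ℝ v v := rfl

theorem vec_mul_self (v : V) : vec V v * vec V v = algebraMap ℝ (Cl V) (inner ℝ v v) :=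
  CliffordAlgebra.ι_sq_scalar _ _

theorem vec_mul_vec_add_swap (v w : V) :
    vec V v * vec V w + vec V w * vec V v = algebraMap ℝ (Cl V) (2 * inner ℝ v w) := by
  rw [CliffordAlgebra.ι_mul_ι_add_swap]
  congr 1
  simp only [QuadraticMap.polar, quadForm_apply, inner_add_left, inner_add_right,
    real_inner_comm v w]
  ring

/-- The antiderivation of the Clifford algebra with `w ↦ ⟪v, w⟫` on vectors. -/
def der (v : V) : Cl V →ₗ[ℝ] Cl V := CliffordAlgebra.contractLeft (innerₗ V v)

theorem der_vec_mul (v w : V) (x : Cl V) :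
    der v (vec V w * x) = (inner ℝ v w : ℝ) • x - vec V w * der v x :=
  CliffordAlgebra.contractLeft_ι_mul ..

theorem der_algebraMap (v : V) (r : ℝ) : der v (algebraMap ℝ (Cl V) r) = 0 :=
  CliffordAlgebra.contractLeft_algebraMap ..

/-- The contraction measures the failure of `v` to commute with `x` up to `π`. The product rule for
`der`, the trace property and the determination of the scalars all rest on this identity. -/
theorem vec_mul_sub (v : V) (x : Cl V) :
    vec V v * x - prinAut x * vec V v = (2 : ℝ) • der v x := by
  induction x using CliffordAlgebra.left_induction with
  | algebraMap r => simp [der_algebraMap, Algebra.commutes r (CliffordAlgebra.ι (quadForm V) v)]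
  | add x y hx hy =>
    rw [map_add, smul_add, ← hx, ← hy, prinAut, map_add, mul_add, add_mul]
    abel
  | ι_mul x m hx =>
    have h1 : vec V v * vec V m * x = (2 * inner ℝ v m : ℝ) • x - vec V m * vec V v * x := by
      rw [Algebra.smul_def, ← vec_mul_vec_add_swap, add_mul, add_sub_cancel_right]
    rw [der_vec_mul, smul_sub, ← mul_smul_comm, ← hx, smul_smul, ← mul_assoc, h1]
    simp only [prinAut, map_mul, CliffordAlgebra.involute_ι, neg_mul, mul_sub, mul_assoc]
    abel

theorem der_mul (v : V) (x y : Cl V) :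
    der v (x * y) = der v x * y + prinAut x * der v y := by
  have h : (2 : ℝ) • der v (x * y) = (2 : ℝ) • (der v x * y + prinAut x * der v y) := by
    rw [smul_add, ← smul_mul_assoc, ← mul_smul_comm, ← vec_mul_sub, ← vec_mul_sub, ← vec_mul_sub]
    simp [prinAut, mul_sub, sub_mul, mul_assoc]
  exact smul_right_injective _ (two_ne_zero) h

theorem contractLeft_involute {R M : Type*} [CommRing R] [AddCommGroup M] [Module R M]
    {Q : QuadraticForm R M} (d : Module.Dual R M) (x : CliffordAlgebra Q) :
    CliffordAlgebra.contractLeft d (CliffordAlgebra.involute x)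
      = -CliffordAlgebra.involute (CliffordAlgebra.contractLeft d x) := by
  induction x using CliffordAlgebra.left_induction with
  | algebraMap r => simp
  | add x y hx hy => simp only [map_add, hx, hy]; abel
  | ι_mul x m hx =>
    simp only [map_mul, CliffordAlgebra.involute_ι, neg_mul, map_neg,
      CliffordAlgebra.contractLeft_ι_mul, hx, map_sub, map_smul]
    simp

/-- Passing to the exterior algebra is a change of form, so this reduces the invariance of `Φ` under
`π` to the exterior algebra, where it is clear on generators. -/
theorem changeForm_involute {R M : Type*} [CommRing R] [AddCommGroup M] [Module R M]
    {Q Q' : QuadraticForm R M} {B : LinearMap.BilinForm R M} (h : B.toQuadraticMap = Q' - Q)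
    (x : CliffordAlgebra Q) :
    CliffordAlgebra.changeForm h (CliffordAlgebra.involute x)
      = CliffordAlgebra.involute (CliffordAlgebra.changeForm h x) := by
  induction x using CliffordAlgebra.left_induction with
  | algebraMap r => simp
  | add x y hx hy => simp only [map_add, hx, hy]
  | ι_mul x m hx =>
    simp only [map_mul, CliffordAlgebra.involute_ι, neg_mul, map_neg,
      CliffordAlgebra.changeForm_ι_mul, hx, map_sub, contractLeft_involute]
    abel

/-- The scalar part, as a linear form. -/
def scalarPartLin (V : Type*) [NormedAddCommGroup V] [InnerProductSpace ℝ V] : Cl V →ₗ[ℝ] ℝ :=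
  (ExteriorAlgebra.algebraMapInv (R := ℝ) (M := V)).toLinearMap ∘ₗ
    (CliffordAlgebra.equivExterior (quadForm V)).toLinearMap

theorem scalarPart_add (a b : Cl V) : scalarPart (a + b) = scalarPart a + scalarPart b :=
  map_add (scalarPartLin V) a b

theorem scalarPart_neg (a : Cl V) : scalarPart (-a) = -scalarPart a :=
  map_neg (scalarPartLin V) a

theorem scalarPart_smul (r : ℝ) (a : Cl V) : scalarPart (r • a) = r * scalarPart a :=
  map_smul (scalarPartLin V) r a

theorem scalarPart_algebraMap (r : ℝ) : scalarPart (algebraMap ℝ (Cl V) r) = r := by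
  simp [scalarPart, ExteriorAlgebra.algebraMapInv]

theorem scalarPart_prinAut (a : Cl V) : scalarPart (prinAut a) = scalarPart a := by
  have key : (ExteriorAlgebra.algebraMapInv (R := ℝ) (M := V)).comp
      (CliffordAlgebra.involute (Q := (0 : QuadraticForm ℝ V))) = ExteriorAlgebra.algebraMapInv := by
    apply CliffordAlgebra.hom_ext
    ext v
    change ExteriorAlgebra.algebraMapInv (CliffordAlgebra.involute (CliffordAlgebra.ι _ v))
      = ExteriorAlgebra.algebraMapInv (ExteriorAlgebra.ι ℝ v)
    rw [CliffordAlgebra.involute_ι]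
    change ExteriorAlgebra.algebraMapInv (-ExteriorAlgebra.ι ℝ v) = _
    rw [map_neg]
    simp [ExteriorAlgebra.algebraMapInv]
  have h2 : CliffordAlgebra.equivExterior (quadForm V) (prinAut a)
      = CliffordAlgebra.involute (Q := (0 : QuadraticForm ℝ V))
        (CliffordAlgebra.equivExterior (quadForm V) a) := changeForm_involute
      CliffordAlgebra.changeForm.associated_neg_proof a
  unfold scalarPart
  rw [h2]
  exact DFunLike.congr_fun key _

/-- In the exterior algebra Clifford multiplication by `v` is the wedge with `v` plus the
contraction, and the wedge has no component of degree zero. -/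
theorem scalarPart_vec_mul (v : V) (x : Cl V) :
    scalarPart (vec V v * x) = scalarPart (der v x) := by
  have h : CliffordAlgebra.equivExterior (quadForm V) (vec V v * x)
      = ExteriorAlgebra.ι ℝ v * CliffordAlgebra.equivExterior (quadForm V) x
        + CliffordAlgebra.equivExterior (quadForm V) (der v x) := by
    unfold der
    refine (CliffordAlgebra.changeForm_ι_mul
      CliffordAlgebra.changeForm.associated_neg_proof v x).trans ?_
    rw [← CliffordAlgebra.changeForm_contractLeft, sub_eq_add_neg]
    congr 1
    change _ = CliffordAlgebra.changeForm CliffordAlgebra.changeForm.associated_neg_proof _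
    rw [← map_neg, ← LinearMap.neg_apply, ← map_neg]
    congr 3
    ext w
    simp [QuadraticMap.associated_apply, quadForm_apply]
    rw [norm_add_sq_real]
    ring
  unfold scalarPart
  rw [h, map_add, map_mul]
  simp [ExteriorAlgebra.algebraMapInv]

theorem scalarPart_vec (v : V) : scalarPart (vec V v) = 0 := by
  have := scalarPart_vec_mul v (1 : Cl V)
  rw [mul_one] at this
  rw [this, ← map_one (algebraMap ℝ (Cl V)), der_algebraMap]
  exact map_zero (scalarPartLin V)

/-- Taking scalar parts in `vec_mul_sub` gives `Φ(v x) - Φ(π(x) v) = 2 Φ(v x)`, and `Φ ∘ π = Φ`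
turns `-Φ(π(x) v)` into `Φ(x v)`. -/
theorem scalarPart_vec_mul_comm (v : V) (x : Cl V) :
    scalarPart (vec V v * x) = scalarPart (x * vec V v) := by
  have h := congrArg scalarPart (vec_mul_sub v x)
  rw [scalarPart_smul, sub_eq_add_neg, scalarPart_add, scalarPart_neg, ← scalarPart_vec_mul,
    ← scalarPart_prinAut (prinAut x * vec V v)] at h
  simp only [prinAut, map_mul, CliffordAlgebra.involute_involute, CliffordAlgebra.involute_ι,
    mul_neg, scalarPart_neg] at h
  linarith

theorem scalarPart_mul_comm (x y : Cl V) : scalarPart (x * y) = scalarPart (y * x) := by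
  induction x using CliffordAlgebra.left_induction generalizing y with
  | algebraMap r => rw [Algebra.commutes]
  | add x x' hx hx' => rw [add_mul, mul_add, scalarPart_add, scalarPart_add, hx, hx']
  | ι_mul x m hx =>
    rw [mul_assoc, scalarPart_vec_mul_comm, mul_assoc, hx, mul_assoc]

theorem tau_mul (a b : Cl V) : tau (a * b) = tau b * tau a := CliffordAlgebra.reverse.map_mul a b

theorem tau_tau (a : Cl V) : tau (tau a) = a := CliffordAlgebra.reverse_reverse a

theorem tau_vec (v : V) : tau (vec V v) = vec V v := CliffordAlgebra.reverse_ι v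

theorem tau_algebraMap (r : ℝ) : tau (algebraMap ℝ (Cl V) r) = algebraMap ℝ (Cl V) r :=
  CliffordAlgebra.reverse.commutes r

theorem tau_one : tau (1 : Cl V) = 1 := CliffordAlgebra.reverse.map_one

theorem prinAut_prinAut (a : Cl V) : prinAut (prinAut a) = a :=
  CliffordAlgebra.involute_involute a

theorem prinAut_one : prinAut (1 : Cl V) = 1 := map_one _

theorem prinAut_vec (v : V) : prinAut (vec V v) = -vec V v := CliffordAlgebra.involute_ι v

theorem prinAut_mul (a b : Cl V) : prinAut (a * b) = prinAut a * prinAut b := map_mul _ a b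

theorem tau_prinAut (a : Cl V) : tau (prinAut a) = prinAut (tau a) :=
  CliffordAlgebra.reverse_involute a

end CliffordBasics

/-! ### The Clifford algebra built up one orthonormal vector at a time -/

section Positivity

variable {V : Type*} [NormedAddCommGroup V] [InnerProductSpace ℝ V]
  {ι : Type*} [Fintype ι] [DecidableEq ι]

/-- The subalgebra generated by the vectors `b i`, `i ∈ s`. -/
def genSubalgebra (b : ι → V) (s : Finset ι) : Subalgebra ℝ (Cl V) :=
  Algebra.adjoin ℝ ((fun i => vec V (b i)) '' (s : Set ι))

theorem vec_mem_genSubalgebra {b : ι → V} {s : Finset ι} {i : ι} (hi : i ∈ s) :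
    vec V (b i) ∈ genSubalgebra b s :=
  Algebra.subset_adjoin ⟨i, hi, rfl⟩

theorem prinAut_mem_genSubalgebra {b : ι → V} {s : Finset ι} {a : Cl V}
    (ha : a ∈ genSubalgebra b s) : prinAut a ∈ genSubalgebra b s := by
  induction ha using Algebra.adjoin_induction with
  | mem x hx =>
    obtain ⟨i, hi, rfl⟩ := hx
    simp only [prinAut_vec]
    exact neg_mem (vec_mem_genSubalgebra hi)
  | algebraMap r => rw [prinAut, AlgHom.commutes]; exact Subalgebra.algebraMap_mem _ r
  | add x y _ _ hx hy => rw [prinAut, map_add]; exact add_mem hx hy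
  | mul x y _ _ hx hy => rw [prinAut, map_mul]; exact mul_mem hx hy

theorem tau_mem_genSubalgebra {b : ι → V} {s : Finset ι} {a : Cl V}
    (ha : a ∈ genSubalgebra b s) : tau a ∈ genSubalgebra b s := by
  induction ha using Algebra.adjoin_induction with
  | mem x hx =>
    obtain ⟨i, hi, rfl⟩ := hx
    simp only [tau_vec]
    exact vec_mem_genSubalgebra hi
  | algebraMap r => rw [tau_algebraMap]; exact Subalgebra.algebraMap_mem _ r
  | add x y _ _ hx hy => rw [tau, map_add]; exact add_mem hx hy
  | mul x y _ _ hx hy => rw [tau_mul]; exact mul_mem hy hx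

variable (b : OrthonormalBasis ι ℝ V)

theorem genSubalgebra_univ : genSubalgebra b Finset.univ = ⊤ := by
  rw [eq_top_iff, ← CliffordAlgebra.adjoin_range_ι, Algebra.adjoin_le_iff]
  rintro _ ⟨v, rfl⟩
  rw [← b.sum_repr v, map_sum]
  refine sum_mem fun i _ => ?_
  rw [map_smul]
  exact Subalgebra.smul_mem _ (vec_mem_genSubalgebra (Finset.mem_univ i)) _

variable {b} {s : Finset ι} {i : ι}

theorem der_eq_zero_of_notMem (hi : i ∉ s) {a : Cl V} (ha : a ∈ genSubalgebra b s) :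
    der (b i) a = 0 := by
  induction ha using Algebra.adjoin_induction with
  | mem x hx =>
    obtain ⟨j, hj, rfl⟩ := hx
    have hij : i ≠ j := by rintro rfl; exact hi hj
    have := der_vec_mul (b i) (b j) 1
    rw [← map_one (algebraMap ℝ (Cl V)), der_algebraMap, map_one, mul_one] at this
    simp [this, b.inner_eq_zero hij]
  | algebraMap r => exact der_algebraMap _ r
  | add x y _ _ hx hy => rw [map_add, hx, hy, add_zero]
  | mul x y _ _ hx hy => rw [der_mul, hx, hy, zero_mul, mul_zero, add_zero]

theorem vec_mul_eq_of_notMem (hi : i ∉ s) {a : Cl V} (ha : a ∈ genSubalgebra b s) :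
    vec V (b i) * a = prinAut a * vec V (b i) := by
  have := vec_mul_sub (b i) a
  rwa [der_eq_zero_of_notMem hi ha, smul_zero, sub_eq_zero] at this

theorem basis_vec_sq (i : ι) : vec V (b i) * vec V (b i) = 1 := by
  rw [vec_mul_self, real_inner_self_eq_norm_sq, b.norm_eq_one]; simp

/-- Such sums are closed under products: `e_i` moves past the smaller subalgebra at the cost of `π`,
and `e_i² = 1`. -/
theorem exists_eq_add_vec_mul (hi : i ∉ s) {a : Cl V} (ha : a ∈ genSubalgebra b (insert i s)) :
    ∃ p ∈ genSubalgebra b s, ∃ q ∈ genSubalgebra b s, a = p + vec V (b i) * q := by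
  induction ha using Algebra.adjoin_induction with
  | mem x hx =>
    obtain ⟨j, hj, rfl⟩ := hx
    rcases Finset.mem_insert.mp (Finset.mem_coe.mp hj) with rfl | hj
    · exact ⟨0, zero_mem _, 1, one_mem _, by simp⟩
    · exact ⟨_, vec_mem_genSubalgebra hj, 0, zero_mem _, by simp⟩
  | algebraMap r => exact ⟨_, Subalgebra.algebraMap_mem _ r, 0, zero_mem _, by simp⟩
  | add x y _ _ hx hy =>
    obtain ⟨p, hp, q, hq, rfl⟩ := hx
    obtain ⟨p', hp', q', hq', rfl⟩ := hy
    exact ⟨p + p', add_mem hp hp', q + q', add_mem hq hq', by rw [mul_add]; abel⟩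
  | mul x y _ _ hx hy =>
    obtain ⟨p, hp, q, hq, rfl⟩ := hx
    obtain ⟨p', hp', q', hq', rfl⟩ := hy
    refine ⟨p * p' + prinAut q * q', add_mem (mul_mem hp hp')
      (mul_mem (prinAut_mem_genSubalgebra hq) hq'), prinAut p * q' + q * p',
      add_mem (mul_mem (prinAut_mem_genSubalgebra hp) hq') (mul_mem hq hp'), ?_⟩
    have h1 := vec_mul_eq_of_notMem hi (prinAut_mem_genSubalgebra hp)
    have h2 := vec_mul_eq_of_notMem hi hq
    rw [prinAut_prinAut] at h1
    have h3 : p * (vec V (b i) * q') = vec V (b i) * (prinAut p * q') := by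
      rw [← mul_assoc, ← h1, mul_assoc]
    have h4 : vec V (b i) * q * (vec V (b i) * q') = prinAut q * q' := by
      rw [h2, mul_assoc, ← mul_assoc (vec V (b i)) (vec V (b i)), basis_vec_sq, one_mul]
    rw [add_mul, mul_add, mul_add, h3, h4, mul_add, mul_assoc (vec V (b i)) q p']
    abel

theorem scalarPart_vec_mul_eq_zero (hi : i ∉ s) {a : Cl V} (ha : a ∈ genSubalgebra b s) :
    scalarPart (vec V (b i) * a) = 0 := by
  rw [scalarPart_vec_mul, der_eq_zero_of_notMem hi ha]
  exact map_zero (scalarPartLin V)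

theorem mem_genSubalgebra_empty {a : Cl V} (ha : a ∈ genSubalgebra b ∅) :
    ∃ r : ℝ, a = algebraMap ℝ (Cl V) r := by
  simp only [genSubalgebra, Finset.coe_empty, Set.image_empty, Algebra.adjoin_empty] at ha
  obtain ⟨r, hr⟩ := Algebra.mem_bot.mp ha
  exact ⟨r, hr.symm⟩

/-- For `a = p + e_i q` the cross terms are, up to cyclic order, `e_i` times an element of the
smaller subalgebra, so their scalar parts vanish. Since `e_i² = 1`, what remains is the sum of the
values at `p` and `q`. -/
theorem scalarPart_tau_mul_self_aux (s : Finset ι) {a : Cl V} (ha : a ∈ genSubalgebra b s) :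
    0 ≤ scalarPart (tau a * a) ∧ (scalarPart (tau a * a) = 0 → a = 0) := by
  induction s using Finset.induction_on generalizing a with
  | empty =>
    obtain ⟨r, rfl⟩ := mem_genSubalgebra_empty ha
    rw [tau_algebraMap, ← map_mul, scalarPart_algebraMap]
    exact ⟨mul_self_nonneg r, fun h => by rw [mul_self_eq_zero.mp h, map_zero]⟩
  | insert i s hi ih =>
    obtain ⟨p, hp, q, hq, rfl⟩ := exists_eq_add_vec_mul hi ha
    have key : scalarPart (tau (p + vec V (b i) * q) * (p + vec V (b i) * q))
        = scalarPart (tau p * p) + scalarPart (tau q * q) := by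
      have h1 : tau (p + vec V (b i) * q) = tau p + tau q * vec V (b i) := by
        rw [tau, map_add, ← tau, ← tau, tau_mul, tau_vec]
      have h2 : scalarPart (tau p * (vec V (b i) * q)) = 0 := by
        rw [scalarPart_mul_comm, mul_assoc]
        exact scalarPart_vec_mul_eq_zero hi (mul_mem hq (tau_mem_genSubalgebra hp))
      have h3 : scalarPart (tau q * vec V (b i) * p) = 0 := by
        rw [mul_assoc, scalarPart_mul_comm, mul_assoc]
        exact scalarPart_vec_mul_eq_zero hi (mul_mem hp (tau_mem_genSubalgebra hq))
      have h4 : tau q * vec V (b i) * (vec V (b i) * q) = tau q * q := by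
        rw [mul_assoc, ← mul_assoc (vec V (b i)) (vec V (b i)), basis_vec_sq, one_mul]
      rw [h1, add_mul, mul_add, mul_add, h4, scalarPart_add, scalarPart_add, scalarPart_add, h2, h3]
      ring
    rw [key]
    obtain ⟨hp1, hp2⟩ := ih hp
    obtain ⟨hq1, hq2⟩ := ih hq
    refine ⟨add_nonneg hp1 hq1, fun h => ?_⟩
    rw [hp2 (by linarith), hq2 (by linarith), mul_zero, add_zero]

theorem genSubalgebra_finite (s : Finset ι) :
    Module.Finite ℝ (Subalgebra.toSubmodule (genSubalgebra b s)) := by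
  induction s using Finset.induction_on with
  | empty =>
    have : Subalgebra.toSubmodule (genSubalgebra b ∅) ≤
        LinearMap.range (Algebra.linearMap ℝ (Cl V)) := by
      intro a ha
      obtain ⟨r, rfl⟩ := mem_genSubalgebra_empty (b := b) ha
      exact ⟨r, rfl⟩
    exact Submodule.finiteDimensional_of_le this
  | insert i s hi ih =>
    have : Subalgebra.toSubmodule (genSubalgebra b (insert i s)) ≤
        Subalgebra.toSubmodule (genSubalgebra b s) ⊔
          (Subalgebra.toSubmodule (genSubalgebra b s)).map
            (LinearMap.mulLeft ℝ (vec V (b i))) := by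
      intro a ha
      obtain ⟨p, hp, q, hq, rfl⟩ := exists_eq_add_vec_mul hi ha
      exact Submodule.add_mem_sup hp ⟨q, hq, rfl⟩
    exact Submodule.finiteDimensional_of_le this

/-- Contraction of `p + e_i q` by `e_i` returns `q`; so `q = 0`, and the generators are peeled off
in turn. -/
theorem mem_genSubalgebra_of_der_eq_zero {a : Cl V} (ha : ∀ v, der v a = 0) (s : Finset ι)
    (h : a ∈ genSubalgebra b s) : ∃ r : ℝ, a = algebraMap ℝ (Cl V) r := by
  induction s using Finset.induction_on with
  | empty => exact mem_genSubalgebra_empty h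
  | insert i s hi ih =>
    obtain ⟨p, hp, q, hq, rfl⟩ := exists_eq_add_vec_mul hi h
    have h1 := ha (b i)
    rw [map_add, der_vec_mul, der_eq_zero_of_notMem hi hp, der_eq_zero_of_notMem hi hq,
      real_inner_self_eq_norm_sq, b.norm_eq_one] at h1
    have hq0 : q = 0 := by simpa using h1
    refine ih ?_
    rw [hq0, mul_zero, add_zero]
    exact hp

theorem scalarPart_tau_aux (s : Finset ι) {a : Cl V} (ha : a ∈ genSubalgebra b s) :
    scalarPart (tau a) = scalarPart a := by
  induction s using Finset.induction_on generalizing a with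
  | empty =>
    obtain ⟨r, rfl⟩ := mem_genSubalgebra_empty ha
    rw [tau_algebraMap]
  | insert i s hi ih =>
    obtain ⟨p, hp, q, hq, rfl⟩ := exists_eq_add_vec_mul hi ha
    rw [tau, map_add, scalarPart_add, scalarPart_add, ← tau, ← tau, tau_mul, tau_vec,
      ← scalarPart_vec_mul_comm, scalarPart_vec_mul_eq_zero hi hq,
      scalarPart_vec_mul_eq_zero hi (tau_mem_genSubalgebra hq), ih hp]

end Positivity

/-! ### Finite dimension and the Euclidean structure of the Clifford algebra -/

section PositivityConsequences

variable {V : Type*} [NormedAddCommGroup V] [InnerProductSpace ℝ V] [FiniteDimensional ℝ V]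

instance : Module.Finite ℝ (Cl V) := by
  have h := genSubalgebra_finite (b := stdOrthonormalBasis ℝ V) Finset.univ
  rw [genSubalgebra_univ, Algebra.top_toSubmodule] at h
  exact Module.Finite.equiv (Submodule.topEquiv (R := ℝ) (M := Cl V))

theorem mem_genSubalgebra_univ (a : Cl V) :
    a ∈ genSubalgebra (stdOrthonormalBasis ℝ V) Finset.univ := by
  rw [genSubalgebra_univ]; trivial

theorem scalarPart_tau_mul_self_nonneg (a : Cl V) : 0 ≤ scalarPart (tau a * a) :=
  (scalarPart_tau_mul_self_aux _ (mem_genSubalgebra_univ a)).1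

theorem eq_zero_of_scalarPart_tau_mul_self {a : Cl V} (h : scalarPart (tau a * a) = 0) : a = 0 :=
  (scalarPart_tau_mul_self_aux _ (mem_genSubalgebra_univ a)).2 h

theorem exists_algebraMap_of_der_eq_zero {a : Cl V} (ha : ∀ v, der v a = 0) :
    ∃ r : ℝ, a = algebraMap ℝ (Cl V) r :=
  mem_genSubalgebra_of_der_eq_zero ha _ (mem_genSubalgebra_univ a)

theorem scalarPart_tau (a : Cl V) : scalarPart (tau a) = scalarPart a :=
  scalarPart_tau_aux _ (mem_genSubalgebra_univ a)

/-- A linear isomorphism of the Clifford algebra with a Euclidean space that carries the form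
`Φ(a^τ a)` to the square of the norm. -/
theorem exists_euclidean_equiv : ∃ (k : ℕ) (e : Cl V ≃ₗ[ℝ] EuclideanSpace ℝ (Fin k)),
    ∀ a, ‖e a‖ ^ 2 = scalarPart (tau a * a) := by
  let core : InnerProductSpace.Core ℝ (Cl V) :=
    { inner := fun a b => scalarPart (tau a * b)
      conj_inner_symm := fun a b => by
        change scalarPart (tau b * a) = scalarPart (tau a * b)
        rw [← scalarPart_tau, tau_mul, tau_tau]
      re_inner_nonneg := fun a => scalarPart_tau_mul_self_nonneg a
      add_left := fun a b c => by
        simp only [tau, map_add, add_mul, scalarPart_add]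
      smul_left := fun a b r => by
        simp only [tau, map_smul, smul_mul_assoc, scalarPart_smul]; rfl
      definite := fun a h => eq_zero_of_scalarPart_tau_mul_self h }
  let : NormedAddCommGroup (Cl V) := core.toNormedAddCommGroup
  let : InnerProductSpace ℝ (Cl V) := InnerProductSpace.ofCore core.toCore
  refine ⟨_, (stdOrthonormalBasis ℝ (Cl V)).repr.toLinearEquiv, fun a => ?_⟩
  have : ‖(stdOrthonormalBasis ℝ (Cl V)).repr.toLinearEquiv a‖ = ‖a‖ :=
    (stdOrthonormalBasis ℝ (Cl V)).repr.norm_map a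
  rw [this, ← real_inner_self_eq_norm_sq]
  rfl

end PositivityConsequences

/-! ### Lorentzian geometry of the paravectors -/

section Lorentz

variable {V : Type*} [NormedAddCommGroup V] [InnerProductSpace ℝ V]

/-- The Lorentzian bilinear form on `ℝ × V`. -/
def lor (p q : ℝ × V) : ℝ := p.1 * q.1 - inner ℝ p.2 q.2

theorem lor_comm (p q : ℝ × V) : lor p q = lor q p := by
  simp only [lor, mul_comm p.1, real_inner_comm]

theorem lor_add_left (p p' q : ℝ × V) : lor (p + p') q = lor p q + lor p' q := by
  simp only [lor, Prod.fst_add, Prod.snd_add, inner_add_left]; ring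

theorem lor_smul_left (r : ℝ) (p q : ℝ × V) : lor (r • p) q = r * lor p q := by
  simp only [lor, Prod.smul_fst, Prod.smul_snd, real_inner_smul_left, smul_eq_mul]; ring

theorem lor_add_right (p q q' : ℝ × V) : lor p (q + q') = lor p q + lor p q' := by
  rw [lor_comm, lor_add_left, lor_comm p, lor_comm p]

theorem lor_smul_right (r : ℝ) (p q : ℝ × V) : lor p (r • q) = r * lor p q := by
  rw [lor_comm, lor_smul_left, lor_comm]

theorem lor_self (p : ℝ × V) : lor p p = p.1 ^ 2 - ‖p.2‖ ^ 2 := by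
  rw [lor, real_inner_self_eq_norm_sq, sq p.1]

theorem lor_polarization {L : (ℝ × V) →ₗ[ℝ] (ℝ × V)} (hL : ∀ p, lor (L p) (L p) = lor p p)
    (p q : ℝ × V) : lor (L p) (L q) = lor p q := by
  have h := hL (p + q)
  rw [map_add, lor_add_left, lor_add_left, lor_add_right, lor_add_right, lor_add_right,
    lor_add_right, hL, hL, lor_comm (L q) (L p), lor_comm q p] at h
  linarith

theorem eq_zero_of_lor_eq_zero {p : ℝ × V} (h : ∀ q, lor p q = 0) : p = 0 := by
  have h1 := h (1, 0)
  have h2 := h (0, p.2)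
  simp [lor] at h1 h2
  exact Prod.ext h1 h2

/-- A Lorentz isometry that sends `(1, 0)` to the future preserves the closed forward cone. -/
theorem fst_pos_of_isometry {L : (ℝ × V) →ₗ[ℝ] (ℝ × V)} (hL : ∀ p, lor (L p) (L p) = lor p p)
    (h1 : 0 < (L (1, 0)).1) {p : ℝ × V} (hp : 0 ≤ lor p p) (hp1 : 0 < p.1) : 0 < (L p).1 := by
  have e1 := hL (1, 0)
  have e2 := hL p
  have e3 := lor_polarization hL (1, 0) p
  rw [lor_self, lor_self] at e1
  rw [lor_self] at e2
  have e4 := real_inner_le_norm (-(L (1, 0)).2) (L p).2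
  rw [inner_neg_left, norm_neg] at e4
  simp only [lor, inner_zero_left, one_mul, sub_zero, norm_zero] at e1 e3
  rw [← real_inner_self_eq_norm_sq] at e2
  -- If `L p` were not in the future, `-L p` and `L (1, 0)` would both be causal with nonnegative
  -- time, and Cauchy–Schwarz would give `L (1, 0)` and `L p` a product `≤ 0`. But that product is
  -- `p.1 > 0`.
  by_contra hneg
  push Not at hneg
  have hn : ‖(L p).2‖ ≤ -(L p).1 := by
    apply abs_le_of_sq_le_sq' _ (by linarith) |>.2
    rw [real_inner_self_eq_norm_sq] at e2
    linarith
  have hm : ‖(L (1, 0)).2‖ ≤ (L (1, 0)).1 := by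
    apply abs_le_of_sq_le_sq' _ h1.le |>.2
    nlinarith
  have h5 : ‖(L (1, 0)).2‖ * ‖(L p).2‖ ≤ (L (1, 0)).1 * -(L p).1 := by gcongr
  linarith

variable (V) in
/-- The embedding of `ℝ × V` in the Clifford algebra as the paravectors. -/
def pv : (ℝ × V) →ₗ[ℝ] Cl V := (Algebra.linearMap ℝ (Cl V)).coprod (vec V)

theorem pv_apply (p : ℝ × V) : pv V p = algebraMap ℝ (Cl V) p.1 + vec V p.2 := rfl

theorem pv_mk (t : ℝ) (v : V) : pv V (t, v) = algebraMap ℝ (Cl V) t + vec V v := rfl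

theorem mem_paravectors {a : Cl V} : a ∈ paravectors V ↔ ∃ p, pv V p = a := by
  simp only [paravectors, Submodule.mem_sup, LinearMap.mem_range, Algebra.linearMap_apply,
    exists_exists_eq_and, Prod.exists, pv_mk]

theorem pv_mem (p : ℝ × V) : pv V p ∈ paravectors V := mem_paravectors.mpr ⟨p, rfl⟩

variable (V) in
/-- The components of degree zero and one. -/
def coords : Cl V →ₗ[ℝ] ℝ × V :=
  (scalarPartLin V).prod ((ExteriorAlgebra.ιInv (R := ℝ) (M := V)) ∘ₗ
    (CliffordAlgebra.equivExterior (quadForm V)).toLinearMap)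

theorem coords_fst (a : Cl V) : (coords V a).1 = scalarPart a := rfl

theorem coords_pv (p : ℝ × V) : coords V (pv V p) = p := by
  apply Prod.ext
  · rw [coords_fst, pv_apply, scalarPart_add, scalarPart_algebraMap, scalarPart_vec, add_zero]
  · change ExteriorAlgebra.ιInv (CliffordAlgebra.equivExterior (quadForm V) (pv V p)) = p.2
    rw [pv_apply, map_add, map_add]
    have h1 : CliffordAlgebra.equivExterior (quadForm V) (algebraMap ℝ (Cl V) p.1)
        = algebraMap ℝ (ExteriorAlgebra ℝ V) p.1 := CliffordAlgebra.changeForm_algebraMap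
          CliffordAlgebra.changeForm.associated_neg_proof _
    have h2 : CliffordAlgebra.equivExterior (quadForm V) (vec V p.2)
        = ExteriorAlgebra.ι ℝ p.2 := CliffordAlgebra.changeForm_ι
          CliffordAlgebra.changeForm.associated_neg_proof _
    rw [h1, h2, ExteriorAlgebra.ι_leftInverse]
    simp [ExteriorAlgebra.ιInv, ExteriorAlgebra.toTrivSqZeroExt, TrivSqZeroExt.algebraMap_eq_inl]

theorem pv_injective : Function.Injective (pv V) :=
  Function.LeftInverse.injective coords_pv

theorem tau_pv (p : ℝ × V) : tau (pv V p) = pv V p := by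
  rw [pv_apply, tau, map_add, ← tau, ← tau, tau_algebraMap, tau_vec]

theorem prinAut_pv (p : ℝ × V) : prinAut (pv V p) = pv V (p.1, -p.2) := by
  rw [pv_apply, pv_mk, prinAut, map_add, AlgHom.commutes, ← prinAut, prinAut_vec, map_neg]

theorem pv_one : pv V (1, 0) = 1 := by simp [pv_apply]

theorem pv_mul_prinAut (p : ℝ × V) :
    pv V p * prinAut (pv V p) = algebraMap ℝ (Cl V) (lor p p) := by
  rw [prinAut_pv, pv_apply, pv_apply]
  simp only [map_neg, add_mul, mul_add, mul_neg, ← map_mul, vec_mul_self, lor, map_sub,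
    Algebra.commutes p.1 (vec V p.2)]
  abel

theorem prinAut_mul_pv (p : ℝ × V) :
    prinAut (pv V p) * pv V p = algebraMap ℝ (Cl V) (lor p p) := by
  have := congrArg prinAut (pv_mul_prinAut p)
  rw [prinAut_mul, prinAut_prinAut] at this
  rw [this, prinAut, AlgHom.commutes]

theorem pv_mul_prinAut_add (p q : ℝ × V) :
    pv V p * prinAut (pv V q) + pv V q * prinAut (pv V p)
      = algebraMap ℝ (Cl V) (2 * lor p q) := by
  have h := pv_mul_prinAut (p + q)
  rw [lor_add_left, lor_add_right, lor_add_right, map_add (pv V), prinAut, map_add, ← prinAut,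
    ← prinAut, add_mul, mul_add, mul_add, pv_mul_prinAut, pv_mul_prinAut, lor_comm q p] at h
  have e : lor p p + lor p q + (lor p q + lor q q) = lor p p + lor q q + 2 * lor p q := by ring
  rw [e, map_add, map_add] at h
  have : ∀ a b c d x : Cl V, a + b + (c + d) = a + d + x → b + c = x := by
    intro a b c d x hx
    have : a + d + (b + c) = a + d + x := by rw [← hx]; abel
    exact add_left_cancel this
  exact this _ _ _ _ _ h

/-- With `q̄ = (q.1, -q.2)` one has `π(q̄) = q`, so the polarized relation reads `p q + q̄ π(p) = 2
lor p q̄`. Multiplying by `p` on the right and using `π(p) p = 1` isolates `p q p`. -/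
theorem pv_mul_pv_mul_pv (p q : ℝ × V) (hp : lor p p = 1) :
    pv V p * pv V q * pv V p = pv V ((2 * lor p (q.1, -q.2)) • p - (q.1, -q.2)) := by
  have h := pv_mul_prinAut_add p (q.1, -q.2)
  have e : prinAut (pv V (q.1, -q.2)) = pv V q := by rw [prinAut_pv]; simp
  rw [e] at h
  rw [eq_sub_of_add_eq h, sub_mul, mul_assoc, prinAut_mul_pv, hp, map_one, mul_one, map_sub,
    map_smul, Algebra.smul_def]

/-- A paravector satisfies its quadratic equation: `p + π(p) = 2 p.1` and `π(p) p = lor p p`. -/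
theorem pv_sq (p : ℝ × V) : pv V p * pv V p = pv V ((2 * p.1) • p - (lor p p, 0)) := by
  have h1 : pv V p = algebraMap ℝ (Cl V) (2 * p.1) - prinAut (pv V p) := by
    rw [prinAut_pv, pv_apply, pv_mk, two_mul, map_add, map_neg]; abel
  nth_rewrite 1 [h1]
  rw [sub_mul, prinAut_mul_pv, map_sub, map_smul, Algebra.smul_def, pv_mk (lor p p)]
  simp

end Lorentz

/-! ### The action on paravectors and on the ball -/

section Action

variable {V : Type*} [NormedAddCommGroup V] [InnerProductSpace ℝ V] [FiniteDimensional ℝ V]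

/-- The element of the Clifford algebra underlying an element of the group. -/
abbrev elt (g : spinG V) : Cl V := ((g : (Cl V)ˣ) : Cl V)

theorem nu_mul_elt (g : spinG V) : nu (elt g) * elt g = 1 := g.2.2

theorem elt_inv (g : spinG V) : elt g⁻¹ = nu (elt g) :=
  (Units.eq_inv_of_mul_eq_one_right (nu_mul_elt g)).symm

theorem elt_mul_nu (g : spinG V) : elt g * nu (elt g) = 1 := by
  rw [← elt_inv]; exact Units.mul_inv _

theorem tau_mul_prinAut (g : spinG V) : tau (elt g) * prinAut (elt g) = 1 := by
  have := congrArg prinAut (nu_mul_elt g)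
  rwa [prinAut_mul, nu, ← tau_prinAut, prinAut_prinAut, prinAut_one] at this

theorem prinAut_mul_tau (g : spinG V) : prinAut (elt g) * tau (elt g) = 1 := by
  have := congrArg prinAut (elt_mul_nu g)
  rwa [prinAut_mul, nu, ← tau_prinAut, prinAut_prinAut, prinAut_one] at this

theorem elt_mul (g h : spinG V) : elt (g * h) = elt g * elt h := rfl

theorem elt_one : elt (1 : spinG V) = 1 := rfl

theorem elt_injective : Function.Injective (elt : spinG V → Cl V) := fun _ _ h =>
  Subtype.ext (Units.ext h)

theorem elt_ne_zero (g : spinG V) : elt g ≠ 0 := Units.ne_zero _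

theorem sigma_mul (a b w : Cl V) : sigma (a * b) w = sigma a (sigma b w) := by
  simp only [sigma, tau_mul, mul_assoc]

/-- The action of the group on `ℝ × V`. -/
def lorentzMap (g : spinG V) : (ℝ × V) →ₗ[ℝ] (ℝ × V) :=
  coords V ∘ₗ LinearMap.mulRight ℝ (tau (elt g)) ∘ₗ LinearMap.mulLeft ℝ (elt g) ∘ₗ pv V

theorem lorentzMap_apply (g : spinG V) (p : ℝ × V) :
    lorentzMap g p = coords V (sigma (elt g) (pv V p)) := rfl

/-- The relation `g w = w' π(g)` and `π(g) g^τ = 1` say that `σ_g(w) = w'` is a paravector, so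
`coords` discards nothing. -/
theorem pv_lorentzMap (g : spinG V) (p : ℝ × V) :
    pv V (lorentzMap g p) = sigma (elt g) (pv V p) := by
  obtain ⟨w', hw', e⟩ := g.2.1 (pv V p) (pv_mem p)
  obtain ⟨q, rfl⟩ := mem_paravectors.mp hw'
  have : sigma (elt g) (pv V p) = pv V q := by
    rw [sigma, e, mul_assoc, prinAut_mul_tau, mul_one]
  rw [lorentzMap_apply, this, coords_pv]

/-- In `σ_g(w) π(σ_g(w))` the factors `g^τ π(g)` cancel. The middle becomes the scalar `w π(w)`, and
`g g^ν = 1` removes the outer factors. -/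
theorem lor_lorentzMap_self (g : spinG V) (p : ℝ × V) :
    lor (lorentzMap g p) (lorentzMap g p) = lor p p := by
  have h := pv_mul_prinAut (lorentzMap g p)
  have e : sigma (elt g) (pv V p) * prinAut (sigma (elt g) (pv V p))
      = algebraMap ℝ (Cl V) (lor p p) := by
    have h1 : prinAut (tau (elt g)) = nu (elt g) := (tau_prinAut _).symm
    rw [sigma, prinAut_mul, prinAut_mul, h1]
    calc elt g * pv V p * tau (elt g) * (prinAut (elt g) * prinAut (pv V p) * nu (elt g))
        = elt g * (pv V p * ((tau (elt g) * prinAut (elt g)) * prinAut (pv V p))) * nu (elt g) := by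
          simp only [mul_assoc]
      _ = algebraMap ℝ (Cl V) (lor p p) := by
          rw [tau_mul_prinAut, one_mul, pv_mul_prinAut, ← Algebra.commutes, mul_assoc, elt_mul_nu,
            mul_one]
  rw [pv_lorentzMap, e] at h
  have := congrArg scalarPart h
  rw [scalarPart_algebraMap, scalarPart_algebraMap] at this
  exact this.symm

theorem lor_lorentzMap (g : spinG V) (p q : ℝ × V) :
    lor (lorentzMap g p) (lorentzMap g q) = lor p q :=
  lor_polarization (lor_lorentzMap_self g) p q

theorem lorentzMap_mul (g h : spinG V) (p : ℝ × V) :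
    lorentzMap (g * h) p = lorentzMap g (lorentzMap h p) := by
  apply pv_injective
  rw [pv_lorentzMap, pv_lorentzMap, pv_lorentzMap, elt_mul, sigma_mul]

theorem lorentzMap_one (p : ℝ × V) : lorentzMap (1 : spinG V) p = p := by
  apply pv_injective
  rw [pv_lorentzMap, sigma, elt_one, tau_one, one_mul, mul_one]

theorem lorentzMap_one_fst (g : spinG V) :
    (lorentzMap g (1, 0)).1 = scalarPart (elt g * tau (elt g)) := by
  rw [lorentzMap_apply, coords_fst, pv_one, sigma, mul_one]

/-- The trace property turns `Φ(g g^τ)` into `Φ(g^τ g)`, which is positive because `g ≠ 0`. -/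
theorem lorentzMap_one_fst_pos (g : spinG V) : 0 < (lorentzMap g (1, 0)).1 := by
  rw [lorentzMap_one_fst, scalarPart_mul_comm]
  refine lt_of_le_of_ne (scalarPart_tau_mul_self_nonneg _) fun h => ?_
  exact elt_ne_zero g (eq_zero_of_scalarPart_tau_mul_self h.symm)

theorem lorentzMap_fst_pos (g : spinG V) {p : ℝ × V} (hp : 0 ≤ lor p p) (hp1 : 0 < p.1) :
    0 < (lorentzMap g p).1 :=
  fst_pos_of_isometry (lor_lorentzMap_self g) (lorentzMap_one_fst_pos g) hp hp1

theorem P_eq_pv (x : Ball V) : P x = pv V (1, (x : V)) := by simp [P, pv_apply]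

theorem P_injective : Function.Injective (P : Ball V → Cl V) := by
  intro x y h
  rw [P_eq_pv, P_eq_pv] at h
  exact Subtype.ext (Prod.ext_iff.mp (pv_injective h)).2

theorem lor_ball_nonneg (x : Ball V) : 0 ≤ lor (1, (x : V)) (1, (x : V)) := by
  have : ‖(x : V)‖ ≤ 1 := mem_closedBall_zero_iff.mp x.2
  rw [lor_self]
  nlinarith [norm_nonneg (x : V)]

/-- The denominator of the action on the ball. -/
def denom (g : spinG V) (v : V) : ℝ := (lorentzMap g (1, v)).1

theorem denom_pos (g : spinG V) (x : Ball V) : 0 < denom g x :=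
  lorentzMap_fst_pos g (lor_ball_nonneg x) one_pos

theorem scalarPart_sigma_P (g : spinG V) (x : Ball V) :
    scalarPart (sigma (elt g) (P x)) = denom g x := by
  rw [P_eq_pv, ← coords_fst, ← lorentzMap_apply, denom]

theorem exists_P_eq_normalizedSigma (g : spinG V) (x : Ball V) :
    ∃ y : Ball V, P y = normalizedSigma g x ∧
      (y : V) = (denom g x)⁻¹ • (lorentzMap g (1, (x : V))).2 := by
  have hd := denom_pos g x
  have h1 := lor_lorentzMap_self g (1, (x : V))
  have h2 := lor_ball_nonneg x
  rw [← h1, lor_self] at h2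
  refine ⟨⟨(denom g x)⁻¹ • (lorentzMap g (1, (x : V))).2, ?_⟩, ?_, rfl⟩
  · rw [mem_closedBall_zero_iff, norm_smul, norm_inv, Real.norm_of_nonneg hd.le,
      inv_mul_le_iff₀ hd, mul_one]
    exact abs_le_of_sq_le_sq' (by rw [denom]; linarith) hd.le |>.2
  · rw [P_eq_pv, normalizedSigma, scalarPart_sigma_P, P_eq_pv, ← pv_lorentzMap, ← map_smul]
    congr 1
    exact Prod.ext (inv_mul_cancel₀ hd.ne').symm rfl

theorem P_phi (g : spinG V) (x : Ball V) : P (phi g x) = normalizedSigma g x := by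
  obtain ⟨y, hy, _⟩ := exists_P_eq_normalizedSigma g x
  exact Function.invFun_eq ⟨y, hy⟩

theorem phi_coe (g : spinG V) (x : Ball V) :
    (phi g x : V) = (denom g x)⁻¹ • (lorentzMap g (1, (x : V))).2 := by
  obtain ⟨y, hy, h⟩ := exists_P_eq_normalizedSigma g x
  rw [← h, P_injective ((P_phi g x).trans hy.symm)]

theorem lorentzMap_ball (g : spinG V) (x : Ball V) :
    lorentzMap g (1, (x : V)) = denom g x • (1, (phi g x : V)) := by
  rw [phi_coe]
  apply Prod.ext
  · simp [denom]
  · simp [smul_smul, (denom_pos g x).ne']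

/-- The point `φ_g(x)` depends only on the ray of the image of `(1, x)`. With this criterion the
composition law follows from linearity. -/
theorem phi_eq_of_lorentzMap {g : spinG V} {x y : Ball V} {c : ℝ}
    (h : lorentzMap g (1, (x : V)) = c • (1, (y : V))) : phi g x = y := by
  have h0 := denom_pos g x
  have h1 : denom g x = c := by
    have := congrArg Prod.fst h; simpa [denom] using this
  apply Subtype.ext
  rw [phi_coe, h, ← h1]
  simp [smul_smul, h0.ne']

theorem phi_mul (g h : spinG V) (x : Ball V) : phi (g * h) x = phi g (phi h x) := by
  refine phi_eq_of_lorentzMap (c := denom h x * denom g (phi h x)) ?_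
  rw [lorentzMap_mul, lorentzMap_ball h, map_smul, lorentzMap_ball g, smul_smul]

theorem phi_one (x : Ball V) : phi (1 : spinG V) x = x :=
  phi_eq_of_lorentzMap (c := 1) (by rw [lorentzMap_one, one_smul])

variable (V) in
/-- The action of the group on the closed ball. -/
def ballHom : spinG V →* Equiv.Perm (Ball V) where
  toFun g := ⟨phi g, phi g⁻¹, fun x => by rw [← phi_mul, inv_mul_cancel, phi_one],
    fun x => by rw [← phi_mul, mul_inv_cancel, phi_one]⟩
  map_one' := Equiv.ext phi_one
  map_mul' g h := Equiv.ext (phi_mul g h)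

/-- A paravector of norm one, as an element of the group. -/
def paraElt (p : ℝ × V) (hp : lor p p = 1) : spinG V :=
  ⟨⟨pv V p, prinAut (pv V p), by rw [pv_mul_prinAut, hp, map_one],
    by rw [prinAut_mul_pv, hp, map_one]⟩, by
    refine ⟨fun w hw => ?_, ?_⟩
    · obtain ⟨q, rfl⟩ := mem_paravectors.mp hw
      refine ⟨_, pv_mem ((2 * lor p (q.1, -q.2)) • p - (q.1, -q.2)), ?_⟩
      change pv V p * pv V q = _ * prinAut (pv V p)
      rw [← pv_mul_pv_mul_pv p q hp, mul_assoc _ (pv V p), pv_mul_prinAut, hp, map_one, mul_one]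
    · change tau (prinAut (pv V p)) * pv V p = 1
      rw [tau_prinAut, tau_pv, prinAut_mul_pv, hp, map_one]⟩

theorem elt_paraElt (p : ℝ × V) (hp : lor p p = 1) : elt (paraElt p hp) = pv V p := rfl

theorem lorentzMap_paraElt (p : ℝ × V) (hp : lor p p = 1) (q : ℝ × V) :
    lorentzMap (paraElt p hp) q = (2 * lor p (q.1, -q.2)) • p - (q.1, -q.2) := by
  apply pv_injective
  rw [pv_lorentzMap, elt_paraElt, sigma, tau_pv, pv_mul_pv_mul_pv p q hp]

/-- The square root of a future paravector of norm one. -/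
theorem exists_sq_eq {p : ℝ × V} (hp : lor p p = 1) (hp1 : 0 < p.1) :
    ∃ r : ℝ × V, lor r r = 1 ∧ 0 < r.1 ∧ pv V r * pv V r = pv V p ∧
      r = (Real.sqrt (2 * (p.1 + 1)))⁻¹ • (p + (1, 0)) := by
  have hs : 0 < 2 * (p.1 + 1) := by linarith
  -- From `p² + 1 = 2 p.1 p` one gets `(p + 1)² = 2 (p.1 + 1) p`, which dictates the normalizing
  -- constant.
  set s := Real.sqrt (2 * (p.1 + 1)) with hsdef
  have hs0 : 0 < s := Real.sqrt_pos.mpr hs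
  have hs2 : s * s = 2 * (p.1 + 1) := Real.mul_self_sqrt hs.le
  have hl : lor (p + (1, 0)) (p + (1, 0)) = 2 * (p.1 + 1) := by
    simp only [lor_add_left, lor_add_right, hp]
    simp [lor]; ring
  have hr : lor (s⁻¹ • (p + (1, 0))) (s⁻¹ • (p + (1, 0))) = 1 := by
    rw [lor_smul_left, lor_smul_right, hl, ← hs2]
    field_simp
  refine ⟨s⁻¹ • (p + (1, 0)), hr, ?_, ?_, rfl⟩
  · simp only [Prod.smul_fst, Prod.fst_add, smul_eq_mul]; positivity
  · rw [pv_sq, hr]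
    congr 1
    have e : (2 * (s⁻¹ • (p + ((1, 0) : ℝ × V))).1) • s⁻¹ • (p + ((1, 0) : ℝ × V))
        = p + (1, 0) := by
      rw [smul_smul]
      have : 2 * (s⁻¹ • (p + ((1, 0) : ℝ × V))).1 * s⁻¹ = 1 := by
        simp only [Prod.smul_fst, Prod.fst_add, smul_eq_mul]
        have : 2 * (s⁻¹ * (p.1 + 1)) * s⁻¹ = (2 * (p.1 + 1)) / (s * s) := by field_simp
        rw [this, hs2, div_self hs.ne']
      rw [this, one_smul]
    rw [e, add_sub_cancel_right]

/-- If `p = r²` with `r^τ = r`, then `Φ(v^τ p v) = Φ((r v)^τ (r v))`. -/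
theorem isPositive_pv {p : ℝ × V} (hp : lor p p = 1) (hp1 : 0 < p.1) : IsPositive (pv V p) := by
  refine ⟨(tau_pv p).symm, fun v => ?_⟩
  obtain ⟨r, _, _, hr, _⟩ := exists_sq_eq hp hp1
  have := scalarPart_tau_mul_self_nonneg (pv V r * v)
  rwa [tau_mul, tau_pv, mul_assoc, ← mul_assoc (pv V r), hr] at this

end Action

/-! ### The even subalgebra and the map `ψ⁺` -/

section EvenPart

variable {V : Type*} [NormedAddCommGroup V] [InnerProductSpace ℝ V]

variable (V) in
/-- The inclusion of `ℝ × V` in its Clifford algebra. -/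
abbrev vec1 : (ℝ × V) →ₗ[ℝ] Cl1 V := CliffordAlgebra.ι (quadForm1 V)

theorem quadForm1_apply (p : ℝ × V) : quadForm1 V p = lor p p := by
  simp [quadForm1, quadForm_apply, lor, sub_eq_add_neg]

theorem vec1_mul_self (p : ℝ × V) : vec1 V p * vec1 V p = algebraMap ℝ (Cl1 V) (lor p p) := by
  rw [CliffordAlgebra.ι_sq_scalar, quadForm1_apply]

theorem vec1_mul_swap (v : V) : vec1 V (0, v) * vec1 V (1, 0) = -(vec1 V (1, 0) * vec1 V (0, v)) := by
  have h := CliffordAlgebra.ι_mul_ι_add_swap (Q := quadForm1 V) (0, v) (1, 0)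
  rw [QuadraticMap.polar, quadForm1_apply, quadForm1_apply, quadForm1_apply] at h
  rw [eq_neg_iff_add_eq_zero]
  refine h.trans ?_
  simp [lor]

theorem vec1_one_sq : vec1 V (1, 0) * vec1 V (1, 0) = 1 := by
  rw [vec1_mul_self]; simp [lor]

variable (V) in
/-- The map `v ↦ v e₀`, for the unit vector `e₀` of `ℝ`. -/
def evenLin : V →ₗ[ℝ] Cl1 V :=
  (LinearMap.mulRight ℝ (vec1 V (1, 0))) ∘ₗ vec1 V ∘ₗ LinearMap.inr ℝ ℝ V

theorem evenLin_apply (v : V) : evenLin V v = vec1 V (0, v) * vec1 V (1, 0) := rfl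

/-- The vectors `v` and `e₀` anticommute and `e₀² = 1`, while `v² = -Q(v)` in `C¹`; the two signs
cancel. -/
theorem evenLin_sq (v : V) :
    evenLin V v * evenLin V v = algebraMap ℝ (Cl1 V) (quadForm V v) := by
  have h : vec1 V (0, v) * vec1 V (1, 0) * (vec1 V (0, v) * vec1 V (1, 0))
      = -(vec1 V (0, v) * vec1 V (0, v)) := by
    nth_rewrite 2 [vec1_mul_swap]
    rw [mul_neg, mul_assoc, ← mul_assoc (vec1 V (1, 0)), vec1_one_sq, one_mul]
  rw [evenLin_apply, h, vec1_mul_self, ← map_neg]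
  simp [lor, quadForm_apply]

variable (V) in
/-- The inverse of `ψ⁺`. -/
def evenLift : Cl V →ₐ[ℝ] Cl1 V := CliffordAlgebra.lift (quadForm V) ⟨evenLin V, evenLin_sq⟩

theorem evenLift_vec (v : V) : evenLift V (vec V v) = vec1 V (0, v) * vec1 V (1, 0) :=
  CliffordAlgebra.lift_ι_apply (evenLin V) evenLin_sq v

theorem evenLift_pv (p : ℝ × V) : evenLift V (pv V p) = vec1 V p * vec1 V (1, 0) := by
  have e : p = p.1 • ((1, 0) : ℝ × V) + (0, p.2) := by simp
  rw [pv_apply, map_add, evenLift_vec, AlgHom.commutes]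
  conv_rhs => rw [e, map_add, map_smul, add_mul, smul_mul_assoc, vec1_one_sq,
    ← Algebra.algebraMap_eq_smul_one]

theorem evenLift_mem_even (a : Cl V) : evenLift V a ∈ CliffordAlgebra.even (quadForm1 V) := by
  induction a using CliffordAlgebra.left_induction with
  | algebraMap r => rw [AlgHom.commutes]; exact Subalgebra.algebraMap_mem _ r
  | add x y hx hy => rw [map_add]; exact add_mem hx hy
  | ι_mul x m hx =>
    rw [map_mul]
    refine mul_mem ?_ hx
    rw [← vec, evenLift_vec]
    exact CliffordAlgebra.ι_mul_ι_mem_evenOdd_zero _ _ _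

/-- Conjugation by `e₀` changes the sign of `v e₀`. This turns the twisted relation `a w = w' π(a)`
into an ordinary commutation relation in `C¹`. -/
theorem evenLift_prinAut (a : Cl V) :
    evenLift V (prinAut a) = vec1 V (1, 0) * evenLift V a * vec1 V (1, 0) := by
  induction a using CliffordAlgebra.left_induction with
  | algebraMap r =>
    rw [prinAut, AlgHom.commutes, AlgHom.commutes, ← Algebra.commutes, mul_assoc, vec1_one_sq,
      mul_one]
  | add x y hx hy => rw [prinAut, map_add, map_add, hx, hy, map_add, mul_add, add_mul]
  | ι_mul x m hx =>
    rw [prinAut_mul, map_mul, hx, map_mul, ← vec, prinAut_vec, map_neg, evenLift_vec,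
      vec1_mul_swap, neg_neg]
    have : ∀ e w y : Cl1 V, e * w * (e * y * e) = -(e * -(w * e) * y * e) := by
      intro e w y; simp [mul_assoc]
    rw [this, ← vec1_mul_swap]
    have h2 := vec1_mul_swap m
    have h3 : vec1 V (1, 0) * vec1 V (0, m) = -(vec1 V (0, m) * vec1 V (1, 0)) := by
      rw [h2, neg_neg]
    simp [mul_assoc]

theorem evenLift_nu (a : Cl V) :
    evenLift V (nu a) = CliffordAlgebra.reverse (CliffordAlgebra.involute (evenLift V a)) := by
  induction a using CliffordAlgebra.left_induction with
  | algebraMap r =>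
    rw [nu, prinAut, AlgHom.commutes, tau_algebraMap, AlgHom.commutes, AlgHom.commutes,
      CliffordAlgebra.reverse.commutes]
  | add x y hx hy =>
    rw [nu, prinAut, map_add, tau, map_add, map_add, ← tau, ← prinAut, ← tau, ← prinAut, ← nu, ← nu,
      hx, hy, map_add, map_add, map_add]
  | ι_mul x m hx =>
    rw [nu, prinAut_mul, tau_mul, ← nu, map_mul, hx, map_mul, map_mul, CliffordAlgebra.reverse.map_mul,
      ← vec, prinAut_vec]
    congr 1
    rw [tau, map_neg, ← tau, tau_vec, map_neg, evenLift_vec, map_mul, CliffordAlgebra.involute_ι,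
      CliffordAlgebra.involute_ι, neg_mul_neg, CliffordAlgebra.reverse.map_mul,
      CliffordAlgebra.reverse_ι, CliffordAlgebra.reverse_ι, vec1_mul_swap, neg_neg]

theorem gamma_vec1 (p : ℝ × V) :
    gamma V (vec1 V p) = !![0, pv V p; prinAut (pv V p), 0] := by
  have : gamma V (vec1 V p) = gammaLin V p := CliffordAlgebra.lift_ι_apply _ _ _
  rw [this, prinAut_pv, pv_apply, pv_mk, map_neg, ← sub_eq_add_neg]
  rfl

theorem gamma_of_even {g : Cl1 V} (hg : g ∈ CliffordAlgebra.even (quadForm1 V)) :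
    gamma V g = !![psi g, 0; 0, prinAut (psi g)] ∧
      psi (CliffordAlgebra.reverse (CliffordAlgebra.involute g)) = nu (psi g) := by
  induction g, hg using CliffordAlgebra.even_induction with
  | algebraMap r =>
    have h : gamma V (algebraMap ℝ (Cl1 V) r)
        = !![algebraMap ℝ (Cl V) r, 0; 0, algebraMap ℝ (Cl V) r] := by
      rw [AlgHom.commutes]
      ext i j
      fin_cases i <;> fin_cases j <;> simp [Matrix.algebraMap_matrix_apply]
    have h' : psi (algebraMap ℝ (Cl1 V) r) = algebraMap ℝ (Cl V) r := by rw [psi, h]; rfl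
    rw [AlgHom.commutes CliffordAlgebra.involute, CliffordAlgebra.reverse.commutes, h', h, nu, prinAut, AlgHom.commutes,
      tau_algebraMap]
    exact ⟨rfl, rfl⟩
  | add x y _ _ hx hy =>
    have h' : ∀ a b : Cl1 V, psi (a + b) = psi a + psi b := fun a b => by
      rw [psi, map_add]; rfl
    refine ⟨?_, ?_⟩
    · rw [map_add, hx.1, hy.1, h']
      ext i j
      fin_cases i <;> fin_cases j <;> simp
    · rw [map_add, map_add, h', h', hx.2, hy.2]
      simp only [nu, prinAut, tau, map_add]
  | ι_mul_ι_mul p q x _ hx =>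
    have h1 : gamma V (vec1 V p * vec1 V q * x)
        = !![pv V p * prinAut (pv V q) * psi x, 0; 0,
          prinAut (pv V p) * pv V q * prinAut (psi x)] := by
      rw [map_mul, map_mul, gamma_vec1, gamma_vec1, hx.1]
      simp
    have h2 : psi (vec1 V p * vec1 V q * x) = pv V p * prinAut (pv V q) * psi x := by
      rw [psi, h1]; rfl
    refine ⟨?_, ?_⟩
    · rw [h1, h2, prinAut_mul, prinAut_mul, prinAut_prinAut]
    · have h3 : ∀ y : Cl1 V, psi (y * (vec1 V q * vec1 V p))
          = psi y * (pv V q * prinAut (pv V p)) := by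
        intro y
        rw [psi, map_mul, map_mul, gamma_vec1, gamma_vec1, Matrix.mul_apply, Fin.sum_univ_two]
        simp [psi]
      rw [h2, map_mul CliffordAlgebra.involute, map_mul CliffordAlgebra.involute,
        CliffordAlgebra.involute_ι, CliffordAlgebra.involute_ι,
        neg_mul_neg, CliffordAlgebra.reverse.map_mul, CliffordAlgebra.reverse.map_mul,
        CliffordAlgebra.reverse_ι, CliffordAlgebra.reverse_ι, h3, hx.2]
      simp only [nu, prinAut_mul, tau_mul, prinAut_prinAut]
      rw [tau_pv, tau_prinAut (pv V p), tau_pv]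

theorem psi_evenLift (a : Cl V) : psi (evenLift V a) = a := by
  -- The whole matrix is computed because the induction multiplies matrices; the entry alone would
  -- not suffice.
  have h : gamma V (evenLift V a) = !![a, 0; 0, prinAut a] := by
    induction a using CliffordAlgebra.left_induction with
    | algebraMap r =>
      rw [AlgHom.commutes, AlgHom.commutes, prinAut, AlgHom.commutes]
      ext i j
      fin_cases i <;> fin_cases j <;> simp [Matrix.algebraMap_matrix_apply]
    | add x y hx hy =>
      rw [map_add, map_add, hx, hy]
      ext i j
      fin_cases i <;> fin_cases j <;> simp
    | ι_mul x m hx =>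
      rw [map_mul, map_mul, hx, ← vec, evenLift_vec, map_mul, gamma_vec1, gamma_vec1, pv_one,
        prinAut_one, prinAut_mul, prinAut_vec, pv_mk, map_zero, zero_add, prinAut_vec]
      simp
  rw [psi, h]; rfl

end EvenPart

/-! ### Identification of `𝒢` with the image of `Spin⁺` -/

section SpinGroup

variable {V : Type*} [NormedAddCommGroup V] [InnerProductSpace ℝ V] [FiniteDimensional ℝ V]

theorem image_spinG_eq :
    (fun g : (Cl V)ˣ => (g : Cl V)) '' (spinG V : Set (Cl V)ˣ) = psi '' spinPlus V := by
  apply Subset.antisymm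
  · rintro _ ⟨a, ha, rfl⟩
    refine ⟨evenLift V a, ⟨evenLift_mem_even _, ?_, ?_⟩, psi_evenLift _⟩
    · rw [← evenLift_nu, ← map_mul]
      exact (congrArg (evenLift V) ha.2).trans (map_one _)
    · have key : ∀ b : spinG V, ∀ p, ∃ q, evenLift V (elt b) * vec1 V p * evenLift V (elt b⁻¹)
          = vec1 V q := by
        intro b p
        obtain ⟨w', hw', e⟩ := b.2.1 (pv V p) (pv_mem p)
        obtain ⟨q, rfl⟩ := mem_paravectors.mp hw'
        refine ⟨q, ?_⟩
        -- A paravector `p` lifts to `p e₀`, so the relation becomes `A p e₀ = q e₀ (e₀ A e₀)` for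
        -- the lift `A` of `b`, that is `A p = q A`.
        have h1 := congrArg (evenLift V) e
        rw [map_mul, map_mul, evenLift_pv, evenLift_pv, evenLift_prinAut] at h1
        have h2 := congrArg (· * vec1 V (1, 0)) h1
        simp only [mul_assoc, vec1_one_sq, mul_one] at h2
        rw [← mul_assoc (vec1 V (1, 0)), vec1_one_sq, one_mul] at h2
        rw [h2, mul_assoc, ← map_mul]
        have : elt b * elt b⁻¹ = 1 := Units.mul_inv _
        rw [this, map_one, mul_one]
      refine ⟨Units.map (evenLift V : Cl V →* Cl1 V) a, rfl, ?_⟩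
      apply Subset.antisymm
      · rintro _ ⟨_, ⟨p, rfl⟩, rfl⟩
        obtain ⟨q, hq⟩ := key ⟨a, ha⟩ p
        exact ⟨q, hq.symm⟩
      · rintro _ ⟨p, rfl⟩
        obtain ⟨q, hq⟩ := key ⟨a, ha⟩⁻¹ p
        rw [inv_inv] at hq
        refine ⟨_, ⟨q, rfl⟩, ?_⟩
        change _ * vec1 V q * _ = _
        rw [← hq]
        set u := Units.map (evenLift V : Cl V →* Cl1 V) a
        change (u : Cl1 V) * (((u⁻¹ : (Cl1 V)ˣ) : Cl1 V) * _ * (u : Cl1 V)) * ((u⁻¹ : (Cl1 V)ˣ) : Cl1 V) = _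
        simp [mul_assoc]
  · rintro _ ⟨g, ⟨hg, hn, u, rfl, hu⟩, rfl⟩
    obtain ⟨h1, h2⟩ := gamma_of_even hg
    have hmul : ∀ h : Cl1 V, psi ((u : Cl1 V) * h) = psi (u : Cl1 V) * psi h := by
      intro h
      rw [psi, map_mul, h1, Matrix.mul_apply, Fin.sum_univ_two]
      simp [psi]
    have hmul' : ∀ h : Cl1 V, psi (h * (u : Cl1 V)) = psi h * psi (u : Cl1 V) := by
      intro h
      rw [psi, map_mul, h1, Matrix.mul_apply, Fin.sum_univ_two]
      simp [psi]
    have hone : psi (1 : Cl1 V) = 1 := by rw [psi, map_one]; rfl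
    have hν : nu (psi (u : Cl1 V)) * psi (u : Cl1 V) = 1 := by
      rw [← h2, ← hmul', hn, hone]
    refine ⟨⟨psi u, psi ((u⁻¹ : (Cl1 V)ˣ) : Cl1 V), by rw [← hmul, Units.mul_inv, hone],
      by rw [← hmul', Units.inv_mul, hone]⟩, ⟨fun w hw => ?_, hν⟩, rfl⟩
    obtain ⟨p, rfl⟩ := mem_paravectors.mp hw
    have : (u : Cl1 V) * vec1 V p * ((u⁻¹ : (Cl1 V)ˣ) : Cl1 V) ∈ range (vec1 V) := by
      rw [← hu]; exact ⟨_, ⟨p, rfl⟩, rfl⟩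
    obtain ⟨q, hq⟩ := this
    refine ⟨pv V q, pv_mem q, ?_⟩
    have h3 : (u : Cl1 V) * vec1 V p = vec1 V q * u := by rw [hq]; simp [mul_assoc]
    -- The upper right entry of `γ(g p) = γ(q g)` is the transformer relation `ψ(g) p = q π(ψ(g))`.
    have h4 := congrArg (fun M => M 0 1) (congrArg (gamma V) h3)
    rw [map_mul, map_mul, h1, gamma_vec1, gamma_vec1] at h4
    simpa [Matrix.mul_apply, Fin.sum_univ_two] using h4

end SpinGroup

/-! ### Differential calculus of the boost -/

section BoostCalculus

variable {V : Type*} [NormedAddCommGroup V] [InnerProductSpace ℝ V]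

theorem alternating_comp_eq_det [FiniteDimensional ℝ V] {ι : Type*} [Fintype ι] [DecidableEq ι]
    (e : Module.Basis ι ℝ V) (f : V [⋀^ι]→ₗ[ℝ] ℝ) (L : V →ₗ[ℝ] V) (v : ι → V) :
    f (fun i => L (v i)) = LinearMap.det L * f v := by
  rw [f.eq_smul_basis_det e]
  simp only [AlternatingMap.smul_apply, smul_eq_mul]
  have := e.det_comp L v
  rw [Function.comp_def] at this
  rw [this]
  ring

theorem volumeForm_comp_eq_det {n : ℕ} [Fact (Module.finrank ℝ V = n + 1)]
    (o : Orientation ℝ V (Fin (n + 1))) (L : V →ₗ[ℝ] V) (v : Fin (n + 1) → V) :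
    o.volumeForm (fun i => L (v i)) = LinearMap.det L * o.volumeForm v := by
  have : FiniteDimensional ℝ V := Module.finite_of_finrank_eq_succ (Fact.out : _ = n + 1)
  exact alternating_comp_eq_det (Module.finBasisOfFinrankEq ℝ V Fact.out) _ L v

variable {α : ℝ} {u x : V}

/-- The denominator `1 + α² + 2 α (u · x)` of the boost. -/
def boostDen (α : ℝ) (u x : V) : ℝ := 1 + α ^ 2 + 2 * α * inner ℝ u x

theorem boostDen_pos (hα : 0 ≤ α) (hα1 : α < 1) (hu : ‖u‖ = 1) (hx : ‖x‖ ≤ 1) :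
    0 < boostDen α u x := by
  have h := neg_le_of_abs_le (abs_real_inner_le_norm u x)
  rw [hu, one_mul] at h
  have h2 : -1 ≤ inner ℝ u x := by linarith
  unfold boostDen
  -- The denominator is at least `1 + α² - 2 α = (1 - α)² > 0`.
  nlinarith [mul_le_mul_of_nonneg_left h2 hα, sq_nonneg (1 - α), mul_pos (sub_pos.mpr hα1) (sub_pos.mpr hα1)]

theorem boostFactor_eq (α : ℝ) (u x : V) : boostFactor α u x = (1 - α ^ 2) / boostDen α u x := rfl

theorem boostFactor_pos (hα : 0 ≤ α) (hα1 : α < 1) (hu : ‖u‖ = 1) (hx : ‖x‖ ≤ 1) :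
    0 < boostFactor α u x :=
  div_pos (by nlinarith) (boostDen_pos hα hα1 hu hx)

/-- The numerator of the boost. -/
def boostNum (α : ℝ) (u x : V) : V := (1 - α ^ 2) • x + (2 * α * (1 + α * inner ℝ u x)) • u

theorem boostMap_eq (α : ℝ) (u x : V) : boostMap α u x = (boostDen α u x)⁻¹ • boostNum α u x := rfl

/-- The vector `k` in the derivative `h ↦ ρ (h + (u · h) k)` of the boost. -/
def boostShift (α : ℝ) (u x : V) : V :=
  (1 - α ^ 2)⁻¹ • ((2 * α ^ 2) • u - (2 * α) • boostMap α u x)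

/-- The derivative of the boost. -/
def boostDeriv (α : ℝ) (u x : V) : V →L[ℝ] V :=
  boostFactor α u x • (ContinuousLinearMap.id ℝ V + (innerSL ℝ u).smulRight (boostShift α u x))

theorem boostDeriv_apply (h : V) :
    boostDeriv α u x h = boostFactor α u x • (h + (inner ℝ u h : ℝ) • boostShift α u x) := rfl

/-- For the quotient `F = N / d` of numerator by denominator, the derivative is `(dN - F dd) / d`.
Here `dN` is `1 - α²` times the identity plus `2 α² u ⊗ u`, and `dd = 2 α u`; taking out `ρ = (1 -
α²) / d` leaves the rank one term with vector `k`. -/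
theorem hasFDerivAt_boostMap (hα : 1 - α ^ 2 ≠ 0) (hd : boostDen α u x ≠ 0) :
    HasFDerivAt (boostMap α u) (boostDeriv α u x) x := by
  have hi : HasFDerivAt (fun y : V => (inner ℝ u y : ℝ)) (innerSL ℝ u) x :=
    (innerSL ℝ u).hasFDerivAt
  have hden : HasFDerivAt (fun y => boostDen α u y) ((2 * α) • innerSL ℝ u) x :=
    (hi.const_mul (2 * α)).const_add (1 + α ^ 2)
  have hc : HasFDerivAt (fun y : V => 2 * α * (1 + α * (inner ℝ u y : ℝ)))
      ((2 * α) • α • innerSL ℝ u) x := ((hi.const_mul α).const_add 1).const_mul (2 * α)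
  have hnum : HasFDerivAt (fun y => boostNum α u y)
      ((1 - α ^ 2) • ContinuousLinearMap.id ℝ V + ((2 * α) • α • innerSL ℝ u).smulRight u) x :=
    ((hasFDerivAt_id x).const_smul (1 - α ^ 2)).add (hc.smul_const u)
  have h := ((hasDerivAt_inv hd).comp_hasFDerivAt x hden).smul hnum
  refine h.congr_fderiv ?_
  ext v
  simp only [boostDeriv_apply, boostShift, boostMap_eq, boostFactor_eq, add_apply, _root_.smul_apply,
    ContinuousLinearMap.smulRight_apply, ContinuousLinearMap.id_apply,
    innerSL_apply_apply, smul_eq_mul, Function.comp_apply]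
  -- The identity is linear in the value of the numerator, which can stay opaque.
  generalize boostNum α u x = N
  match_scalars <;> field_simp

theorem contDiffAt_boostMap (hd : boostDen α u x ≠ 0) : ContDiffAt ℝ ∞ (boostMap α u) x := by
  have hi : ContDiff ℝ ∞ (fun y : V => (inner ℝ u y : ℝ)) := (innerSL ℝ u).contDiff
  have hden : ContDiff ℝ ∞ (fun y => boostDen α u y) := by unfold boostDen; fun_prop
  have hnum : ContDiff ℝ ∞ (fun y => boostNum α u y) := by unfold boostNum; fun_prop
  exact (hden.contDiffAt.inv hd).smul hnum.contDiffAt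

theorem inner_boostMap (hu : ‖u‖ = 1) (hd : boostDen α u x ≠ 0) :
    inner ℝ u (boostMap α u x) = ((1 + α ^ 2) * inner ℝ u x + 2 * α) / boostDen α u x := by
  rw [boostMap_eq, boostNum, real_inner_smul_right, inner_add_right, real_inner_smul_right,
    real_inner_smul_right, real_inner_self_eq_norm_sq, hu]
  field_simp
  ring

theorem one_add_inner_boostShift (hu : ‖u‖ = 1) (hα : 1 - α ^ 2 ≠ 0) (hd : boostDen α u x ≠ 0) :
    1 + inner ℝ u (boostShift α u x) = boostFactor α u x := by
  rw [boostShift, real_inner_smul_right, inner_sub_right, real_inner_smul_right,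
    real_inner_smul_right, real_inner_self_eq_norm_sq, hu, inner_boostMap hu hd, boostFactor_eq]
  field_simp
  rw [boostDen]
  ring

/-- The scalar `ρ` contributes one factor per dimension, and the transvection `h ↦ h + (u · h) k`
has determinant `1 + u · k`, which is one further `ρ`. -/
theorem det_boostDeriv [FiniteDimensional ℝ V] (hu : ‖u‖ = 1) (hα : 1 - α ^ 2 ≠ 0)
    (hd : boostDen α u x ≠ 0) :
    LinearMap.det (boostDeriv α u x : V →ₗ[ℝ] V)
      = boostFactor α u x ^ (Module.finrank ℝ V + 1) := by
  have e : (boostDeriv α u x : V →ₗ[ℝ] V) = boostFactor α u x •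
      LinearMap.transvection (innerₗ V u) (boostShift α u x) := by
    ext h
    simp [boostDeriv_apply, LinearMap.transvection.apply]
  rw [e, LinearMap.det_smul, LinearMap.transvection.det, pow_succ]
  congr 1
  exact one_add_inner_boostShift hu hα hd

theorem norm_boostMap (hu : ‖u‖ = 1) (hx : ‖x‖ = 1) (hd : boostDen α u x ≠ 0) :
    inner ℝ (boostMap α u x) (boostMap α u x) = (1 : ℝ) := by
  have huu : inner ℝ u u = (1 : ℝ) := by rw [real_inner_self_eq_norm_sq, hu]; norm_num
  have hxx : inner ℝ x x = (1 : ℝ) := by rw [real_inner_self_eq_norm_sq, hx]; norm_num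
  rw [boostMap_eq, real_inner_smul_left, real_inner_smul_right, boostNum]
  simp only [inner_add_left, inner_add_right, real_inner_smul_left, real_inner_smul_right,
    huu, hxx, real_inner_comm u x]
  field_simp
  rw [boostDen]
  ring

theorem inner_boostMap_of_orthogonal {v : V} (hv : inner ℝ x v = (0 : ℝ)) :
    inner ℝ (boostMap α u x) v
      = 2 * α * (1 + α * inner ℝ u x) * inner ℝ u v / boostDen α u x := by
  rw [boostMap_eq, boostNum, real_inner_smul_left, inner_add_left, real_inner_smul_left,
    real_inner_smul_left, hv]
  ring

theorem inner_boostShift_of_orthogonal {v : V} (hα : 1 - α ^ 2 ≠ 0) (hd : boostDen α u x ≠ 0)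
    (hv : inner ℝ x v = (0 : ℝ)) :
    inner ℝ (boostShift α u x) v = -(2 * α ^ 2 * inner ℝ u v) / boostDen α u x := by
  rw [boostShift, real_inner_smul_left, inner_sub_left, real_inner_smul_left,
    real_inner_smul_left, inner_boostMap_of_orthogonal hv]
  field_simp
  rw [boostDen]
  ring

theorem inner_boostShift_boostMap (hu : ‖u‖ = 1) (hx : ‖x‖ = 1) (hα : 1 - α ^ 2 ≠ 0)
    (hd : boostDen α u x ≠ 0) :
    inner ℝ (boostShift α u x) (boostMap α u x)
      = -(2 * α * (1 + α * inner ℝ u x)) / boostDen α u x := by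
  rw [boostShift, real_inner_smul_left, inner_sub_left, real_inner_smul_left,
    real_inner_smul_left, norm_boostMap hu hx hd, inner_boostMap hu hd]
  field_simp
  rw [boostDen]
  ring

theorem inner_boostShift_self (hu : ‖u‖ = 1) (hx : ‖x‖ = 1) (hα : 1 - α ^ 2 ≠ 0)
    (hd : boostDen α u x ≠ 0) :
    inner ℝ (boostShift α u x) (boostShift α u x) = 4 * α ^ 2 / boostDen α u x := by
  rw [boostShift, real_inner_smul_left, real_inner_smul_right]
  simp only [inner_sub_left, inner_sub_right, real_inner_smul_left, real_inner_smul_right,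
    norm_boostMap hu hx hd, real_inner_comm u (boostMap α u x), inner_boostMap hu hd]
  rw [real_inner_self_eq_norm_sq, hu]
  field_simp
  rw [boostDen]
  ring

/-- The boost is conformal on the sphere. -/
theorem inner_boostDeriv (hu : ‖u‖ = 1) (hx : ‖x‖ = 1) (hα : 1 - α ^ 2 ≠ 0)
    (hd : boostDen α u x ≠ 0) {v w : V} (hv : inner ℝ x v = (0 : ℝ)) (hw : inner ℝ x w = (0 : ℝ)) :
    inner ℝ (boostDeriv α u x v) (boostDeriv α u x w)
      = boostFactor α u x ^ 2 * inner ℝ v w := by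
  rw [boostDeriv_apply, boostDeriv_apply, real_inner_smul_left, real_inner_smul_right]
  simp only [inner_add_left, inner_add_right, real_inner_smul_left, real_inner_smul_right,
    inner_boostShift_of_orthogonal hα hd hw, inner_boostShift_self hu hx hα hd]
  rw [real_inner_comm (boostShift α u x) v, inner_boostShift_of_orthogonal hα hd hv]
  -- The coefficient of `(u · v) (u · w)` vanishes: each of the two cross terms contributes `-2 α² /
  -- d`, and `k · k` contributes `4 α² / d`, with `d` the denominator of the boost.
  field_simp
  ring

theorem inner_boostDeriv_boostMap (hu : ‖u‖ = 1) (hx : ‖x‖ = 1) (hα : 1 - α ^ 2 ≠ 0)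
    (hd : boostDen α u x ≠ 0) {v : V} (hv : inner ℝ x v = (0 : ℝ)) :
    inner ℝ (boostDeriv α u x v) (boostMap α u x) = (0 : ℝ) := by
  rw [boostDeriv_apply, real_inner_smul_left, inner_add_left, real_inner_smul_left,
    inner_boostShift_boostMap hu hx hα hd, real_inner_comm, inner_boostMap_of_orthogonal hv]
  ring

theorem inner_boostDeriv_self_boostMap (hu : ‖u‖ = 1) (hx : ‖x‖ = 1) (hα : 1 - α ^ 2 ≠ 0)
    (hd : boostDen α u x ≠ 0) :
    inner ℝ (boostDeriv α u x x) (boostMap α u x) = boostFactor α u x ^ 2 := by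
  rw [boostDeriv_apply, real_inner_smul_left, inner_add_left, real_inner_smul_left,
    inner_boostShift_boostMap hu hx hα hd, sq]
  congr 1
  rw [boostMap_eq, boostNum, real_inner_smul_right, inner_add_right, real_inner_smul_right,
    real_inner_smul_right, real_inner_self_eq_norm_sq, hx, boostFactor_eq, real_inner_comm u x]
  field_simp
  ring

/-- The derivative of the radial extension of the boost at a point of the sphere. -/
def boostConeDeriv (α : ℝ) (u x : V) : V →L[ℝ] V :=
  boostDeriv α u x + (innerSL ℝ x).smulRight (boostMap α u x - boostDeriv α u x x)

theorem boostConeDeriv_apply (h : V) : boostConeDeriv α u x h = boostDeriv α u x h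
    + (inner ℝ x h : ℝ) • (boostMap α u x - boostDeriv α u x x) := rfl

/-- Let `D` be the derivative of the boost `F`, and write `F(x) = D y`. The radial derivative is `D`
after the transvection `h ↦ h + (x · h) (y - x)`, so its determinant is `ρ^(n+2) (x · y)`. The part
of `y` orthogonal to `x` is sent by `D` to a vector orthogonal to `F(x)`. Pairing `D y` with `F(x)`
hence gives `1 = (x · y) ρ²`. -/
theorem det_boostConeDeriv {n : ℕ} [FiniteDimensional ℝ V] (hn : Module.finrank ℝ V = n + 1)
    (hu : ‖u‖ = 1) (hx : ‖x‖ = 1) (hα : 1 - α ^ 2 ≠ 0) (hd : boostDen α u x ≠ 0) :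
    LinearMap.det (boostConeDeriv α u x : V →ₗ[ℝ] V) = boostFactor α u x ^ n := by
  have hρ : boostFactor α u x ≠ 0 := div_ne_zero hα hd
  have hdet := det_boostDeriv hu hα hd (x := x)
  have hdet0 : LinearMap.det (boostDeriv α u x : V →ₗ[ℝ] V) ≠ 0 := by
    rw [hdet]; exact pow_ne_zero _ hρ
  obtain ⟨y, hy⟩ : ∃ y, boostDeriv α u x y = boostMap α u x :=
    (LinearMap.equivOfDetNeZero (boostDeriv α u x : V →ₗ[ℝ] V) hdet0).surjective _
  have e : (boostConeDeriv α u x : V →ₗ[ℝ] V) = (boostDeriv α u x : V →ₗ[ℝ] V) ∘ₗ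
      LinearMap.transvection (innerₗ V x) (y - x) := by
    ext h
    simp [boostConeDeriv_apply, LinearMap.transvection.apply, hy]
  have hxx : inner ℝ x x = (1 : ℝ) := by rw [real_inner_self_eq_norm_sq, hx]; norm_num
  have hperp : inner ℝ x (y - (inner ℝ x y : ℝ) • x) = (0 : ℝ) := by
    rw [inner_sub_right, real_inner_smul_right, hxx]; ring
  have h1 : inner ℝ x y * boostFactor α u x ^ 2 = 1 := by
    have h2 := inner_boostDeriv_boostMap hu hx hα hd hperp
    rw [map_sub, map_smul, hy, inner_sub_left, norm_boostMap hu hx hd, real_inner_smul_left,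
      inner_boostDeriv_self_boostMap hu hx hα hd] at h2
    linarith
  rw [e, LinearMap.det_comp, LinearMap.transvection.det, hdet, hn]
  simp only [innerₗ_apply_apply, inner_sub_right, hxx, add_sub_cancel]
  calc boostFactor α u x ^ (n + 1 + 1) * inner ℝ x y
      = boostFactor α u x ^ n * (inner ℝ x y * boostFactor α u x ^ 2) := by ring
    _ = _ := by rw [h1, mul_one]

/-- At a unit vector the norm has derivative `x · h` and the radial projection has derivative `h -
(x · h) x`. The result agrees with `L` on tangent vectors and sends `x` to `F(x)`. -/
theorem hasFDerivAt_coneExt {f : Sph V → Sph V} {x : Sph V} {F : V → V} {L : V →L[ℝ] V}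
    (hf : ∀ y, (f y : V) = F y) (hF : HasFDerivAt F L (x : V)) :
    HasFDerivAt (coneExt f) (L + (innerSL ℝ (x : V)).smulRight (F x - L x)) (x : V) := by
  have hx : ‖(x : V)‖ = 1 := by simp
  have hx0 : (x : V) ≠ 0 := by intro h; rw [h] at hx; simp at hx
  have hnorm : HasFDerivAt (fun v : V => ‖v‖) (innerSL ℝ (x : V)) (x : V) := by
    have h := (hasStrictFDerivAt_norm_sq (x : V)).hasFDerivAt.sqrt (by rw [hx]; norm_num)
    simp only [Real.sqrt_sq (norm_nonneg _), hx] at h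
    refine h.congr_fderiv ?_
    ext v; simp
  have hinv : HasFDerivAt (fun v : V => ‖v‖⁻¹ • v)
      (ContinuousLinearMap.id ℝ V - (innerSL ℝ (x : V)).smulRight (x : V)) (x : V) := by
    refine (((hasDerivAt_inv (by rw [hx]; norm_num)).comp_hasFDerivAt (x : V) hnorm).smul
      (hasFDerivAt_id (x : V))).congr_fderiv ?_
    ext v
    simp [hx, sub_eq_add_neg]
  have hF' : HasFDerivAt F L ((fun v : V => ‖v‖⁻¹ • v) (x : V)) := by simpa [hx] using hF
  have h := hnorm.smul (HasFDerivAt.comp (f := fun v : V => ‖v‖⁻¹ • v) (x : V) hF' hinv)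
  refine (h.congr_fderiv ?_).congr_of_eventuallyEq ?_
  · ext v
    simp [hx, smul_sub]
    abel
  · filter_upwards [isOpen_ne.mem_nhds hx0] with v hv
    rw [coneExt_of_ne f hv, hf]
    rfl

end BoostCalculus

/-! ### The action on the sphere and its effect on distances -/

section SphereAction

variable {V : Type*} [NormedAddCommGroup V] [InnerProductSpace ℝ V] [FiniteDimensional ℝ V]

theorem sph_norm (x : Sph V) : ‖(x : V)‖ = 1 := mem_sphere_zero_iff_norm.mp x.2

/-- This translates between Lorentz products of light vectors and chordal distances, in both
directions of the correspondence. -/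
theorem lor_sph (x y : Sph V) : lor (1, (x : V)) (1, (y : V)) = dist x y ^ 2 / 2 := by
  rw [Subtype.dist_eq, dist_eq_norm, norm_sub_sq_real, sph_norm, sph_norm, lor]
  ring

theorem lor_sph_self (x : Sph V) : lor (1, (x : V)) (1, (x : V)) = 0 := by
  rw [lor_sph, dist_self]; norm_num

theorem norm_phi_sph (g : spinG V) (x : Sph V) : ‖(phi g (sphToBall x) : V)‖ = 1 := by
  have h := lor_lorentzMap_self g (1, ((sphToBall x : Ball V) : V))
  have hd := denom_pos g (sphToBall x)
  rw [lorentzMap_ball, lor_smul_left, lor_smul_right, lor_self] at h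
  change _ = lor (1, (x : V)) (1, (x : V)) at h
  rw [lor_sph_self, mul_eq_zero, mul_eq_zero] at h
  have h2 := (h.resolve_left hd.ne').resolve_left hd.ne'
  simp only at h2
  nlinarith [norm_nonneg (phi g (sphToBall x) : V)]

/-- The action of the group on the sphere. -/
def sphMap (g : spinG V) (x : Sph V) : Sph V :=
  ⟨phi g (sphToBall x), mem_sphere_zero_iff_norm.mpr (norm_phi_sph g x)⟩

theorem sphMap_mul (g h : spinG V) (x : Sph V) : sphMap (g * h) x = sphMap g (sphMap h x) := by
  apply Subtype.ext
  exact congrArg (fun y : Ball V => (y : V)) (phi_mul g h (sphToBall x))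

theorem sphMap_one (x : Sph V) : sphMap (1 : spinG V) x = x := by
  apply Subtype.ext
  exact congrArg (fun y : Ball V => (y : V)) (phi_one (sphToBall x))

variable (V) in
/-- The action of the group on the sphere, as a homomorphism. -/
def sphHom : spinG V →* Equiv.Perm (Sph V) where
  toFun g := ⟨sphMap g, sphMap g⁻¹, fun x => by rw [← sphMap_mul, inv_mul_cancel, sphMap_one],
    fun x => by rw [← sphMap_mul, mul_inv_cancel, sphMap_one]⟩
  map_one' := Equiv.ext sphMap_one
  map_mul' g h := Equiv.ext (sphMap_mul g h)

theorem sphHom_apply (g : spinG V) (x : Sph V) : sphHom V g x = sphMap g x := rfl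

theorem denom_sph_pos (g : spinG V) (x : Sph V) : 0 < denom g x := denom_pos g (sphToBall x)

theorem lorentzMap_sph (g : spinG V) (x : Sph V) :
    lorentzMap g (1, (x : V)) = denom g x • (1, (sphMap g x : V)) :=
  lorentzMap_ball g (sphToBall x)

theorem sphMap_eq_of_lorentzMap {g : spinG V} {x y : Sph V} {c : ℝ}
    (h : lorentzMap g (1, (x : V)) = c • (1, (y : V))) : sphMap g x = y := by
  have : phi g (sphToBall x) = sphToBall y := phi_eq_of_lorentzMap h
  exact Subtype.ext (congrArg (fun y : Ball V => (y : V)) this)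

theorem dist_sphMap_sq (g : spinG V) (x y : Sph V) :
    denom g x * denom g y * dist (sphMap g x) (sphMap g y) ^ 2 = dist x y ^ 2 := by
  have h := lor_lorentzMap g (1, (x : V)) (1, (y : V))
  rw [lorentzMap_sph, lorentzMap_sph, lor_smul_left, lor_smul_right, lor_sph, lor_sph] at h
  linarith

theorem dist_sphMap (g : spinG V) (x y : Sph V) :
    dist (sphMap g x) (sphMap g y)
      = dist x y * (√(denom g x))⁻¹ * (√(denom g y))⁻¹ := by
  have hx := denom_sph_pos g x
  have hy := denom_sph_pos g y
  rw [← sq_eq_sq₀ dist_nonneg (by positivity), mul_pow, mul_pow, ← dist_sphMap_sq g x y, inv_pow,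
    inv_pow, Real.sq_sqrt hx.le, Real.sq_sqrt hy.le]
  field_simp

/-- Each of the four points occurs once in the numerator and once in the denominator, so the point
factors cancel. -/
theorem sphHom_mem_mobiusGroup (g : spinG V) : sphHom V g ∈ mobiusGroup V := by
  intro a b x y hab hxy
  have h1 : dist a b ≠ 0 := dist_ne_zero.mpr hab
  have h2 : dist x y ≠ 0 := dist_ne_zero.mpr hxy
  have hs : ∀ z : Sph V, √(denom g z) ≠ 0 := fun z => (Real.sqrt_pos.mpr (denom_sph_pos g z)).ne'
  have ha := hs a
  have hb := hs b
  have hx := hs x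
  have hy := hs y
  simp only [crossRatio, sphHom_apply, dist_sphMap]
  field_simp

end SphereAction

/-! ### The spin-boosts as group elements -/

section Boosts

variable {V : Type*} [NormedAddCommGroup V] [InnerProductSpace ℝ V] [FiniteDimensional ℝ V]
  {α : ℝ} {u : V}

/-- The paravector `(1 + α u) / √(1 - α²)`. -/
def boostPara (α : ℝ) (u : V) : ℝ × V := (√(1 - α ^ 2))⁻¹ • (1, α • u)

theorem inv_sqrt_mul_self (hα : 0 < 1 - α ^ 2) :
    (√(1 - α ^ 2))⁻¹ * (√(1 - α ^ 2))⁻¹ = (1 - α ^ 2)⁻¹ := by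
  rw [← mul_inv, Real.mul_self_sqrt hα.le]

theorem lor_boostPara (hα : 0 < 1 - α ^ 2) (hu : ‖u‖ = 1) :
    lor (boostPara α u) (boostPara α u) = 1 := by
  rw [boostPara, lor_smul_left, lor_smul_right, ← mul_assoc, inv_sqrt_mul_self hα, lor_self,
    norm_smul, hu, mul_one, Real.norm_eq_abs, sq_abs, one_pow, inv_mul_cancel₀ hα.ne']

/-- The boost `(1 + α u) / √(1 - α²)` as an element of the group. -/
def boostElt (α : ℝ) (u : V) (hα : 0 < 1 - α ^ 2) (hu : ‖u‖ = 1) : spinG V :=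
  paraElt (boostPara α u) (lor_boostPara hα hu)

theorem elt_boostElt (hα : 0 < 1 - α ^ 2) (hu : ‖u‖ = 1) :
    elt (boostElt α u hα hu) = (√(1 - α ^ 2))⁻¹ • (1 + α • vec V u) := by
  rw [boostElt, elt_paraElt, boostPara, map_smul, pv_mk, map_one, map_smul]

theorem boostPara_fst_pos (hα : 0 < 1 - α ^ 2) : 0 < (boostPara α u).1 := by
  simp only [boostPara, Prod.smul_fst, smul_eq_mul, mul_one]
  exact inv_pos.mpr (Real.sqrt_pos.mpr hα)

theorem boostElt_mem (hα : 0 < 1 - α ^ 2) (hu : ‖u‖ = 1) : boostElt α u hα hu ∈ spinBoosts V :=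
  isPositive_pv (lor_boostPara hα hu) (boostPara_fst_pos hα)

theorem lorentzMap_boostElt (hα : 0 < 1 - α ^ 2) (hu : ‖u‖ = 1) (x : V) :
    lorentzMap (boostElt α u hα hu) (1, x)
      = ((1 - α ^ 2)⁻¹) • (boostDen α u x, boostNum α u x) := by
  have h1 : lor (boostPara α u) (1, -x) = (√(1 - α ^ 2))⁻¹ * (1 + α * inner ℝ u x) := by
    rw [boostPara, lor_smul_left, lor]
    simp only [inner_neg_right, real_inner_smul_left]
    ring
  rw [boostElt, lorentzMap_paraElt, h1, boostPara, smul_smul]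
  have h2 : 2 * ((√(1 - α ^ 2))⁻¹ * (1 + α * inner ℝ u x)) * (√(1 - α ^ 2))⁻¹
      = (1 - α ^ 2)⁻¹ * (2 * (1 + α * inner ℝ u x)) := by
    rw [← inv_sqrt_mul_self hα]; ring
  rw [h2]
  have h3 := hα.ne'
  apply Prod.ext
  · simp only [Prod.smul_fst, Prod.fst_sub, smul_eq_mul, boostDen]
    field_simp
    ring
  · simp only [Prod.smul_snd, Prod.snd_sub, boostNum]
    match_scalars <;> field_simp

theorem phi_boostElt (hα0 : 0 ≤ α) (hα1 : α < 1) (hα : 0 < 1 - α ^ 2) (hu : ‖u‖ = 1) (x : Ball V) :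
    (phi (boostElt α u hα hu) x : V) = boostMap α u x := by
  have hd := boostDen_pos hα0 hα1 hu (mem_closedBall_zero_iff.mp x.2)
  rw [phi_coe, denom, lorentzMap_boostElt hα hu, boostMap_eq]
  simp only [Prod.smul_fst, Prod.smul_snd, smul_smul, smul_eq_mul]
  congr 1
  have := hα.ne'
  field_simp

theorem sphMap_boostElt (hα0 : 0 ≤ α) (hα1 : α < 1) (hα : 0 < 1 - α ^ 2) (hu : ‖u‖ = 1)
    (x : Sph V) : (sphMap (boostElt α u hα hu) x : V) = boostMap α u x :=
  phi_boostElt hα0 hα1 hα hu (sphToBall x)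

theorem boostElt_inv (hα : 0 < 1 - α ^ 2) (hu : ‖u‖ = 1) :
    (boostElt α u hα hu)⁻¹ = boostElt α (-u) hα ((norm_neg u).trans hu) := by
  apply elt_injective
  rw [elt_inv, boostElt, boostElt, elt_paraElt, elt_paraElt, nu, tau_prinAut, tau_pv, prinAut_pv]
  congr 1
  simp [boostPara]

theorem preservesOrientation_boostElt (hα0 : 0 ≤ α) (hα1 : α < 1) (hα : 0 < 1 - α ^ 2)
    (hu : ‖u‖ = 1) : PreservesOrientation (sphHom V (boostElt α u hα hu)) := by
  intro x
  have hx := sph_norm x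
  have hd := boostDen_pos hα0 hα1 hu hx.le
  have h := hasFDerivAt_coneExt (f := sphMap (boostElt α u hα hu)) (x := x)
    (sphMap_boostElt hα0 hα1 hα hu) (hasFDerivAt_boostMap hα.ne' hd.ne')
  have hpos : Module.finrank ℝ V ≠ 0 := by
    have : Nontrivial V := ⟨(x : V), 0, by intro h; rw [h] at hx; simp at hx⟩
    exact Module.finrank_pos.ne'
  obtain ⟨n, hn⟩ := Nat.exists_eq_succ_of_ne_zero hpos
  change 0 < (fderiv ℝ (coneExt (sphMap (boostElt α u hα hu))) (x : V)).det
  rw [h.fderiv]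
  change 0 < LinearMap.det (boostConeDeriv α u (x : V) : V →ₗ[ℝ] V)
  rw [det_boostConeDeriv hn hu hx hα.ne' hd.ne']
  exact pow_pos (boostFactor_pos hα0 hα1 hu hx.le) n

end Boosts

/-! ### The boost as a conformal diffeomorphism of the sphere -/

section BoostGeometry

variable {V : Type*} [NormedAddCommGroup V] [InnerProductSpace ℝ V] [FiniteDimensional ℝ V]
  {α : ℝ} {u : V} {n : ℕ} [Fact (Module.finrank ℝ V = n + 1)]

theorem contMDiff_sphMap_boostElt (hα0 : 0 ≤ α) (hα1 : α < 1) (hα : 0 < 1 - α ^ 2) (hu : ‖u‖ = 1) :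
    ContMDiff (𝓡 n) (𝓡 n) ∞ (sphMap (boostElt α u hα hu) : Sph V → Sph V) := by
  have h : ContMDiff (𝓡 n) 𝓘(ℝ, V) ∞ (fun x : Sph V => boostMap α u (x : V)) := by
    intro x
    have hd := boostDen_pos hα0 hα1 hu (sph_norm x).le
    exact (contDiffAt_boostMap hd.ne').contMDiffAt.comp x (contMDiff_coe_sphere x)
  have h2 : ∀ x : Sph V, boostMap α u (x : V) ∈ sphere (0 : V) 1 := fun x => by
    rw [← sphMap_boostElt hα0 hα1 hα hu]; exact (sphMap _ x).2
  have h3 := ContMDiff.codRestrict_sphere (n := n) h h2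
  have e : (sphMap (boostElt α u hα hu) : Sph V → Sph V) = Set.codRestrict _ _ h2 := by
    funext x
    exact Subtype.ext (sphMap_boostElt hα0 hα1 hα hu x)
  rw [e]
  exact h3

variable (n) in
/-- The boost as a diffeomorphism of the sphere. -/
def boostDiffeo (hα0 : 0 ≤ α) (hα1 : α < 1) (hα : 0 < 1 - α ^ 2) (hu : ‖u‖ = 1) :
    Diffeomorph (𝓡 n) (𝓡 n) (Sph V) (Sph V) ∞ where
  toEquiv := sphHom V (boostElt α u hα hu)
  contMDiff_toFun := contMDiff_sphMap_boostElt hα0 hα1 hα hu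
  contMDiff_invFun := by
    change ContMDiff (𝓡 n) (𝓡 n) ∞ (sphMap (boostElt α u hα hu)⁻¹ : Sph V → Sph V)
    rw [boostElt_inv hα hu]
    exact contMDiff_sphMap_boostElt hα0 hα1 hα _

theorem inner_tangentToAmbient (x : Sph V) (v : TangentSpace (𝓡 n) x) :
    inner ℝ (x : V) (tangentToAmbient (n := n) x v) = (0 : ℝ) := by
  have h := range_mvfderiv_subtypeVal (n := n) x
  have h2 : tangentToAmbient (n := n) x v ∈ (Submodule.span ℝ {(x : V)})ᗮ := by
    rw [← h]; exact ⟨v, rfl⟩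
  exact Submodule.mem_orthogonal_singleton_iff_inner_right.mp h2

/-- This is the chain rule on both sides of the relation that the inclusion after `D` is the boost
of `V` after the inclusion. It moves the metric and volume computations into `V`. -/
theorem tangentToAmbient_mfderiv (hα0 : 0 ≤ α) (hα1 : α < 1) (hα : 0 < 1 - α ^ 2) (hu : ‖u‖ = 1)
    (x : Sph V) (v : TangentSpace (𝓡 n) x) :
    tangentToAmbient (n := n) (boostDiffeo n hα0 hα1 hα hu x)
        (mfderiv (𝓡 n) (𝓡 n) (boostDiffeo n hα0 hα1 hα hu) x v)
      = boostDeriv α u (x : V) (tangentToAmbient (n := n) x v) := by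
  have hd := boostDen_pos hα0 hα1 hu (sph_norm x).le
  have hcoe : ∀ y : Sph V, MDifferentiableAt (𝓡 n) 𝓘(ℝ, V) (Subtype.val : Sph V → V) y :=
    fun y => (contMDiff_coe_sphere (m := 1) (n := n) y).mdifferentiableAt one_ne_zero
  have hD : MDifferentiableAt (𝓡 n) (𝓡 n) (boostDiffeo n hα0 hα1 hα hu) x :=
    (boostDiffeo n hα0 hα1 hα hu).contMDiff.mdifferentiableAt (by simp)
  have hF := hasFDerivAt_boostMap (u := u) hα.ne' hd.ne'
  have e : (Subtype.val : Sph V → V) ∘ (boostDiffeo n hα0 hα1 hα hu) = boostMap α u ∘ Subtype.val := by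
    funext y; exact sphMap_boostElt hα0 hα1 hα hu y
  have h1 := mfderiv_comp x (hcoe (boostDiffeo n hα0 hα1 hα hu x)) hD
  have h2 := mfderiv_comp x hF.differentiableAt.mdifferentiableAt (hcoe x)
  rw [e, h2, mfderiv_eq_fderiv, hF.fderiv] at h1
  exact (DFunLike.congr_fun h1 v).symm

theorem sphereMetric_boostDiffeo (hα0 : 0 ≤ α) (hα1 : α < 1) (hα : 0 < 1 - α ^ 2) (hu : ‖u‖ = 1)
    (x : Sph V) (v w : TangentSpace (𝓡 n) x) :
    sphereMetric (n := n) (boostDiffeo n hα0 hα1 hα hu x)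
        (mfderiv (𝓡 n) (𝓡 n) (boostDiffeo n hα0 hα1 hα hu) x v)
        (mfderiv (𝓡 n) (𝓡 n) (boostDiffeo n hα0 hα1 hα hu) x w)
      = boostFactor α u x ^ 2 * sphereMetric (n := n) x v w := by
  have hd := boostDen_pos hα0 hα1 hu (sph_norm x).le
  rw [sphereMetric, tangentToAmbient_mfderiv, tangentToAmbient_mfderiv,
    inner_boostDeriv hu (sph_norm x) hα.ne' hd.ne' (inner_tangentToAmbient (n := n) x v)
      (inner_tangentToAmbient x w), sphereMetric]

/-- The radial derivative sends the outer normal `x` to the outer normal at the image and agrees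
with the boost derivative on tangent vectors. The whole frame is thus moved by one linear map of
determinant `ρ^n`. -/
theorem sphereVolumeForm_boostDiffeo (hα0 : 0 ≤ α) (hα1 : α < 1) (hα : 0 < 1 - α ^ 2)
    (hu : ‖u‖ = 1) (o : Orientation ℝ V (Fin (n + 1))) (x : Sph V)
    (v : Fin n → TangentSpace (𝓡 n) x) :
    sphereVolumeForm o (boostDiffeo n hα0 hα1 hα hu x)
        (fun i => mfderiv (𝓡 n) (𝓡 n) (boostDiffeo n hα0 hα1 hα hu) x (v i))
      = boostFactor α u x ^ n * sphereVolumeForm o x v := by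
  have hx := sph_norm x
  have hd := boostDen_pos hα0 hα1 hu hx.le
  have e : (Fin.cons ((boostDiffeo n hα0 hα1 hα hu x : Sph V) : V) fun i =>
      tangentToAmbient (n := n) (boostDiffeo n hα0 hα1 hα hu x)
        (mfderiv (𝓡 n) (𝓡 n) (boostDiffeo n hα0 hα1 hα hu) x (v i)) : Fin (n + 1) → V)
      = fun i => (boostConeDeriv α u (x : V) : V →ₗ[ℝ] V)
        ((Fin.cons (x : V) fun i => tangentToAmbient x (v i) : Fin (n + 1) → V) i) := by
    funext i
    refine Fin.cases ?_ (fun j => ?_) i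
    · simp only [Fin.cons_zero, ContinuousLinearMap.coe_coe, boostConeDeriv_apply,
        real_inner_self_eq_norm_sq, hx, one_pow, one_smul, add_sub_cancel]
      exact sphMap_boostElt hα0 hα1 hα hu x
    · simp only [Fin.cons_succ, ContinuousLinearMap.coe_coe, boostConeDeriv_apply,
        inner_tangentToAmbient, zero_smul, add_zero, tangentToAmbient_mfderiv]
  rw [sphereVolumeForm, e, volumeForm_comp_eq_det,
    det_boostConeDeriv (Fact.out : Module.finrank ℝ V = n + 1) hu hx hα.ne' hd.ne',
    sphereVolumeForm]

theorem boosts_spec (hα0 : 0 ≤ α) (hα1 : α < 1) (hu : ‖u‖ = 1) :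
    ∃ m ∈ spinBoosts V,
        ((m : (Cl V)ˣ) : Cl V) = (Real.sqrt (1 - α ^ 2))⁻¹ • (1 + α • vec V u) ∧
        (∀ x : Ball V, (phi m x : V) = boostMap α u x) ∧
        (∃ D : Diffeomorph (𝓡 n) (𝓡 n) (Sph V) (Sph V) ∞,
          (∀ x : Sph V, sphToBall (D x) = phi m (sphToBall x)) ∧
          (∀ x : Sph V, 0 < boostFactor α u x) ∧
          (∀ (x : Sph V) (v w : TangentSpace (𝓡 n) x),
            sphereMetric (n := n) (D x) (mfderiv (𝓡 n) (𝓡 n) D x v) (mfderiv (𝓡 n) (𝓡 n) D x w)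
              = boostFactor α u x ^ 2 * sphereMetric (n := n) x v w) ∧
          (∀ (o : Orientation ℝ V (Fin (n + 1))) (x : Sph V)
            (v : Fin n → TangentSpace (𝓡 n) x),
            sphereVolumeForm o (D x) (fun i => mfderiv (𝓡 n) (𝓡 n) D x (v i))
              = boostFactor α u x ^ n * sphereVolumeForm o x v)) ∧
        (∀ x ∈ closedBall (0 : V) 1,
          DifferentiableAt ℝ (boostMap α u) x ∧
          ∀ (o : Orientation ℝ V (Fin (n + 1))) (v : Fin (n + 1) → V),
            o.volumeForm (fun i => fderiv ℝ (boostMap α u) x (v i))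
              = boostFactor α u x ^ (n + 2) * o.volumeForm v) := by
  have hα : 0 < 1 - α ^ 2 := by nlinarith
  refine ⟨boostElt α u hα hu, boostElt_mem hα hu, elt_boostElt hα hu,
    phi_boostElt hα0 hα1 hα hu, ⟨boostDiffeo n hα0 hα1 hα hu, fun x => rfl,
      fun x => boostFactor_pos hα0 hα1 hu (sph_norm x).le,
      sphereMetric_boostDiffeo hα0 hα1 hα hu, sphereVolumeForm_boostDiffeo hα0 hα1 hα hu⟩, ?_⟩
  intro x hx
  have hd := boostDen_pos hα0 hα1 hu (mem_closedBall_zero_iff.mp hx)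
  have hF := hasFDerivAt_boostMap (u := u) hα.ne' hd.ne'
  refine ⟨hF.differentiableAt, fun o v => ?_⟩
  rw [hF.fderiv]
  have := volumeForm_comp_eq_det o (boostDeriv α u x : V →ₗ[ℝ] V) v
  rw [det_boostDeriv hu hα.ne' hd.ne', (Fact.out : Module.finrank ℝ V = n + 1)] at this
  exact this

end BoostGeometry

/-! ### Rotations of `V` and the Pin group -/

section Rotations

variable {V : Type*} [NormedAddCommGroup V] [InnerProductSpace ℝ V] [FiniteDimensional ℝ V]

/-- A Lorentz isometry that fixes `(1, 0)` is a rotation or a reflection of `V`. -/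
theorem exists_linearIsometryEquiv {L : (ℝ × V) →ₗ[ℝ] (ℝ × V)}
    (hL : ∀ p, lor (L p) (L p) = lor p p) (h1 : L (1, 0) = (1, 0)) :
    ∃ R : V ≃ₗᵢ[ℝ] V, ∀ t v, L (t, v) = (t, R v) := by
  have hfst : ∀ v, (L (0, v)).1 = 0 := fun v => by
    have := lor_polarization hL (1, 0) (0, v)
    rw [h1] at this
    simpa [lor] using this
  let S : V →ₗᵢ[ℝ] V := ⟨LinearMap.snd ℝ ℝ V ∘ₗ L ∘ₗ LinearMap.inr ℝ ℝ V, fun v => by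
    have := hL (0, v)
    rw [lor_self, lor_self, hfst v] at this
    change ‖(L (0, v)).2‖ = ‖v‖
    rw [← sq_eq_sq₀ (norm_nonneg _) (norm_nonneg _)]
    simpa using this⟩
  refine ⟨S.toLinearIsometryEquiv rfl, fun t v => ?_⟩
  have e : ((t, v) : ℝ × V) = t • (1, 0) + (0, v) := by simp
  rw [e, map_add, map_smul, h1]
  apply Prod.ext
  · simp [hfst v]
  · simp only [Prod.snd_add, Prod.smul_snd, smul_zero, zero_add]
    rfl

theorem reflection_orthogonal_apply_unit {w : V} (hw : ‖w‖ = 1) (v : V) :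
    Submodule.reflection (Submodule.span ℝ {w})ᗮ v = v - (2 * inner ℝ w v : ℝ) • w := by
  rw [Submodule.reflection_orthogonal_apply, Submodule.reflection_singleton_apply]
  simp [hw, two_smul, two_mul, add_smul]

/-- A unit vector covers the reflection in its orthogonal complement. -/
theorem vec_mul_reflection {w : V} (hw : ‖w‖ = 1) (v : V) :
    prinAut (vec V w) * vec V v
      = vec V (Submodule.reflection (Submodule.span ℝ {w})ᗮ v) * vec V w := by
  have h := vec_mul_vec_add_swap w v
  rw [reflection_orthogonal_apply_unit hw, prinAut_vec, map_sub, map_smul, sub_mul,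
    smul_mul_assoc, vec_mul_self, real_inner_self_eq_norm_sq, hw, one_pow, map_one,
    ← Algebra.algebraMap_eq_smul_one, ← h]
  simp

theorem det_reflection_unit {w : V} (hw : ‖w‖ = 1) :
    LinearMap.det (Submodule.reflection (Submodule.span ℝ {w})ᗮ).toLinearMap = -1 := by
  have hw0 : w ≠ 0 := by rintro rfl; simp at hw
  rw [Submodule.det_reflection, Submodule.orthogonal_orthogonal, finrank_span_singleton hw0, pow_one]

/-- Every orthogonal transformation is covered by an element of the Pin group, whose parity is
given by the determinant. -/
theorem exists_pin_lift (R : V ≃ₗᵢ[ℝ] V) :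
    ∃ q : Cl V, tau q * q = 1 ∧ q * tau q = 1 ∧
      ((LinearMap.det R.toLinearMap = 1 ∧ prinAut q = q) ∨
        (LinearMap.det R.toLinearMap = -1 ∧ prinAut q = -q)) ∧
      ∀ v, prinAut q * vec V v = vec V (R v) * q := by
  obtain ⟨l, -, rfl⟩ := R.reflections_generate_dim
  induction l with
  | nil =>
    refine ⟨1, by rw [tau_one, one_mul], by rw [tau_one, one_mul],
      Or.inl ⟨?_, prinAut_one⟩, fun v => by rw [prinAut_one, one_mul, mul_one]; rfl⟩
    exact LinearMap.det_id
  | cons w l ih =>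
    obtain ⟨q, h1, h2, h3, h4⟩ := ih
    rw [List.map_cons, List.prod_cons]
    set R := (l.map fun v => Submodule.reflection (Submodule.span ℝ {v})ᗮ).prod
    by_cases hw : w = 0
    -- The list of reflections may contain the zero vector, for which the reflection is the
    -- identity.
    · have e : Submodule.reflection (Submodule.span ℝ {w})ᗮ * R = R := by
        subst hw
        ext v
        change Submodule.reflection (Submodule.span ℝ {(0 : V)})ᗮ (R v) = R v
        rw [Submodule.reflection_orthogonal_apply, Submodule.reflection_singleton_apply]
        simp
      rw [e]
      exact ⟨q, h1, h2, h3, h4⟩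
    · set w' := ‖w‖⁻¹ • w
      have hw' : ‖w'‖ = 1 := by simp [w', norm_smul, hw]
      have hspan : Submodule.span ℝ {w} = Submodule.span ℝ {w'} :=
        (Submodule.span_singleton_smul_eq (IsUnit.mk0 _ (inv_ne_zero (norm_ne_zero_iff.mpr hw))) w).symm
      have hsq : vec V w' * vec V w' = 1 := by
        rw [vec_mul_self, real_inner_self_eq_norm_sq, hw', one_pow, map_one]
      have hdet : LinearMap.det
          ((Submodule.reflection (Submodule.span ℝ {w})ᗮ * R : V ≃ₗᵢ[ℝ] V)).toLinearMap
          = -LinearMap.det R.toLinearMap := by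
        rw [← neg_one_mul, ← det_reflection_unit hw', ← LinearMap.det_comp]
        simp only [hspan]
        rfl
      refine ⟨vec V w' * q, ?_, ?_, ?_, fun v => ?_⟩
      · rw [tau_mul, tau_vec, mul_assoc, ← mul_assoc (vec V w'), hsq, one_mul, h1]
      · rw [tau_mul, tau_vec, mul_assoc, ← mul_assoc q, h2, one_mul, hsq]
      · rw [hdet, prinAut_mul, prinAut_vec]
        rcases h3 with ⟨h3, h5⟩ | ⟨h3, h5⟩
        · exact Or.inr ⟨by rw [h3], by rw [h5, neg_mul]⟩
        · exact Or.inl ⟨by rw [h3, neg_neg], by rw [h5, neg_mul_neg]⟩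
      · rw [prinAut_mul, mul_assoc, h4, ← mul_assoc, vec_mul_reflection hw', mul_assoc]
        simp only [hspan]
        rfl

/-- Here `g g^τ = 1`, so `g` and `π(g)` are both inverse to `g^τ`. -/
theorem prinAut_eq_of_fix {g : spinG V} (h : lorentzMap g (1, 0) = (1, 0)) :
    prinAut (elt g) = elt g := by
  have h1 := pv_lorentzMap g (1, 0)
  rw [h, pv_one, sigma, mul_one] at h1
  calc prinAut (elt g) = elt g * tau (elt g) * prinAut (elt g) := by rw [← h1, one_mul]
    _ = elt g := by rw [mul_assoc, tau_mul_prinAut, mul_one]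

theorem elt_mul_pv {g : spinG V} (p : ℝ × V) :
    elt g * pv V p = pv V (lorentzMap g p) * prinAut (elt g) := by
  rw [pv_lorentzMap, sigma, mul_assoc, tau_mul_prinAut, mul_one]

/-- The hypothesis says that every contraction of `z` vanishes. -/
theorem eq_algebraMap_of_commute {z : Cl V} (hz : ∀ v, vec V v * z = prinAut z * vec V v) :
    ∃ r : ℝ, z = algebraMap ℝ (Cl V) r := by
  refine exists_algebraMap_of_der_eq_zero fun v => ?_
  have h := vec_mul_sub v z
  rw [hz, sub_self] at h
  exact (smul_eq_zero.mp h.symm).resolve_left two_ne_zero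

/-- The elements of the group that fix `(1, 0)` act on `V` by rotations. -/
theorem det_eq_one_of_fix {g : spinG V} {R : V ≃ₗᵢ[ℝ] V}
    (hR : ∀ t v, lorentzMap g (t, v) = (t, R v)) : LinearMap.det R.toLinearMap = 1 := by
  have heven := prinAut_eq_of_fix (g := g) (by rw [hR, map_zero])
  obtain ⟨q, h1, h2, h3, h4⟩ := exists_pin_lift R
  rcases h3 with ⟨h3, _⟩ | ⟨_, h3⟩
  · exact h3
  -- Otherwise `R` is covered by an odd `q`. Then `q^τ g` is odd and commutes with all vectors up to
  -- `π`, so it is a scalar; being both odd and even it is zero, although `q` and `g` are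
  -- invertible.
  exfalso
  have hg : ∀ v, elt g * vec V v = vec V (R v) * elt g := fun v => by
    have := elt_mul_pv (g := g) (0, v)
    rw [hR, heven, pv_mk, pv_mk, map_zero, zero_add, zero_add] at this
    exact this
  have hz : prinAut (tau q * elt g) = -(tau q * elt g) := by
    rw [prinAut_mul, heven, ← tau_prinAut, h3, tau, map_neg, neg_mul]
  obtain ⟨r, hr⟩ := eq_algebraMap_of_commute (z := tau q * elt g) fun v => by
    have h5 := h4 v
    rw [h3] at h5
    rw [hz, neg_mul, mul_assoc, hg, ← mul_assoc, ← mul_assoc]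
    have h9 : vec V v * tau q = -(tau q * vec V (R v)) := by
      calc vec V v * tau q = tau q * (q * vec V v) * tau q := by rw [← mul_assoc, h1, one_mul]
        _ = -(tau q * (-q * vec V v) * tau q) := by simp
        _ = -(tau q * vec V (R v)) := by rw [h5, mul_assoc, mul_assoc, h2, mul_one]
    rw [h9, neg_mul]
  have h6 : tau q * elt g = 0 := by
    have h7 : prinAut (tau q * elt g) = tau q * elt g := by rw [hr, prinAut, AlgHom.commutes]
    rw [hz] at h7
    have h9 : (2 : ℝ) • (tau q * elt g) = 0 := by
      rw [two_smul]
      nth_rewrite 1 [← h7]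
      exact neg_add_cancel _
    exact (smul_eq_zero.mp h9).resolve_left two_ne_zero
  have h8 : elt g = 0 := by
    calc elt g = q * (tau q * elt g) := by rw [← mul_assoc, h2, one_mul]
      _ = 0 := by rw [h6, mul_zero]
  exact elt_ne_zero g h8

/-- Every rotation comes from the group. -/
theorem exists_spinG_of_rotation (R : V ≃ₗᵢ[ℝ] V) (hR : LinearMap.det R.toLinearMap = 1) :
    ∃ g : spinG V, ∀ t v, lorentzMap g (t, v) = (t, R v) := by
  obtain ⟨q, h1, h2, h3, h4⟩ := exists_pin_lift R
  have heven : prinAut q = q := by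
    rcases h3 with ⟨_, h3⟩ | ⟨h3, _⟩
    · exact h3
    · rw [hR] at h3; norm_num at h3
  rw [heven] at h4
  have hpv : ∀ t v, q * pv V (t, v) = pv V (t, R v) * q := fun t v => by
    rw [pv_mk, pv_mk, mul_add, add_mul, h4, Algebra.commutes]
  let g : spinG V := ⟨⟨q, tau q, h2, h1⟩, fun w hw => by
    obtain ⟨p, rfl⟩ := mem_paravectors.mp hw
    refine ⟨_, pv_mem (p.1, R p.2), ?_⟩
    change q * pv V p = _ * prinAut q
    rw [heven]
    exact hpv p.1 p.2, by
    change tau (prinAut q) * q = 1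
    rw [heven, h1]⟩
  have hg : elt g = q := rfl
  refine ⟨g, fun t v => pv_injective ?_⟩
  rw [pv_lorentzMap, hg, sigma, hpv, mul_assoc, h2, mul_one]

/-- For a rotation or reflection of the sphere the orientation condition thus becomes the sign of a
determinant. -/
theorem coneExt_linear {f : Sph V → Sph V} (R : V →ₗ[ℝ] V) (hf : ∀ x, (f x : V) = R x) :
    coneExt f = R := by
  funext v
  by_cases h : v = 0
  · subst h; rw [coneExt_zero, map_zero]
  · rw [coneExt_of_ne f h, hf, map_smul, smul_smul, mul_inv_cancel₀ (norm_ne_zero_iff.mpr h),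
      one_smul]

theorem fderiv_coneExt_linear {f : Sph V → Sph V} (R : V →ₗ[ℝ] V) (hf : ∀ x, (f x : V) = R x)
    (x : V) : (fderiv ℝ (coneExt f) x).det = LinearMap.det R := by
  rw [coneExt_linear R hf]
  have : (R : V → V) = (LinearMap.toContinuousLinearMap R : V →L[ℝ] V) := rfl
  rw [this, ContinuousLinearMap.fderiv]
  rfl

end Rotations

/-! ### Polar decomposition and preservation of orientation -/

section Polar

variable {V : Type*} [NormedAddCommGroup V] [InnerProductSpace ℝ V] [FiniteDimensional ℝ V]

/-- The unit vector `u` is the direction of the space part, arbitrary if that part is zero, and `α`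
is the ratio of space to time. It is less than one because the vector is timelike. -/
theorem exists_boostPara_eq [Nonempty (Sph V)] {r : ℝ × V} (hr : lor r r = 1) (hr1 : 0 < r.1) :
    ∃ (α : ℝ) (u : V), 0 ≤ α ∧ α < 1 ∧ ‖u‖ = 1 ∧ boostPara α u = r := by
  obtain ⟨u, hu, hu2⟩ : ∃ u : V, ‖u‖ = 1 ∧ ‖r.2‖ • u = r.2 := by
    by_cases h : r.2 = 0
    · exact ⟨Classical.arbitrary (Sph V), sph_norm _, by rw [h]; simp⟩
    · exact ⟨‖r.2‖⁻¹ • r.2, by simp [norm_smul, h], by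
        rw [smul_smul, mul_inv_cancel₀ (norm_ne_zero_iff.mpr h), one_smul]⟩
  rw [lor_self] at hr
  have hlt : ‖r.2‖ < r.1 := by
    refine abs_lt_of_sq_lt_sq' ?_ hr1.le |>.2
    linarith
  refine ⟨‖r.2‖ / r.1, u, by positivity, (div_lt_one hr1).mpr hlt, hu, ?_⟩
  have h1 : √(1 - (‖r.2‖ / r.1) ^ 2) = r.1⁻¹ := by
    have : 1 - (‖r.2‖ / r.1) ^ 2 = (r.1⁻¹) ^ 2 := by
      field_simp
      linarith
    rw [this, Real.sqrt_sq (by positivity)]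
  rw [boostPara, h1, inv_inv]
  apply Prod.ext
  · simp
  · simp only [Prod.smul_snd, smul_smul]
    rw [mul_div_cancel₀ _ hr1.ne', hu2]

/-- The square root of a future unit paravector is a boost that sends `(1, 0)` to it. -/
theorem exists_boost_apply_one [Nonempty (Sph V)] {y : ℝ × V} (hy : lor y y = 1) (hy1 : 0 < y.1) :
    ∃ m : spinG V, lorentzMap m (1, 0) = y ∧ PreservesOrientation (sphHom V m) := by
  obtain ⟨r, hr, hr1, hsq, -⟩ := exists_sq_eq hy hy1
  obtain ⟨α, u, hα0, hα1, hu, rfl⟩ := exists_boostPara_eq hr hr1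
  have hα : 0 < 1 - α ^ 2 := by nlinarith
  refine ⟨boostElt α u hα hu, pv_injective ?_, preservesOrientation_boostElt hα0 hα1 hα hu⟩
  rw [pv_lorentzMap, pv_one, sigma, mul_one, boostElt, elt_paraElt, tau_pv, hsq]

theorem lor_one_self : lor ((1, 0) : ℝ × V) (1, 0) = 1 := by simp [lor]

/-- Write `g = m k` with a boost `m` such that `m` and `g` agree at `(1, 0)`. Then `k` fixes `(1,
0)` and acts by a rotation of determinant one, while `m` has radial derivative of determinant `ρ^n >
0`. -/
theorem preservesOrientation_sphHom (g : spinG V) : PreservesOrientation (sphHom V g) := by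
  intro x₀
  have : Nonempty (Sph V) := ⟨x₀⟩
  obtain ⟨m, hm, hmo⟩ := exists_boost_apply_one
    ((lor_lorentzMap_self g (1, 0)).trans lor_one_self) (lorentzMap_one_fst_pos g)
  have hk : lorentzMap (m⁻¹ * g) (1, 0) = (1, 0) := by
    rw [lorentzMap_mul, ← hm, ← lorentzMap_mul, inv_mul_cancel, lorentzMap_one]
  obtain ⟨R, hR⟩ := exists_linearIsometryEquiv (lor_lorentzMap_self (m⁻¹ * g)) hk
  have hko : PreservesOrientation (sphHom V (m⁻¹ * g)) := fun x => by
    have hf : ∀ y : Sph V, (sphHom V (m⁻¹ * g) y : V) = R.toLinearMap y := fun y => by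
      have h : sphMap (m⁻¹ * g) y = ⟨R y, by simp⟩ :=
        sphMap_eq_of_lorentzMap (c := 1) (by rw [hR, one_smul])
      exact congrArg (fun z : Sph V => (z : V)) h
    rw [fderiv_coneExt_linear R.toLinearMap hf, det_eq_one_of_fix hR]
    exact one_pos
  have e : sphHom V g = sphHom V m * sphHom V (m⁻¹ * g) := by
    rw [← map_mul, mul_inv_cancel_left]
  rw [e]
  exact hmo.comp hko x₀

end Polar

/-! ### Light vectors span -/

section Spanning

variable {V : Type*} [NormedAddCommGroup V] [InnerProductSpace ℝ V] [FiniteDimensional ℝ V]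

/-- The light ray through a point of the sphere. -/
def lightVec (x : Sph V) : ℝ × V := (1, (x : V))

/-- The vector `(1, 0)` is the mean of two antipodal light vectors, and the light vectors differ
from it by the unit vectors of `V`. -/
theorem span_lightVec [Nonempty (Sph V)] :
    Submodule.span ℝ (range (lightVec : Sph V → ℝ × V)) = ⊤ := by
  have hmem : ∀ x : Sph V, lightVec x ∈ Submodule.span ℝ (range (lightVec : Sph V → ℝ × V)) :=
    fun x => Submodule.subset_span ⟨x, rfl⟩
  have h1 : ((1, 0) : ℝ × V) ∈ Submodule.span ℝ (range (lightVec : Sph V → ℝ × V)) := by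
    obtain ⟨x⟩ := ‹Nonempty (Sph V)›
    have e : ((1, 0) : ℝ × V) = (2⁻¹ : ℝ) • (lightVec x + lightVec (-x)) := by
      apply Prod.ext
      · simp [lightVec]; norm_num
      · simp [lightVec]
    rw [e]
    exact Submodule.smul_mem _ _ (add_mem (hmem x) (hmem (-x)))
  rw [eq_top_iff]
  rintro ⟨t, v⟩ -
  by_cases hv : v = 0
  · have e : ((t, v) : ℝ × V) = t • (1, 0) := by simp [hv]
    rw [e]
    exact Submodule.smul_mem _ _ h1
  · have hn : ‖v‖ ≠ 0 := norm_ne_zero_iff.mpr hv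
    let x : Sph V := ⟨‖v‖⁻¹ • v, by simp [norm_smul, hv]⟩
    have e : ((t, v) : ℝ × V) = ‖v‖ • lightVec x + (t - ‖v‖) • (1, 0) := by
      apply Prod.ext
      · simp [lightVec]
      · simp [lightVec, x, smul_smul, hn]
    rw [e]
    exact add_mem (Submodule.smul_mem _ _ (hmem x)) (Submodule.smul_mem _ _ h1)

theorem linearMap_ext_lightVec [Nonempty (Sph V)] {M : Type*} [AddCommGroup M] [Module ℝ M]
    {A B : (ℝ × V) →ₗ[ℝ] M} (h : ∀ x, A (lightVec x) = B (lightVec x)) : A = B :=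
  LinearMap.ext_on_range span_lightVec h

/-- The Lorentzian form as a linear form in its second argument. -/
def lorLin (p : ℝ × V) : (ℝ × V) →ₗ[ℝ] ℝ where
  toFun q := lor p q
  map_add' := lor_add_right p
  map_smul' r q := lor_smul_right r p q

theorem lorLin_apply (p q : ℝ × V) : lorLin p q = lor p q := rfl

/-- The condition `n ≥ 1` enters here: the zero-dimensional sphere has only two points, which
determine neither the point factors nor a cross-ratio geometry. -/
theorem exists_three_points (h : 2 ≤ Module.finrank ℝ V) :
    ∃ a b c : Sph V, a ≠ b ∧ a ≠ c ∧ b ≠ c := by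
  let e := stdOrthonormalBasis ℝ V
  let i : Fin (Module.finrank ℝ V) := ⟨0, by omega⟩
  let j : Fin (Module.finrank ℝ V) := ⟨1, by omega⟩
  have hij : i ≠ j := by simp [i, j]
  have hi : inner ℝ (e i) (e i) = (1 : ℝ) := by rw [e.inner_eq_one]
  have hj : inner ℝ (e i) (e j) = (0 : ℝ) := e.inner_eq_zero hij
  refine ⟨⟨e i, by simp⟩, ⟨-e i, by simp⟩, ⟨e j, by simp⟩, fun h => ?_, fun h => ?_, fun h => ?_⟩
  all_goals
    have h1 := congrArg (fun z : Sph V => (inner ℝ (e i) (z : V) : ℝ)) h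
    simp only [inner_neg_right, hi, hj] at h1
    norm_num at h1

end Spanning

/-! ### The kernel of the action on the sphere -/

section Kernel

variable {V : Type*} [NormedAddCommGroup V] [InnerProductSpace ℝ V] [FiniteDimensional ℝ V]

/-- If all points are fixed, the point factors at any two distinct points have product one. Among
three points this forces each positive factor to be one, so every light vector is fixed. -/
theorem lorentzMap_eq_id_of_sphHom_eq_one (hV : 2 ≤ Module.finrank ℝ V) {g : spinG V}
    (hg : sphHom V g = 1) : lorentzMap g = LinearMap.id := by
  have hmap : ∀ x, sphMap g x = x := fun x => Equiv.congr_fun hg x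
  have hpos := denom_sph_pos g
  have hprod : ∀ x y : Sph V, x ≠ y → denom g x * denom g y = 1 := fun x y hxy => by
    have h := dist_sphMap_sq g x y
    rw [hmap, hmap] at h
    exact (mul_eq_right₀ (pow_ne_zero 2 (dist_ne_zero.mpr hxy))).mp h
  obtain ⟨a, b, c, hab, hac, hbc⟩ := exists_three_points hV
  have ha : denom g a = 1 := by
    have h1 := hprod a b hab
    have h2 := hprod a c hac
    have h3 := hprod b c hbc
    have h4 : denom g (b : V) = denom g (c : V) :=
      mul_left_cancel₀ (hpos a).ne' (h1.trans h2.symm)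
    rw [← h4] at h3
    have h5 : denom g (b : V) = 1 := by nlinarith [hpos b]
    rwa [h5, mul_one] at h1
  have hb : denom g b = 1 := by simpa [ha] using hprod a b hab
  have hone : ∀ x : Sph V, denom g x = 1 := fun x => by
    by_cases hx : x = a
    · rw [hx, ha]
    · simpa [ha] using hprod x a hx
  have : Nonempty (Sph V) := ⟨a⟩
  refine linearMap_ext_lightVec fun x => ?_
  rw [lightVec, lorentzMap_sph, hone, hmap, one_smul]
  rfl

/-- Such a `g` is even and commutes with every vector, hence is a scalar `r`, and `Δ(g) = 1` gives
`r² = 1`. -/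
theorem elt_eq_of_sphHom_eq_one (hV : 2 ≤ Module.finrank ℝ V) {g : spinG V}
    (hg : sphHom V g = 1) : elt g = 1 ∨ elt g = -1 := by
  have hL := lorentzMap_eq_id_of_sphHom_eq_one hV hg
  have heven := prinAut_eq_of_fix (g := g) (by rw [hL]; rfl)
  obtain ⟨r, hr⟩ := eq_algebraMap_of_commute (z := elt g) fun v => by
    have h := elt_mul_pv (g := g) (0, v)
    rw [hL, heven, LinearMap.id_apply, pv_mk, map_zero, zero_add] at h
    rw [heven, h]
  have h1 := nu_mul_elt g
  rw [nu, heven, hr, tau_algebraMap, ← map_mul] at h1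
  have h2 : r * r = 1 := by
    have := congrArg scalarPart h1
    rwa [scalarPart_algebraMap, ← map_one (algebraMap ℝ (Cl V)), scalarPart_algebraMap] at this
  rw [hr]
  rcases mul_self_eq_one_iff.mp h2 with rfl | rfl
  · exact Or.inl (map_one _)
  · exact Or.inr (by rw [map_neg, map_one])

variable (V) in
/-- The element `-1` of the group. -/
def negOne : spinG V := paraElt (-1, 0) (by simp [lor])

theorem elt_negOne : elt (negOne V) = -1 := by
  rw [negOne, elt_paraElt, pv_mk]; simp

theorem sphHom_negOne : sphHom V (negOne V) = 1 := by
  ext1 x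
  refine sphMap_eq_of_lorentzMap (c := 1) ?_
  rw [negOne, lorentzMap_paraElt]
  apply Prod.ext
  · simp [lor]; norm_num
  · simp

theorem negOne_ne_one : negOne V ≠ 1 := by
  intro h
  have h1 := congrArg (fun g : spinG V => scalarPart (elt g)) h
  simp only [elt_negOne, elt_one, scalarPart_neg] at h1
  have h2 : scalarPart (1 : Cl V) = 1 := by
    rw [← map_one (algebraMap ℝ (Cl V)), scalarPart_algebraMap]
  rw [h2] at h1
  norm_num at h1

theorem sphHom_eq_one_iff (hV : 2 ≤ Module.finrank ℝ V) {g : spinG V} :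
    sphHom V g = 1 ↔ g = 1 ∨ g = negOne V := by
  constructor
  · intro h
    rcases elt_eq_of_sphHom_eq_one hV h with h | h
    · exact Or.inl (elt_injective (h.trans elt_one.symm))
    · exact Or.inr (elt_injective (h.trans elt_negOne.symm))
  · rintro (rfl | rfl)
    · exact map_one _
    · exact sphHom_negOne

end Kernel

/-! ### Möbius transformations come from the group -/

section Surjectivity

variable {V : Type*} [NormedAddCommGroup V] [InnerProductSpace ℝ V] [FiniteDimensional ℝ V]

/-- A Möbius transformation scales distances by a product of values of a positive function. -/
theorem exists_conformal_factor (hV : 2 ≤ Module.finrank ℝ V) {f : Equiv.Perm (Sph V)}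
    (hf : f ∈ mobiusGroup V) :
    ∃ μ : Sph V → ℝ, (∀ x, 0 < μ x) ∧ ∀ x y, dist (f x) (f y) = μ x * μ y * dist x y := by
  classical
  obtain ⟨a, b, c, hab, hac, hbc⟩ := exists_three_points hV
  let D : Sph V → Sph V → ℝ := fun x y => dist (f x) (f y) / dist x y
  have hsymm : ∀ x y, D x y = D y x := fun x y => by simp only [D, dist_comm]
  have hd : ∀ {x y : Sph V}, x ≠ y → 0 < dist x y := fun h => dist_pos.mpr h
  have hfd : ∀ {x y : Sph V}, x ≠ y → 0 < dist (f x) (f y) := fun h =>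
    dist_pos.mpr (f.injective.ne h)
  have hpos : ∀ {x y}, x ≠ y → 0 < D x y := fun h => div_pos (hfd h) (hd h)
  -- This is invariance of the cross-ratio in terms of the distortion `D`. The conditions `p ≠ r`
  -- and `q ≠ s` allow division by the distances in the numerator.
  have hD : ∀ {p q r s}, p ≠ q → r ≠ s → p ≠ r → q ≠ s → D p r * D q s = D p q * D r s := by
    intro p q r s hpq hrs hpr hqs
    have h := hf p q r s hpq hrs
    unfold crossRatio at h
    have h1 := (hd hpq).ne'
    have h2 := (hd hrs).ne'
    have h3 := (hd hpr).ne'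
    have h4 := (hd hqs).ne'
    have h5 := (hfd hpq).ne'
    have h6 := (hfd hrs).ne'
    rw [div_eq_div_iff (mul_ne_zero h5 h6) (mul_ne_zero h1 h2)] at h
    simp only [D]
    rw [div_mul_div_comm, div_mul_div_comm, div_eq_div_iff (mul_ne_zero h3 h4) (mul_ne_zero h1 h2), h]
    ring
  -- If `D x y = μ x * μ y`, then `E x y` is `(μ a)²`. So `E` must be shown constant away from `a`,
  -- and its square root is then the value of `μ` at `a`.
  let E : Sph V → Sph V → ℝ := fun x y => D a x * D a y / D x y
  have hEs : ∀ x y, E x y = E y x := fun x y => by simp only [E, hsymm x y, mul_comm]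
  have hE : ∀ {x y w}, x ≠ a → y ≠ a → w ≠ a → x ≠ y → x ≠ w → E x y = E x w := by
    intro x y w hx hy hw hxy hxw
    have h := hD (p := a) (r := y) (q := w) (s := x) hw.symm hxy.symm hy.symm hxw.symm
    have h1 := (hpos hxy).ne'
    have h2 := (hpos hxw).ne'
    simp only [E]
    rw [div_eq_div_iff h1 h2]
    rw [hsymm w x, hsymm y x] at h
    linear_combination D a x * h
  have hconst : ∀ {x y}, x ≠ a → y ≠ a → x ≠ y → E x y = E b c := by
    intro x y hx hy hxy
    by_cases hxc : x = c
    · subst hxc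
      rw [hE hx hy hab.symm hxy hbc.symm, hEs]
    · rw [hE hx hy hac.symm hxy hxc, hEs, hE hac.symm hx hab.symm (Ne.symm hxc) hbc.symm, hEs]
  have hκ : 0 < E b c := div_pos (mul_pos (hpos hab) (hpos hac)) (hpos hbc)
  set κ := E b c
  have hs : 0 < √κ := Real.sqrt_pos.mpr hκ
  have hs2 : √κ * √κ = κ := Real.mul_self_sqrt hκ.le
  refine ⟨fun x => if x = a then √κ else D a x / √κ, fun x => ?_, fun x y => ?_⟩
  · beta_reduce
    split_ifs with h
    · exact hs
    · exact div_pos (hpos (Ne.symm h)) hs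
  · by_cases hxy : x = y
    · subst hxy; simp
    have hDd : dist (f x) (f y) = D x y * dist x y := (div_mul_cancel₀ _ (hd hxy).ne').symm
    rw [hDd]
    congr 1
    beta_reduce
    by_cases hx : x = a
    · have hy : y ≠ a := fun h => hxy (hx.trans h.symm)
      rw [if_pos hx, if_neg hy, hx]
      field_simp
    · by_cases hy : y = a
      · rw [if_pos hy, if_neg hx, hy, hsymm]
        field_simp
      · rw [if_neg hx, if_neg hy, div_mul_div_comm, hs2, ← hconst hx hy hxy]
        have h1 := (hpos hxy).ne'
        have h2 := (hpos (Ne.symm hx)).ne'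
        have h3 := (hpos (Ne.symm hy)).ne'
        simp only [E]
        field_simp

/-- Every Möbius transformation of the sphere is induced by a Lorentz isometry. -/
theorem exists_lorentz_of_mobius (hV : 2 ≤ Module.finrank ℝ V) {f : Equiv.Perm (Sph V)}
    (hf : f ∈ mobiusGroup V) :
    ∃ (L : (ℝ × V) →ₗ[ℝ] (ℝ × V)) (c : Sph V → ℝ), (∀ p, lor (L p) (L p) = lor p p) ∧
      (∀ x, 0 < c x) ∧ ∀ x, L (lightVec x) = c x • lightVec (f x) := by
  obtain ⟨μ, hμ, hd⟩ := exists_conformal_factor hV hf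
  obtain ⟨a, -⟩ := exists_three_points hV
  have : Nonempty (Sph V) := ⟨a⟩
  -- The product of the light vectors at `f x` and `f y` is `μ(x)² μ(y)²` times the original one,
  -- and this weight compensates the factor.
  let c : Sph V → ℝ := fun x => (μ x ^ 2)⁻¹
  have hc : ∀ x, 0 < c x := fun x => inv_pos.mpr (pow_pos (hμ x) 2)
  let η : Sph V → ℝ × V := fun x => c x • lightVec (f x)
  have hη : ∀ x y, lor (η x) (η y) = lor (lightVec x) (lightVec y) := fun x y => by
    simp only [η, lor_smul_left, lor_smul_right, lightVec, lor_sph, hd x y, c]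
    have h1 := (hμ x).ne'
    have h2 := (hμ y).ne'
    field_simp
  let A : (Sph V →₀ ℝ) →ₗ[ℝ] ℝ × V := Finsupp.linearCombination ℝ lightVec
  let B : (Sph V →₀ ℝ) →ₗ[ℝ] ℝ × V := Finsupp.linearCombination ℝ η
  have hA : LinearMap.range A = ⊤ := by rw [Finsupp.range_linearCombination, span_lightVec]
  have hA1 : ∀ x, A (Finsupp.single x 1) = lightVec x := fun x => by
    simp [A, Finsupp.linearCombination_single]
  have hB1 : ∀ x, B (Finsupp.single x 1) = η x := fun x => by
    simp [B, Finsupp.linearCombination_single]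
  have hAB : ∀ y w, lor (η y) (B w) = lor (lightVec y) (A w) := fun y w => by
    have : lorLin (η y) ∘ₗ B = lorLin (lightVec y) ∘ₗ A := by
      refine Finsupp.lhom_ext' fun x => LinearMap.ext_ring ?_
      simp only [LinearMap.comp_apply, Finsupp.lsingle_apply, hA1, hB1, lorLin_apply, hη]
    exact DFunLike.congr_fun this w
  -- A linear relation among light vectors yields a combination of the `η` orthogonal to every `η
  -- y`. As `f` is surjective these are multiples of all light vectors, which span, so nondegeneracy
  -- makes the combination zero.
  have hker : ∀ w, A w = 0 → B w = 0 := fun w hw => by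
    refine eq_zero_of_lor_eq_zero fun q => ?_
    have h0 : lorLin (B w) = 0 := linearMap_ext_lightVec fun z => by
      have h1 := hAB (f.symm z) w
      have h2 : lor (lightVec (f.symm z)) (0 : ℝ × V) = 0 := (lorLin _).map_zero
      rw [hw, h2] at h1
      simp only [η, Equiv.apply_symm_apply, lor_smul_left] at h1
      rw [lorLin_apply, lor_comm]
      exact (mul_eq_zero.mp h1).resolve_left (hc _).ne'
    exact DFunLike.congr_fun h0 q
  -- Any linear section of `A` serves: two preimages differ by an element of the kernel, on which
  -- `B` vanishes.
  obtain ⟨S, hS⟩ := A.exists_rightInverse_of_surjective hA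
  have hS' : ∀ p, A (S p) = p := fun p => DFunLike.congr_fun hS p
  refine ⟨B ∘ₗ S, c, fun p => ?_, hc, fun x => ?_⟩
  · have h1 : lorLin (B (S p)) ∘ₗ B = lorLin (A (S p)) ∘ₗ A := by
      refine Finsupp.lhom_ext' fun x => LinearMap.ext_ring ?_
      simp only [LinearMap.comp_apply, Finsupp.lsingle_apply, hA1, hB1, lorLin_apply]
      rw [lor_comm, hAB, lor_comm]
    have h2 := DFunLike.congr_fun h1 (S p)
    simp only [LinearMap.comp_apply, lorLin_apply, hS'] at h2
    exact h2
  · change B (S (lightVec x)) = η x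
    rw [← hB1 x, ← sub_eq_zero, ← map_sub]
    apply hker
    rw [map_sub, hS', hA1, sub_self]

/-- The isometry attached to `f` sends `(1, 0)`, a mean of two light vectors, to the future. A boost
`m` undoes this, and `m⁻¹ f` is an orthogonal map `R` of `V`. Orientation gives `R` determinant one,
so `R` lifts to some `k`, and `f` is the action of `m k`. -/
theorem exists_spinG_of_mobius (hV : 2 ≤ Module.finrank ℝ V) {f : Equiv.Perm (Sph V)}
    (hf : f ∈ mobiusGroupPlus V) : ∃ g : spinG V, sphHom V g = f := by
  obtain ⟨L, c, hL, hc, hLf⟩ := exists_lorentz_of_mobius hV hf.1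
  obtain ⟨a, -⟩ := exists_three_points hV
  have : Nonempty (Sph V) := ⟨a⟩
  have h1 : 0 < (L (1, 0)).1 := by
    have e : ((1, 0) : ℝ × V) = (2⁻¹ : ℝ) • (lightVec a + lightVec (-a)) := by
      apply Prod.ext
      · simp [lightVec]; norm_num
      · simp [lightVec]
    rw [e, map_smul, map_add, hLf, hLf]
    have h1 := hc a
    have h2 := hc (-a)
    simp only [lightVec, Prod.smul_fst, Prod.fst_add, smul_eq_mul, mul_one]
    positivity
  obtain ⟨m, hm, hmo⟩ := exists_boost_apply_one ((hL (1, 0)).trans lor_one_self) h1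
  let L' : (ℝ × V) →ₗ[ℝ] (ℝ × V) := lorentzMap m⁻¹ ∘ₗ L
  have hL' : ∀ p, lor (L' p) (L' p) = lor p p := fun p =>
    (lor_lorentzMap_self m⁻¹ (L p)).trans (hL p)
  have hfix : L' (1, 0) = (1, 0) := by
    change lorentzMap m⁻¹ (L (1, 0)) = (1, 0)
    rw [← hm, ← lorentzMap_mul, inv_mul_cancel, lorentzMap_one]
  obtain ⟨R, hR⟩ := exists_linearIsometryEquiv hL' hfix
  have hf' : ∀ x : Sph V, (((sphHom V m)⁻¹ * f) x : V) = R.toLinearMap x := fun x => by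
    have h2 := hR 1 (x : V)
    have h3 : L' (1, (x : V)) = (c x * denom m⁻¹ (f x)) • (1, (sphMap m⁻¹ (f x) : V)) := by
      change lorentzMap m⁻¹ (L (lightVec x)) = _
      rw [hLf, map_smul, lightVec, lorentzMap_sph, smul_smul]
    rw [h3] at h2
    -- The time components show that the scale factor is one, so the space components identify the
    -- point itself.
    have h4 := congrArg Prod.fst h2
    have h5 := congrArg Prod.snd h2
    simp only [Prod.smul_fst, smul_eq_mul, mul_one] at h4
    rw [h4, Prod.smul_snd, one_smul] at h5
    rw [← map_inv]
    exact h5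
  have hplus : PreservesOrientation ((sphHom V m)⁻¹ * f : Equiv.Perm (Sph V)) :=
    fun x => hmo.inv.comp hf.2 x
  have hdet : LinearMap.det R.toLinearMap = 1 := by
    have h2 := hplus a
    rw [fderiv_coneExt_linear R.toLinearMap hf'] at h2
    obtain ⟨q, -, -, h3, -⟩ := exists_pin_lift R
    rcases h3 with ⟨h3, -⟩ | ⟨h3, -⟩
    · exact h3
    · rw [h3] at h2; norm_num at h2
  obtain ⟨k, hk⟩ := exists_spinG_of_rotation R hdet
  refine ⟨m * k, ?_⟩
  have hk' : sphHom V k = (sphHom V m)⁻¹ * f := by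
    ext1 x
    refine sphMap_eq_of_lorentzMap (c := 1) ?_
    rw [hk, hf', one_smul]
    rfl
  rw [map_mul, hk', mul_inv_cancel_left]

variable (V) in
/-- The action on the sphere as a homomorphism to the Möbius group. -/
def mobiusHom : spinG V →* mobiusGroupPlus V :=
  (sphHom V).codRestrict (mobiusGroupPlus V) fun g =>
    ⟨sphHom_mem_mobiusGroup g, preservesOrientation_sphHom g⟩

theorem mobiusHom_coe (g : spinG V) : (mobiusHom V g : Equiv.Perm (Sph V)) = sphHom V g := rfl

theorem mobiusHom_surjective (hV : 2 ≤ Module.finrank ℝ V) :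
    Function.Surjective (mobiusHom V) := fun f => by
  obtain ⟨g, hg⟩ := exists_spinG_of_mobius hV f.2
  exact ⟨g, Subtype.ext hg⟩

theorem mobiusHom_eq_one_iff (hV : 2 ≤ Module.finrank ℝ V) {g : spinG V} :
    mobiusHom V g = 1 ↔ g = 1 ∨ g = negOne V := by
  rw [← sphHom_eq_one_iff hV, ← mobiusHom_coe]
  exact Subtype.ext_iff

theorem ncard_fiber_mobiusHom (hV : 2 ≤ Module.finrank ℝ V) (f : mobiusGroupPlus V) :
    (mobiusHom V ⁻¹' {f}).ncard = 2 := by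
  obtain ⟨g, rfl⟩ := mobiusHom_surjective hV f
  have e : mobiusHom V ⁻¹' {mobiusHom V g} = {g, g * negOne V} := by
    ext h
    rw [mem_preimage, mem_singleton_iff, mem_insert_iff, mem_singleton_iff, eq_comm,
      ← inv_mul_eq_one, ← map_inv, ← map_mul, mobiusHom_eq_one_iff hV, inv_mul_eq_one,
      inv_mul_eq_iff_eq_mul, eq_comm (a := g)]
  rw [e, ncard_pair]
  exact fun h => negOne_ne_one (mul_eq_left.mp h.symm)

end Surjectivity

/-! ### Continuity, properness and the covering property -/

section Covering

open Filter Topology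

variable {V : Type*} [NormedAddCommGroup V] [InnerProductSpace ℝ V] [FiniteDimensional ℝ V]

/-- The topology of the Clifford algebra as a real vector space. -/
@[reducible] def clTopology : TopologicalSpace (Cl V) := moduleTopology ℝ (Cl V)

attribute [local instance] clTopology

theorem isModuleTopology_cl : IsModuleTopology ℝ (Cl V) := ⟨rfl⟩

attribute [local instance] isModuleTopology_cl

theorem isTopologicalRing_cl : IsTopologicalRing (Cl V) :=
  IsModuleTopology.isTopologicalRing ℝ (Cl V)

attribute [local instance] isTopologicalRing_cl

theorem t2Space_cl : T2Space (Cl V) := by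
  obtain ⟨k, e, -⟩ := exists_euclidean_equiv (V := V)
  exact T2Space.of_injective_continuous e.injective
    (IsModuleTopology.continuous_of_linearMap e.toLinearMap)

attribute [local instance] t2Space_cl

theorem continuous_elt : Continuous (elt : spinG V → Cl V) := continuous_induced_dom

theorem isEmbedding_elt : IsEmbedding (elt : spinG V → Cl V) := ⟨⟨rfl⟩, elt_injective⟩

theorem t2Space_spinG : T2Space (spinG V) := isEmbedding_elt.t2Space

theorem continuous_tau : Continuous (tau : Cl V → Cl V) :=
  IsModuleTopology.continuous_of_linearMap CliffordAlgebra.reverse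

theorem continuous_prinAut : Continuous (prinAut : Cl V → Cl V) :=
  IsModuleTopology.continuous_of_linearMap CliffordAlgebra.involute.toLinearMap

theorem continuous_nu : Continuous (nu : Cl V → Cl V) := continuous_tau.comp continuous_prinAut

theorem continuous_coords : Continuous (coords V) := IsModuleTopology.continuous_of_linearMap _

theorem continuous_pv : Continuous (pv V) := LinearMap.continuous_of_finiteDimensional _

theorem isTopologicalGroup_spinG : IsTopologicalGroup (spinG V) where
  continuous_mul := by
    rw [isEmbedding_elt.continuous_iff]
    exact (continuous_elt.comp continuous_fst).mul (continuous_elt.comp continuous_snd)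
  continuous_inv := by
    rw [isEmbedding_elt.continuous_iff]
    have : (elt ∘ fun g : spinG V => g⁻¹) = nu ∘ elt := funext elt_inv
    rw [this]
    exact continuous_nu.comp continuous_elt

theorem continuous_sigma_pv : Continuous fun z : Cl V × (ℝ × V) => sigma z.1 (pv V z.2) :=
  (continuous_fst.mul (continuous_pv.comp continuous_snd)).mul (continuous_tau.comp continuous_fst)

theorem continuous_lorentzMap :
    Continuous fun z : spinG V × (ℝ × V) => lorentzMap z.1 z.2 :=
  continuous_coords.comp (continuous_sigma_pv.comp
    ((continuous_elt.comp continuous_fst).prodMk continuous_snd))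

theorem continuous_sphMap : Continuous fun z : spinG V × Sph V => sphMap z.1 z.2 := by
  have hp : Continuous fun z : spinG V × Sph V => (z.1, ((1 : ℝ), (z.2 : V))) :=
    continuous_fst.prodMk (continuous_const.prodMk (continuous_subtype_val.comp continuous_snd))
  have h := continuous_lorentzMap.comp hp
  have h1 : Continuous fun z : spinG V × Sph V => (lorentzMap z.1 (1, (z.2 : V))).1 := h.fst
  have h2 : Continuous fun z : spinG V × Sph V => (lorentzMap z.1 (1, (z.2 : V))).2 := h.snd
  have hne : ∀ z : spinG V × Sph V, (lorentzMap z.1 (1, (z.2 : V))).1 ≠ 0 := fun z =>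
    (denom_sph_pos z.1 z.2).ne'
  have h3 : Continuous fun z : spinG V × Sph V =>
      (lorentzMap z.1 (1, (z.2 : V))).1⁻¹ • (lorentzMap z.1 (1, (z.2 : V))).2 :=
    (h1.inv₀ hne).smul h2
  have e : ∀ z : spinG V × Sph V, (sphMap z.1 z.2 : V)
      = (lorentzMap z.1 (1, (z.2 : V))).1⁻¹ • (lorentzMap z.1 (1, (z.2 : V))).2 := fun z =>
    phi_coe z.1 (sphToBall z.2)
  exact Continuous.subtype_mk (h3.congr fun z => (e z).symm) _

/-- Joint continuity of the action together with compactness of the sphere gives uniform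
convergence. -/
theorem continuous_mobiusHom : Continuous (mobiusHom V) := by
  rw [continuous_induced_rng, continuous_iff_continuousAt]
  intro g
  change Tendsto _ _ (𝓝 _)
  rw [UniformFun.tendsto_iff_tendstoUniformly]
  intro W hW
  obtain ⟨v, hv, h⟩ := (isCompact_univ (X := Sph V)).mem_uniformity_of_prod
    (f := fun (g : spinG V) (x : Sph V) => sphMap g x) (s := univ)
    continuous_sphMap.continuousOn (mem_univ g) (symm_le_uniformity hW)
  rw [nhdsWithin_univ] at hv
  filter_upwards [hv] with g' hg' x
  exact h g' hg' x (mem_univ x)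

theorem tendsto_apply {ι : Type*} {l : Filter ι} {F : ι → mobiusGroupPlus V}
    {f : mobiusGroupPlus V} (h : Tendsto F l (𝓝 f)) (x : Sph V) :
    Tendsto (fun i => (F i : Equiv.Perm (Sph V)) x) l (𝓝 ((f : Equiv.Perm (Sph V)) x)) :=
  ((UniformFun.uniformContinuous_eval (Sph V) x).continuous.tendsto _).comp
    ((continuous_induced_dom.tendsto f).comp h)

/-- The square of the factor at `x` is the product of the factor pairs `x y` and `x z` divided by
the pair `y z`, and each pair is a quotient of squared distances. Convergence of the images of three
points therefore controls the factor. -/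
theorem denom_sq_eq (g : spinG V) {x y z : Sph V} (hxy : x ≠ y) (hxz : x ≠ z) (hyz : y ≠ z) :
    denom g (x : V) ^ 2 = dist x y ^ 2 * dist x z ^ 2 / dist y z ^ 2 *
      (dist (sphMap g y) (sphMap g z) ^ 2
        / (dist (sphMap g x) (sphMap g y) ^ 2 * dist (sphMap g x) (sphMap g z) ^ 2)) := by
  have h1 := dist_sphMap_sq g x y
  have h2 := dist_sphMap_sq g x z
  have h3 := dist_sphMap_sq g y z
  have hinj : ∀ {p q : Sph V}, p ≠ q → dist (sphMap g p) (sphMap g q) ≠ 0 := fun h =>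
    dist_ne_zero.mpr ((sphHom V g).injective.ne h)
  have i1 := hinj hxy
  have i2 := hinj hxz
  have i3 := hinj hyz
  have p1 := (denom_sph_pos g x).ne'
  have p2 := (denom_sph_pos g y).ne'
  have p3 := (denom_sph_pos g z).ne'
  rw [← h1, ← h2, ← h3]
  field_simp

theorem exists_tendsto_denom_sq (hV : 2 ≤ Module.finrank ℝ V) {l : Filter (spinG V)}
    {f : mobiusGroupPlus V} (h : Tendsto (mobiusHom V) l (𝓝 f)) (x : Sph V) :
    ∃ c, Tendsto (fun g : spinG V => denom g (x : V) ^ 2) l (𝓝 c) := by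
  obtain ⟨y, z, hxy, hxz, hyz⟩ : ∃ y z, x ≠ y ∧ x ≠ z ∧ y ≠ z := by
    obtain ⟨a, b, c, hab, hac, hbc⟩ := exists_three_points hV
    by_cases ha : x = a
    · exact ⟨b, c, ha ▸ hab, ha ▸ hac, hbc⟩
    · by_cases hb : x = b
      · exact ⟨a, c, ha, hb ▸ hbc, hac⟩
      · exact ⟨a, b, ha, hb, hab⟩
  have hlim : ∀ p q : Sph V, Tendsto (fun g => dist (sphMap g p) (sphMap g q) ^ 2) l
      (𝓝 (dist ((f : Equiv.Perm (Sph V)) p) ((f : Equiv.Perm (Sph V)) q) ^ 2)) := fun p q =>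
    ((tendsto_apply h p).dist (tendsto_apply h q)).pow 2
  have hne : ∀ {p q : Sph V}, p ≠ q →
      dist ((f : Equiv.Perm (Sph V)) p) ((f : Equiv.Perm (Sph V)) q) ^ 2 ≠ 0 := fun hpq =>
    pow_ne_zero 2 (dist_ne_zero.mpr ((f : Equiv.Perm (Sph V)).injective.ne hpq))
  refine ⟨_, Tendsto.congr (fun g => (denom_sq_eq g hxy hxz hyz).symm)
    (((hlim y z).div ((hlim x y).mul (hlim x z)) ?_).const_mul _)⟩
  exact mul_ne_zero (hne hxy) (hne hxz)

theorem lorentzMap_one_fst_eq (g : spinG V) (x : Sph V) :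
    (lorentzMap g (1, 0)).1 = (denom g (x : V) + denom g ((-x : Sph V) : V)) / 2 := by
  have e : ((1, 0) : ℝ × V) = (2⁻¹ : ℝ) • ((1, (x : V)) + (1, ((-x : Sph V) : V))) := by
    apply Prod.ext
    · simp; norm_num
    · simp
  rw [e, map_smul, map_add, denom, denom]
  simp only [Prod.smul_fst, Prod.fst_add, smul_eq_mul]
  ring

theorem isCompact_scalarPart_le {C : ℝ} (hC : 0 ≤ C) :
    IsCompact {a : Cl V | scalarPart (tau a * a) ≤ C} := by
  obtain ⟨k, e, he⟩ := exists_euclidean_equiv (V := V)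
  have hc : Continuous e.symm := LinearMap.continuous_of_finiteDimensional e.symm.toLinearMap
  convert (isCompact_closedBall (0 : EuclideanSpace ℝ (Fin k)) (√C)).image hc using 1
  ext a
  rw [e.symm.image_eq_preimage_symm]
  simp only [Set.mem_ofPred_eq, LinearEquiv.symm_symm, mem_preimage, mem_closedBall_zero_iff, ← he]
  rw [Real.le_sqrt (norm_nonneg _) hC]

/-- The group is closed in `C`. The norm conditions are equations, and the transformer condition
becomes one too: `σ_a(w)` equals the paravector of its own coordinates. -/
theorem exists_elt_eq_of_tendsto {l : Filter (spinG V)} [l.NeBot] {a : Cl V}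
    (h : Tendsto elt l (𝓝 a)) : ∃ g : spinG V, elt g = a := by
  have hnu : Tendsto (fun g : spinG V => nu (elt g)) l (𝓝 (nu a)) :=
    (continuous_nu.tendsto a).comp h
  have hl : Tendsto (fun g : spinG V => nu (elt g) * elt g) l (𝓝 (nu a * a)) := hnu.mul h
  have hr : Tendsto (fun g : spinG V => elt g * nu (elt g)) l (𝓝 (a * nu a)) := h.mul hnu
  have h1 : nu a * a = 1 :=
    tendsto_nhds_unique hl (tendsto_const_nhds.congr fun g => (nu_mul_elt g).symm)
  have h2 : a * nu a = 1 :=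
    tendsto_nhds_unique hr (tendsto_const_nhds.congr fun g => (elt_mul_nu g).symm)
  have h3 : ∀ p, sigma a (pv V p) = pv V (coords V (sigma a (pv V p))) := fun p => by
    have hp : Tendsto (fun g : spinG V => (elt g, p)) l (𝓝 (a, p)) :=
      h.prodMk_nhds tendsto_const_nhds
    have hs := (continuous_sigma_pv.tendsto (a, p)).comp hp
    have hs' := ((continuous_pv.comp continuous_coords).tendsto _).comp hs
    exact tendsto_nhds_unique hs (hs'.congr fun g => pv_lorentzMap g p)
  have h4 : tau a * prinAut a = 1 := by
    have := congrArg prinAut h1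
    rwa [prinAut_mul, nu, ← tau_prinAut, prinAut_prinAut, prinAut_one] at this
  have ht : IsTransformer a := fun w hw => by
    obtain ⟨p, rfl⟩ := mem_paravectors.mp hw
    refine ⟨_, pv_mem (coords V (sigma a (pv V p))), ?_⟩
    rw [← h3, sigma, mul_assoc, h4, mul_one]
  let u : (Cl V)ˣ := ⟨a, nu a, h2, h1⟩
  exact ⟨⟨u, ht, h1⟩, rfl⟩

/-- If the images converge along an ultrafilter, the factors at `x` and `-x` have limits. Their mean
is `Φ(g g^τ)`, so the elements stay in a compact set of `C`; the limit lies in the closed group and,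
by continuity, over the given transformation. -/
theorem isProperMap_mobiusHom (hV : 2 ≤ Module.finrank ℝ V) : IsProperMap (mobiusHom V) := by
  rw [isProperMap_iff_ultrafilter]
  refine ⟨continuous_mobiusHom, fun 𝒰 f hf => ?_⟩
  obtain ⟨x, -⟩ := exists_three_points hV
  obtain ⟨c, hc⟩ := exists_tendsto_denom_sq hV hf x
  obtain ⟨c', hc'⟩ := exists_tendsto_denom_sq hV hf (-x)
  -- Eventually the squared factors are below `c + 1` and `c' + 1`, so `2 t ≤ t² + 1` bounds the
  -- mean of the factors by `(c + c' + 4) / 4`. The absolute value makes `C ≥ 0` immediate.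
  let C := |c + c' + 4| / 2
  have hbound : ∀ᶠ g in (𝒰 : Filter (spinG V)), elt g ∈ {a : Cl V | scalarPart (tau a * a) ≤ C} := by
    filter_upwards [hc.eventually (gt_mem_nhds (lt_add_one c)),
      hc'.eventually (gt_mem_nhds (lt_add_one c'))] with g h1 h2
    rw [scalarPart_mul_comm, ← lorentzMap_one_fst, lorentzMap_one_fst_eq g x]
    have := le_abs_self (c + c' + 4)
    simp only [C]
    nlinarith [sq_nonneg (denom g (x : V) - 1), sq_nonneg (denom g ((-x : Sph V) : V) - 1)]
  obtain ⟨a, -, ha⟩ := (isCompact_scalarPart_le (C := C) (by positivity)).ultrafilter_le_nhds (𝒰.map elt)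
    (by rw [le_principal_iff]; exact hbound)
  obtain ⟨g, rfl⟩ := exists_elt_eq_of_tendsto (l := (𝒰 : Filter (spinG V))) (a := a) ha
  have hg : (𝒰 : Filter (spinG V)) ≤ 𝓝 g := by
    rw [isEmbedding_elt.nhds_eq_comap]
    exact map_le_iff_le_comap.mp ha
  refine ⟨g, ?_, hg⟩
  apply Subtype.ext
  ext1 y
  exact tendsto_nhds_unique
    (tendsto_apply ((continuous_mobiusHom.tendsto g).mono_left hg) y) (tendsto_apply hf y)

/-- A proper continuous surjection is closed, hence a quotient map, and a finite kernel in a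
Hausdorff group is discrete. -/
theorem isCoveringMap_mobiusHom (hV : 2 ≤ Module.finrank ℝ V) : IsCoveringMap (mobiusHom V) := by
  have := isTopologicalGroup_spinG (V := V)
  have := t2Space_spinG (V := V)
  have hq : IsQuotientMap (mobiusHom V) := (isProperMap_mobiusHom hV).isClosedMap.isQuotientMap
    continuous_mobiusHom (mobiusHom_surjective hV)
  have hk : ((mobiusHom V).ker : Set (spinG V)).Finite := by
    refine Set.Finite.subset (Set.toFinite {1, negOne V}) fun g hg => ?_
    exact (mobiusHom_eq_one_iff hV).mp hg
  exact (hq.isQuotientCoveringMap_of_isDiscrete_ker_monoidHom hk.isDiscrete).isCoveringMap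

end Covering

end SpinMobius

end

theorem theorem3 {V : Type*} [NormedAddCommGroup V] [InnerProductSpace ℝ V]
    [FiniteDimensional ℝ V] (n : ℕ) (hn : 0 < n) [Fact (Module.finrank ℝ V = n + 1)] :
    -- `𝒢 = ψ⁺(Spin⁺(V¹, Q¹))`
    (fun g : (Cl V)ˣ => (g : Cl V)) '' (spinG V : Set (Cl V)ˣ) = psi '' spinPlus V ∧
    -- (i) `φ_g` is well defined, and `g ↦ φ_g` is an action of `𝒢` on the closed ball
    (Function.Injective (P : Ball V → Cl V) ∧
      (∀ (g : spinG V) (x : Ball V),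
        0 < scalarPart (sigma ((g : (Cl V)ˣ) : Cl V) (P x)) ∧
        P (phi g x) = normalizedSigma g x) ∧
      ∃ T : spinG V →* Equiv.Perm (Ball V), ∀ g x, T g x = phi g x) ∧
    -- (iii) the restriction to the sphere is a two-fold covering homomorphism
    (∃ T : spinG V →* mobiusGroupPlus V,
      (∀ (g : spinG V) (x : Sph V),
        sphToBall ((T g : Equiv.Perm (Sph V)) x) = phi g (sphToBall x)) ∧
      Function.Surjective T ∧
      IsCoveringMap T ∧
      ∀ f : mobiusGroupPlus V, (T ⁻¹' {f}).ncard = 2) ∧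
    -- (ii), (iv) the spin-boosts
    ∀ (α : ℝ) (u : V), 0 ≤ α → α < 1 → ‖u‖ = 1 →
      ∃ m ∈ spinBoosts V,
        ((m : (Cl V)ˣ) : Cl V) = (Real.sqrt (1 - α ^ 2))⁻¹ • (1 + α • vec V u) ∧
        -- (ii) the explicit formula
        (∀ x : Ball V, (phi m x : V) = boostMap α u x) ∧
        -- (iv) conformality on the sphere, and the pullback of the surface volume form
        (∃ D : Diffeomorph (𝓡 n) (𝓡 n) (Sph V) (Sph V) ∞,
          (∀ x : Sph V, sphToBall (D x) = phi m (sphToBall x)) ∧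
          (∀ x : Sph V, 0 < boostFactor α u x) ∧
          (∀ (x : Sph V) (v w : TangentSpace (𝓡 n) x),
            sphereMetric (n := n) (D x) (mfderiv (𝓡 n) (𝓡 n) D x v) (mfderiv (𝓡 n) (𝓡 n) D x w)
              = boostFactor α u x ^ 2 * sphereMetric (n := n) x v w) ∧
          (∀ (o : Orientation ℝ V (Fin (n + 1))) (x : Sph V)
            (v : Fin n → TangentSpace (𝓡 n) x),
            sphereVolumeForm o (D x) (fun i => mfderiv (𝓡 n) (𝓡 n) D x (v i))
              = boostFactor α u x ^ n * sphereVolumeForm o x v)) ∧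
        -- (iv) the pullback of the volume form of the ball
        (∀ x ∈ closedBall (0 : V) 1,
          DifferentiableAt ℝ (boostMap α u) x ∧
          ∀ (o : Orientation ℝ V (Fin (n + 1))) (v : Fin (n + 1) → V),
            o.volumeForm (fun i => fderiv ℝ (boostMap α u) x (v i))
              = boostFactor α u x ^ (n + 2) * o.volumeForm v) := by
  have hV : 2 ≤ Module.finrank ℝ V := by
    rw [(Fact.out : Module.finrank ℝ V = n + 1)]; omega
  refine ⟨image_spinG_eq, ⟨P_injective, fun g x => ⟨?_, P_phi g x⟩, ballHom V, fun _ _ => rfl⟩,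
    ⟨mobiusHom V, fun _ _ => rfl, mobiusHom_surjective hV, isCoveringMap_mobiusHom hV,
      ncard_fiber_mobiusHom hV⟩,
    fun α u hα0 hα1 hu => boosts_spec hα0 hα1 hu⟩
  exact (scalarPart_sigma_P g x).symm ▸ denom_pos g x
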